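/- Let $d\ge 1$, $\alpha\in(0,2)$, $\beta\in(0,1)$, $\kappa_0>0$ and $\kappa_1,\kappa_2\in\mathbb R$. Let $\kappa:\mathbb R^d\times\mathbb R^d\to\mathbb R$ be measurable with $$\kappa_0\le\kappa(x,z)\le\kappa_1,\qquad \kappa(x,z)=\kappa(x,-z),\qquad |\kappa(x,z)-\kappa(y,z)|\le\kappa_2|x-y|^\beta\qquad (x,y,z\in\mathbb R^d).$$ For $b,c\in\mathbb R$ put $\varrho^{b}_{c}(t,x):=t^{c/\alpha}(|x|^{b}\wedge 1)(t^{1/\alpha}+|x|)^{-d-\alpha}$ (with $|x|^0:=1$), and put $$\mathscr L^{\kappa(y)}f(x):=\tfrac12\int_{\mathbb R^d}\big(f(x+z)+f(x-z)-2f(x)\big)\,\kappa(y,z)\,|z|^{-d-\alpha}\,dz .$$ Let $p_y(t,x)$ be the heat kernel of $\mathscr L^{\kappa(y)}$, $y$ fixed, i.e. the transition density $$p_y(t,x)=(2\pi)^{-d}\int_{\mathbb R^d} e^{i\langle\xi,x\rangle}e^{-t\psi_y(\xi)}\,d\xi,\qquad \psi_y(\xi)=\int_{\mathbb R^d}(1-\cos\langle\xi,z\rangle)\,\kappa(y,z)\,|z|^{-d-\alpha}\,dz,$$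 of the symmetric Lévy process generated by $\mathscr L^{\kappa(y)}$. For $t\in(0,1]$ and $x,y\in\mathbb R^d$ set $$q_0(t,x,y):=\big(\mathscr L^{\kappa(x)}-\mathscr L^{\kappa(y)}\big)p_y(t,\cdot)(x-y),\qquad q_n(t,x,y):=\int_0^t\!\!\int_{\mathbb R^d}q_0(t-s,x,z)\,q_{n-1}(s,z,y)\,dz\,ds\quad(n\ge1).$$ Then the following holds. (a) For each $y$, $p_y(t,\cdot)$ is integrable for $t>0$, $\partial_tp_y(t,x)=\mathscr L^{\kappa(y)}p_y(t,\cdot)(x)$ for all $t>0$ and $x$, and $\int p_y(t,x)f(x)\,dx\to f(0)$ as $t\downarrow0$ for every bounded continuous $f$. The integrals defining $\mathscr L^{\kappa(x)}p_y(t,\cdot)$ and $q_n$ converge absolutely for $t\in(0,1]$. (b) For all $t\in(0,1]$ and $x,y\in\mathbb R^d$ the series $q(t,x,y):=\sum_{n\ge0}q_n(t,x,y)$ converges absolutely and $$q(t,x,y)=q_0(t,x,y)+\int_0^t\!\!\int_{\mathbb R^d}q_0(t-s,x,z)\,q(s,z,y)\,dz\,ds,$$ where the double integral converges absolutely. (c)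 There is a constant $C_1>0$, depending only on $d,\alpha,\beta,\kappa_0,\kappa_1,\kappa_2$, such that for all $t\in(0,1]$ and $x,y\in\mathbb R^d$ $$|q(t,x,y)|\le C_1\,(\varrho^\beta_0+\varrho^0_\beta)(t,x-y).$$ (d) For every $\gamma\in(0,\beta)$ there is a constant $C_2>0$, depending only on $d,\alpha,\beta,\gamma,\kappa_0,\kappa_1,\kappa_2$, such that for all $t\in(0,1]$ and $x,x',y\in\mathbb R^d$ $$|q(t,x,y)-q(t,x',y)|\le C_2\big(|x-x'|^{\beta-\gamma}\wedge1\big)\Big((\varrho^0_\gamma+\varrho^\beta_{\gamma-\beta})(t,x-y)+(\varrho^0_\gamma+\varrho^\beta_{\gamma-\beta})(t,x'-y)\Big).$$ -/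

import Mathlib

open MeasureTheory Filter Topology Set
open scoped BoundedContinuousFunction

namespace StableLike

noncomputable section

/-- The space `ℝ^d` with its Euclidean norm. -/
abbrev E (d : ℕ) : Type := EuclideanSpace ℝ (Fin d)

/-- The standing assumptions on the kernel `κ(x,z)`: it is jointly measurable, lies between `κ₀` and
`κ₁`, is symmetric in `z`, and is `β`-Hölder in `x` with constant `κ₂`, uniformly in `z`. -/
structure IsKernel (d : ℕ) (β κ₀ κ₁ κ₂ : ℝ) (κ : E d → E d → ℝ) : Prop where
  measurable : Measurable (Function.uncurry κ)
  lower : ∀ x z, κ₀ ≤ κ x z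
  upper : ∀ x z, κ x z ≤ κ₁
  symm : ∀ x z, κ x z = κ x (-z)
  holder : ∀ x y z, |κ x z - κ y z| ≤ κ₂ * ‖x - y‖ ^ β

/-- `ϱ^β_γ(t,x) = t^{γ/α} (|x|^β ∧ 1) (t^{1/α} + |x|)^{-d-α}`; here `|x|^0 = 1`, also at `x = 0`. -/
def rho (d : ℕ) (α β γ t : ℝ) (x : E d) : ℝ :=
  t ^ (γ / α) * min (‖x‖ ^ β) 1 * (t ^ (1 / α) + ‖x‖) ^ (-(d : ℝ) - α)

/-- The second difference `δ_f(x;z) = f(x+z) + f(x-z) - 2 f(x)`. -/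
def secondDiff {d : ℕ} (f : E d → ℝ) (x z : E d) : ℝ :=
  f (x + z) + f (x - z) - 2 * f x

/-- The symmetric non-local operator with the space-independent kernel `k`,
`L^k f(x) = (1/2) ∫ δ_f(x;z) k(z) |z|^{-d-α} dz`. -/
def opL (d : ℕ) (α : ℝ) (k : E d → ℝ) (f : E d → ℝ) (x : E d) : ℝ :=
  (1 / 2) * ∫ z, secondDiff f x z * k z * ‖z‖ ^ (-(d : ℝ) - α)

/-- The Fourier symbol of `-L^k` (the Lévy exponent),
`ψ(ξ) = ∫ (1 - cos ⟨ξ,z⟩) k(z) |z|^{-d-α} dz`. -/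
def symbol (d : ℕ) (α : ℝ) (k : E d → ℝ) (ξ : E d) : ℝ :=
  ∫ z, (1 - Real.cos (inner ℝ ξ z)) * k z * ‖z‖ ^ (-(d : ℝ) - α)

/-- The heat kernel of `L^k` for a symmetric `k` bounded above and below by positive constants:
the transition density of the symmetric Lévy process generated by `L^k`, that is, the inverse
Fourier transform `(2π)^{-d} ∫ e^{i⟨ξ,x⟩} e^{-tψ(ξ)} dξ` (which is real because `ψ` is even). -/
def heatKernel (d : ℕ) (α : ℝ) (k : E d → ℝ) (t : ℝ) (x : E d) : ℝ :=
  (2 * Real.pi) ^ (-(d : ℝ)) *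
    ∫ ξ, Real.cos (inner ℝ ξ x) * Real.exp (-t * symbol d α k ξ)

/-- `p` is a heat kernel of `L^k`: `∂_t p(t,x) = L^k p(t,·)(x)` for all `t > 0` and `x`, and
`p(t,·)` tends to the Dirac mass at `0` as `t ↓ 0`, tested against bounded continuous functions. -/
structure IsHeatKernel (d : ℕ) (α : ℝ) (k : E d → ℝ) (p : ℝ → E d → ℝ) : Prop where
  integrable : ∀ t, 0 < t → Integrable (p t)
  hasDerivAt : ∀ t x, 0 < t → HasDerivAt (fun s => p s x) (opL d α k (p t) x) t
  tendsto_dirac : ∀ f : E d →ᵇ ℝ,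
    Tendsto (fun t => ∫ x, p t x * f x) (𝓝[>] 0) (𝓝 (f 0))

/-- `q₀(t,x,y) = (L^{κ(x)} - L^{κ(y)}) p_y(t,·)(x-y)`, where `L^{κ(y)}` is the operator with the
frozen kernel `κ(y,·)` and `p_y` is its heat kernel. -/
def q0 (d : ℕ) (α : ℝ) (κ : E d → E d → ℝ) (t : ℝ) (x y : E d) : ℝ :=
  opL d α (κ x) (heatKernel d α (κ y) t) (x - y) -
    opL d α (κ y) (heatKernel d α (κ y) t) (x - y)

/-- The space-time convolution `(f ⊛ g)(t,x,y) = ∫_0^t ∫ f(t-s,x,z) g(s,z,y) dz ds`. -/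
def conv {d : ℕ} (f g : ℝ → E d → E d → ℝ) (t : ℝ) (x y : E d) : ℝ :=
  ∫ s in (0 : ℝ)..t, ∫ z, f (t - s) x z * g s z y

/-- Absolute convergence of the double integral that defines `(f ⊛ g)(t,x,y)`. -/
def ConvIntegrable {d : ℕ} (f g : ℝ → E d → E d → ℝ) (t : ℝ) (x y : E d) : Prop :=
  Integrable (fun w : ℝ × E d => f (t - w.1) x w.2 * g w.1 w.2 y)
    ((volume.restrict (Ioc 0 t)).prod volume)

/-- The Picard iterates: `q_0` as above and `q_{n+1} = q_0 ⊛ q_n`. -/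
def qIter (d : ℕ) (α : ℝ) (κ : E d → E d → ℝ) : ℕ → ℝ → E d → E d → ℝ
  | 0 => q0 d α κ
  | n + 1 => conv (q0 d α κ) (qIter d α κ n)

/-- The sum of the Picard series, `q = ∑ q_n`. -/
def qSum (d : ℕ) (α : ℝ) (κ : E d → E d → ℝ) (t : ℝ) (x y : E d) : ℝ :=
  ∑' n, qIter d α κ n t x y

end

end StableLike

namespace StableLike

noncomputable section

/-! This is the parametrix method. All input on the frozen kernels is proved at time one, uniformly
over the class `IsDensity` of measurable symmetric densities between `κ₀` and `κ₁`. Dilations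
preserve this class, so scaling carries the estimates to every time (`exists_heatKernelBounds`).

At time one the jumps are cut at size one. The symbol of the small jumps is smooth with controlled
derivatives and is at least `c (|ξ|^α - 1)`, so its exponential and all derivatives of it decay
faster than any power. Hence the small-jump density has well-localised derivatives
(`exists_fourier_smallChar_le`). The large jumps have an integrable density bounded by a multiple of
`decay`. As `decay * decay ≤ C decay`, the exponential series of convolutions with that density
preserves the decay rate (`norm_osc_mul_largePart_le`). Finite differences in space are Fourier
multipliers and go through the same argument, which controls second differences and their
increments. Lipschitz dependence on the density comes from Duhamel's formula along the segment from
`k'` to `k` (`exists_osc_charFn_sub_le`).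

For `q₀` this gives a size bound, a bound for increments in `x`, and a bound for simultaneous shifts
of `x` and `y`, all in terms of the single weight `wt`, which is below the sum of the two `rho`
terms of the theorem. The weights satisfy a pointwise product inequality (`wt_mul_wt_le`), and their
spatial mass is at most a constant times `s^{θ/α - 1}` for some `θ > 0`. With an extra factor
`e^{λs}`, a space-time convolution of weights gains a negative power of `λ`
(`exists_integrable_convWt`). For large `λ`, convolution with `q₀` therefore halves the relevant
norm. The Picard series is dominated by a geometric one, and convergence, the integral equation and
the pointwise bound follow.

For the Hölder estimate the bound `(t^{-1/α} |x - x'|)^{β-γ}`, times weights, is propagated through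
the iteration with the same factor `1/2`. For `s ≤ t/2` the kernel `q₀(t-s, ·, z)` is still regular
and its increment in `x` is used. For `s > t/2` that increment may be too singular in `t - s` to
integrate; the variable `z` is translated by `x - x'`, so that the increment falls partly on a joint
shift of `q₀`, which carries no extra time singularity, and partly on `q_n(s, ·, y)`, where `s` is
comparable to `t` (`HoelderBounds.ae_le`). -/

/-- The weight `(1 + |x|)^{-d-α}`. -/
def decay (d : ℕ) (α : ℝ) (x : E d) : ℝ := (1 + ‖x‖) ^ (-(d : ℝ) - α)

/-- The jump density `|z|^{-d-α}` of the isotropic stable process. -/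
def levy (d : ℕ) (α : ℝ) (z : E d) : ℝ := ‖z‖ ^ (-(d : ℝ) - α)

/-! ### Convolution inequalities for polynomial decay. -/

section Decay

variable {d : ℕ} {α : ℝ}

lemma decay_pos (x : E d) : 0 < decay d α x := by unfold decay; positivity

lemma levy_nonneg (x : E d) : 0 ≤ levy d α x := by unfold levy; positivity

lemma measurable_levy : Measurable (levy d α) := by unfold levy; fun_prop

lemma measurable_decay : Measurable (decay d α) := by unfold decay; fun_prop

lemma decay_neg (x : E d) : decay d α (-x) = decay d α x := by simp [decay]

lemma integrable_decay (hα : 0 < α) : Integrable (decay d α) := by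
  have := integrable_one_add_norm (E := E d) (μ := volume) (r := (d : ℝ) + α) (by simpa using hα)
  refine this.congr (ae_of_all _ fun x => ?_)
  simp only [decay]; congr 1; ring

/-- Dilating the argument costs a constant factor. -/
lemma decay_le_mul (hα : 0 < α) {A : ℝ} (hA : 0 < A) {x y : E d}
    (h : 1 + ‖y‖ ≤ A * (1 + ‖x‖)) :
    decay d α x ≤ A ^ ((d : ℝ) + α) * decay d α y := by
  have hd : (0 : ℝ) ≤ d := d.cast_nonneg
  have h1 : decay d α x ≤ ((1 + ‖y‖) / A) ^ (-(d : ℝ) - α) :=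
    Real.rpow_le_rpow_of_nonpos (by positivity) (by rwa [div_le_iff₀' hA]) (by linarith)
  refine h1.trans_eq ?_
  rw [Real.div_rpow (by positivity) hA.le, decay, div_eq_mul_inv, mul_comm,
    ← Real.rpow_neg hA.le]
  congr 2; ring

lemma decay_le_of_le (hα : 0 < α) {x y : E d} (h : 1 + ‖y‖ ≤ 2 * (1 + ‖x‖)) :
    decay d α x ≤ 2 ^ ((d : ℝ) + α) * decay d α y := decay_le_mul hα two_pos h

lemma decay_add_le (hα : 0 < α) (x : E d) {a : E d} (ha : ‖a‖ ≤ 1) :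
    decay d α (x + a) ≤ 2 ^ ((d : ℝ) + α) * decay d α x := by
  refine decay_le_of_le hα ?_
  have := norm_sub_le (x + a) a
  rw [add_sub_cancel_right] at this
  linarith [norm_nonneg (x + a)]

/-- Of `x - z` and `z`, the longer one has norm at least `|x|/2`, so its factor is comparable to the
decay at `x`. Integrating in `z` gives the stability of `decay` under convolution. -/
lemma decay_mul_le (hα : 0 < α) (x z : E d) :
    decay d α (x - z) * decay d α z ≤
      2 ^ ((d : ℝ) + α) * decay d α x * (decay d α (x - z) + decay d α z) := by
  have h0 := norm_add_le (x - z) z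
  rw [sub_add_cancel] at h0
  have hx := (decay_pos (α := α) x).le
  have hz := (decay_pos (α := α) z).le
  have hxz := (decay_pos (α := α) (x - z)).le
  have h2 : (0 : ℝ) ≤ 2 ^ ((d : ℝ) + α) := by positivity
  rcases le_total ‖z‖ ‖x - z‖ with h | h
  · have := decay_le_of_le hα (x := x - z) (y := x) (by linarith)
    nlinarith [mul_le_mul_of_nonneg_right this hz, mul_nonneg (mul_nonneg h2 hx) hxz]
  · have := decay_le_of_le hα (x := z) (y := x) (by linarith)
    nlinarith [mul_le_mul_of_nonneg_right this hxz, mul_nonneg (mul_nonneg h2 hx) hz]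

lemma levy_le_decay (hα : 0 < α) {z : E d} (hz : 1 ≤ ‖z‖) :
    levy d α z ≤ 2 ^ ((d : ℝ) + α) * decay d α z := by
  have hd : (0 : ℝ) ≤ d := d.cast_nonneg
  have h1 : levy d α z ≤ ((1 + ‖z‖) / 2) ^ (-(d : ℝ) - α) :=
    Real.rpow_le_rpow_of_nonpos (by positivity) (by linarith) (by linarith)
  refine h1.trans_eq ?_
  rw [Real.div_rpow (by positivity) (by positivity), decay, div_eq_mul_inv, mul_comm,
    ← Real.rpow_neg (by positivity)]
  congr 2; ring

/-- The constant in `decay * decay ≤ C decay`. -/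
def decayConst (d : ℕ) (α : ℝ) : ℝ := 2 * 2 ^ ((d : ℝ) + α) * ∫ z, decay d α z

lemma decayConst_nonneg : 0 ≤ decayConst d α :=
  mul_nonneg (by positivity) (integral_nonneg fun z => (decay_pos z).le)

lemma integrable_decay_mul (hα : 0 < α) (x : E d) :
    Integrable (fun z => decay d α (x - z) * decay d α z) := by
  have h1 := (integrable_decay (d := d) hα).comp_sub_left x
  refine ((h1.add (integrable_decay hα)).const_mul (2 ^ ((d : ℝ) + α) * decay d α x)).mono'
    ((measurable_decay.comp (measurable_const.sub measurable_id)).mul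
      measurable_decay).aestronglyMeasurable (ae_of_all _ fun z => ?_)
  rw [Real.norm_of_nonneg (mul_nonneg (decay_pos _).le (decay_pos _).le)]
  exact decay_mul_le hα x z

lemma integral_decay_mul_le (hα : 0 < α) (x : E d) :
    ∫ z, decay d α (x - z) * decay d α z ≤ decayConst d α * decay d α x := by
  have h1 := (integrable_decay (d := d) hα).comp_sub_left x
  refine (integral_mono (integrable_decay_mul hα x)
    ((h1.add (integrable_decay hα)).const_mul (2 ^ ((d : ℝ) + α) * decay d α x))
    fun z => decay_mul_le hα x z).trans_eq ?_
  rw [integral_const_mul]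
  simp only [Pi.add_apply]
  rw [integral_add h1 (integrable_decay hα), integral_sub_left_eq_self (decay d α), decayConst]
  ring

/-- In polar coordinates the radial integrand is `r^{1-α}` near zero, integrable since `α < 2`, and
`r^{-1-α}` near infinity, integrable since `α > 0`. -/
lemma integrable_min_sq_levy (hd : 1 ≤ d) (hα0 : 0 < α) (hα2 : α < 2) :
    Integrable (fun z : E d => min (‖z‖ ^ 2) 1 * levy d α z) := by
  have : Nonempty (Fin d) := ⟨⟨0, hd⟩⟩
  refine (integrable_fun_norm_addHaar (volume : Measure (E d))
    (f := fun r => min (r ^ 2) 1 * r ^ (-(d : ℝ) - α))).2 ?_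
  have hpow : ∀ r : ℝ, 0 < r → r ^ (d - 1) * r ^ (-(d : ℝ) - α) = r ^ (-1 - α) := by
    intro r hr
    rw [← Real.rpow_natCast, ← Real.rpow_add hr, Nat.cast_sub hd]
    congr 1; push_cast; ring
  simp only [finrank_euclideanSpace, Fintype.card_fin, smul_eq_mul]
  rw [← Ioc_union_Ioi_eq_Ioi zero_le_one]
  refine IntegrableOn.union ?_ ?_
  · have h1 : IntegrableOn (fun r : ℝ => r ^ (1 - α)) (Ioc 0 1) :=
      (intervalIntegrable_iff_integrableOn_Ioc_of_le zero_le_one).1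
        (intervalIntegral.intervalIntegrable_rpow' (by linarith))
    refine h1.congr_fun (fun r hr => ?_) measurableSet_Ioc
    have h2 : r ^ 2 ≤ 1 := by nlinarith [hr.1, hr.2]
    simp only []
    rw [min_eq_left h2, mul_left_comm, hpow r hr.1, ← Real.rpow_natCast, ← Real.rpow_add hr.1]
    congr 1; push_cast; ring
  · have h1 : IntegrableOn (fun r : ℝ => r ^ (-1 - α)) (Ioi 1) :=
      integrableOn_Ioi_rpow_of_lt (by linarith) one_pos
    refine h1.congr_fun (fun r hr => ?_) measurableSet_Ioi
    have hr' : (1 : ℝ) < r := hr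
    have h2 : 1 ≤ r ^ 2 := by nlinarith
    simp only []
    rw [min_eq_right h2, one_mul, hpow r (by linarith)]

/-- The total mass `∫ (|z|² ∧ 1) |z|^{-d-α} dz`. -/
def levyMass (d : ℕ) (α : ℝ) : ℝ := ∫ z : E d, min (‖z‖ ^ 2) 1 * levy d α z

lemma levyMass_nonneg : 0 ≤ levyMass d α :=
  integral_nonneg fun z => mul_nonneg (by positivity) (levy_nonneg z)

/-- The weight that dominates second differences of the heat kernel at time one. -/
def diffWeight (d : ℕ) (α : ℝ) (x z : E d) : ℝ :=
  min (‖z‖ ^ 2) 1 * (decay d α x + decay d α (x + z) + decay d α (x - z))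

lemma diffWeight_nonneg (x z : E d) : 0 ≤ diffWeight d α x z := by
  have h1 := (decay_pos (α := α) x).le
  have h2 := (decay_pos (α := α) (x + z)).le
  have h3 := (decay_pos (α := α) (x - z)).le
  unfold diffWeight; positivity

lemma measurable_diffWeight (x : E d) : Measurable (diffWeight d α x) := by
  unfold diffWeight decay; fun_prop

/-- For `|z| ≤ 1` the three decay factors are comparable to the one at `x`. For `|z| ≥ 1` the jump
density is itself bounded by `decay`, and the shifted terms become convolution integrands. The last
term is written in `-z` so that a reflection reduces it to the previous one. -/
lemma diffWeight_mul_levy_le (hα : 0 < α) (x z : E d) :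
    diffWeight d α x z * levy d α z ≤
      (1 + 2 * 2 ^ ((d : ℝ) + α)) * decay d α x * (min (‖z‖ ^ 2) 1 * levy d α z) +
      2 ^ ((d : ℝ) + α) * (decay d α (x - z) * decay d α z +
        decay d α (x - (-z)) * decay d α (-z)) := by
  have h1 := (decay_pos (α := α) x).le
  have h2 := (decay_pos (α := α) (x + z)).le
  have h3 := (decay_pos (α := α) (x - z)).le
  have h4 := (decay_pos (α := α) z).le
  have hl := levy_nonneg (α := α) z
  have hm : (0 : ℝ) ≤ min (‖z‖ ^ 2) 1 := by positivity
  have hC : (0 : ℝ) ≤ 2 ^ ((d : ℝ) + α) := by positivity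
  rw [sub_neg_eq_add, decay_neg]
  rcases le_total ‖z‖ 1 with hz | hz
  · have e1 := decay_add_le hα x hz
    have e2 := decay_add_le hα x (a := -z) (by simpa using hz)
    rw [← sub_eq_add_neg] at e2
    have : diffWeight d α x z * levy d α z ≤
        (1 + 2 * 2 ^ ((d : ℝ) + α)) * decay d α x * (min (‖z‖ ^ 2) 1 * levy d α z) := by
      unfold diffWeight
      rw [mul_comm (min _ _), mul_assoc]
      refine mul_le_mul_of_nonneg_right (by linarith) (by positivity)
    refine this.trans (le_add_of_nonneg_right (by positivity))
  · have e := levy_le_decay hα hz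
    have hm1 : min (‖z‖ ^ 2) 1 = 1 := min_eq_right (by nlinarith)
    unfold diffWeight
    rw [hm1]
    have e1 := mul_le_mul_of_nonneg_left e h2
    have e2 := mul_le_mul_of_nonneg_left e h3
    nlinarith [mul_nonneg hC (mul_nonneg h1 hl)]

lemma integrable_diffWeight (hd : 1 ≤ d) (hα0 : 0 < α) (hα2 : α < 2) (x : E d) :
    Integrable (fun z => diffWeight d α x z * levy d α z) := by
  have i1 := integrable_decay_mul (d := d) hα0 x
  have i2 : Integrable (fun z => decay d α (x - z) * decay d α z +
      decay d α (x - (-z)) * decay d α (-z)) := i1.add i1.comp_neg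
  refine (((integrable_min_sq_levy hd hα0 hα2).const_mul
    ((1 + 2 * 2 ^ ((d : ℝ) + α)) * decay d α x)).add
    (i2.const_mul (2 ^ ((d : ℝ) + α)))).mono'
    ((measurable_diffWeight x).mul measurable_levy).aestronglyMeasurable
    (ae_of_all _ fun z => ?_)
  rw [Real.norm_of_nonneg (mul_nonneg (diffWeight_nonneg x z) (levy_nonneg z))]
  exact diffWeight_mul_levy_le hα0 x z

/-- The constant in the integrated second difference bound. -/
def diffConst (d : ℕ) (α : ℝ) : ℝ :=
  (1 + 2 * 2 ^ ((d : ℝ) + α)) * levyMass d α + 2 * 2 ^ ((d : ℝ) + α) * decayConst d α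

lemma diffConst_nonneg : 0 ≤ diffConst d α := by
  have h1 := levyMass_nonneg (d := d) (α := α)
  have h2 := decayConst_nonneg (d := d) (α := α)
  unfold diffConst; positivity

/-- This turns pointwise bounds on second differences into bounds for the nonlocal operators: at
time one, applying such an operator costs only a constant. -/
lemma integral_diffWeight_le (hd : 1 ≤ d) (hα0 : 0 < α) (hα2 : α < 2) (x : E d) :
    ∫ z, diffWeight d α x z * levy d α z ≤ diffConst d α * decay d α x := by
  have i1 := integrable_decay_mul (d := d) hα0 x
  have i0 := integrable_min_sq_levy hd hα0 hα2
  have i2 : Integrable (fun z => decay d α (x - z) * decay d α z +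
      decay d α (x - (-z)) * decay d α (-z)) := i1.add i1.comp_neg
  refine (integral_mono (integrable_diffWeight hd hα0 hα2 x) ((i0.const_mul _).add
    (i2.const_mul _)) fun z => diffWeight_mul_levy_le hα0 x z).trans ?_
  simp only [Pi.add_apply]
  rw [integral_add (i0.const_mul _) (i2.const_mul _), integral_const_mul,
    integral_const_mul, integral_add i1 i1.comp_neg,
    integral_neg_eq_self (fun z => decay d α (x - z) * decay d α z)]
  have := integral_decay_mul_le hα0 x
  have h2 : (0 : ℝ) ≤ 2 ^ ((d : ℝ) + α) := by positivity
  rw [← levyMass, diffConst]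
  nlinarith [mul_le_mul_of_nonneg_left this h2]

end Decay

/-- Measurable symmetric functions between `κ₀` and `κ₁`. -/
structure IsDensity (d : ℕ) (κ₀ κ₁ : ℝ) (k : E d → ℝ) : Prop where
  measurable : Measurable k
  lower : ∀ z, κ₀ ≤ k z
  upper : ∀ z, k z ≤ κ₁
  symm : ∀ z, k z = k (-z)

/-! ### The Lévy symbol: linearity, scaling, truncation at jump size one, and growth. -/

section Symbol

variable {d : ℕ} {α β κ₀ κ₁ κ₂ : ℝ} {k : E d → ℝ}

lemma IsKernel.isDensity {κ : E d → E d → ℝ} (h : IsKernel d β κ₀ κ₁ κ₂ κ) (x : E d) :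
    IsDensity d κ₀ κ₁ (κ x) :=
  ⟨h.measurable.comp (measurable_const.prodMk measurable_id), h.lower x, h.upper x, h.symm x⟩

lemma IsDensity.abs_le (hk : IsDensity d κ₀ κ₁ k) (h0 : 0 < κ₀) (z : E d) : |k z| ≤ κ₁ := by
  rw [abs_of_nonneg (h0.le.trans (hk.lower z))]; exact hk.upper z

lemma IsDensity.upper_nonneg (hk : IsDensity d κ₀ κ₁ k) (h0 : 0 < κ₀) : 0 ≤ κ₁ :=
  (abs_nonneg _).trans (hk.abs_le h0 0)

lemma IsDensity.comp_smul (hk : IsDensity d κ₀ κ₁ k) (r : ℝ) :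
    IsDensity d κ₀ κ₁ (fun z => k (r • z)) :=
  ⟨hk.measurable.comp (measurable_const_smul r), fun z => hk.lower _, fun z => hk.upper _,
    fun z => by rw [smul_neg]; exact hk.symm _⟩

lemma one_sub_cos_nonneg (u : ℝ) : 0 ≤ 1 - Real.cos u := by linarith [Real.cos_le_one u]

lemma one_sub_cos_inner_le (ξ z : E d) :
    1 - Real.cos (inner ℝ ξ z) ≤ 2 * (1 + ‖ξ‖ ^ 2) * min (‖z‖ ^ 2) 1 := by
  have h1 := Real.one_sub_sq_div_two_le_cos (x := inner ℝ ξ z)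
  have h2 := Real.neg_one_le_cos (inner ℝ ξ z)
  have h3 : (inner ℝ ξ z) ^ 2 ≤ (‖ξ‖ * ‖z‖) ^ 2 :=
    sq_le_sq' (by linarith [abs_le.1 (abs_real_inner_le_norm ξ z)])
      (abs_le.1 (abs_real_inner_le_norm ξ z)).2
  rcases min_cases (‖z‖ ^ 2) 1 with ⟨h, _⟩ | ⟨h, _⟩ <;> rw [h]
  · nlinarith [sq_nonneg ‖z‖, sq_nonneg (‖ξ‖ * ‖z‖)]
  · nlinarith [sq_nonneg ‖ξ‖]

/-- Integrability of the integrand of the symbol, for a bounded density. -/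
lemma integrable_one_sub_cos (hd : 1 ≤ d) (hα0 : 0 < α) (hα2 : α < 2) {K : ℝ}
    (hm : Measurable k) (hK : ∀ z, |k z| ≤ K) (ξ : E d) :
    Integrable (fun z => (1 - Real.cos (inner ℝ ξ z)) * k z * levy d α z) := by
  refine ((integrable_min_sq_levy hd hα0 hα2).const_mul (2 * (1 + ‖ξ‖ ^ 2) * K)).mono'
    (((by fun_prop : Measurable fun z : E d => 1 - Real.cos (inner ℝ ξ z)).mul hm).mul
      measurable_levy).aestronglyMeasurable (ae_of_all _ fun z => ?_)
  rw [norm_mul, norm_mul, Real.norm_of_nonneg (one_sub_cos_nonneg _),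
    Real.norm_of_nonneg (levy_nonneg z), Real.norm_eq_abs]
  have h1 := one_sub_cos_inner_le ξ z
  have h2 := one_sub_cos_nonneg (inner ℝ ξ z)
  calc _ ≤ 2 * (1 + ‖ξ‖ ^ 2) * min (‖z‖ ^ 2) 1 * K * levy d α z := by
        gcongr
        · exact levy_nonneg z
        · exact hK z
    _ = _ := by ring

lemma symbol_eq (ξ : E d) :
    symbol d α k ξ = ∫ z, (1 - Real.cos (inner ℝ ξ z)) * k z * levy d α z := rfl

lemma abs_symbol_le (hd : 1 ≤ d) (hα0 : 0 < α) (hα2 : α < 2) {K : ℝ}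
    (hK : ∀ z, |k z| ≤ K) (ξ : E d) :
    |symbol d α k ξ| ≤ 2 * (1 + ‖ξ‖ ^ 2) * K * levyMass d α := by
  rw [symbol_eq, ← Real.norm_eq_abs, levyMass, ← integral_const_mul]
  refine norm_integral_le_of_norm_le ((integrable_min_sq_levy hd hα0 hα2).const_mul _)
    (ae_of_all _ fun z => ?_)
  rw [norm_mul, norm_mul, Real.norm_of_nonneg (one_sub_cos_nonneg _),
    Real.norm_of_nonneg (levy_nonneg z), Real.norm_eq_abs]
  have h1 := one_sub_cos_inner_le ξ z
  have h2 := one_sub_cos_nonneg (inner ℝ ξ z)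
  calc _ ≤ 2 * (1 + ‖ξ‖ ^ 2) * min (‖z‖ ^ 2) 1 * K * levy d α z := by
        gcongr
        · exact levy_nonneg z
        · exact hK z
    _ = _ := by ring

lemma symbol_nonneg (hk : ∀ z, 0 ≤ k z) (ξ : E d) : 0 ≤ symbol d α k ξ :=
  integral_nonneg fun z => mul_nonneg (mul_nonneg (one_sub_cos_nonneg _) (hk z)) (levy_nonneg z)

lemma symbol_zero : symbol d α k 0 = 0 := by simp [symbol]

lemma symbol_sub (hd : 1 ≤ d) (hα0 : 0 < α) (hα2 : α < 2) {k' : E d → ℝ} {K K' : ℝ}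
    (hm : Measurable k) (hm' : Measurable k') (hK : ∀ z, |k z| ≤ K) (hK' : ∀ z, |k' z| ≤ K')
    (ξ : E d) :
    symbol d α (fun z => k z - k' z) ξ = symbol d α k ξ - symbol d α k' ξ := by
  simp only [symbol_eq]
  rw [← integral_sub (integrable_one_sub_cos hd hα0 hα2 hm hK ξ)
    (integrable_one_sub_cos hd hα0 hα2 hm' hK' ξ)]
  congr 1; ext z; ring

lemma symbol_add (hd : 1 ≤ d) (hα0 : 0 < α) (hα2 : α < 2) {k' : E d → ℝ} {K K' : ℝ}
    (hm : Measurable k) (hm' : Measurable k') (hK : ∀ z, |k z| ≤ K) (hK' : ∀ z, |k' z| ≤ K')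
    (ξ : E d) :
    symbol d α (fun z => k z + k' z) ξ = symbol d α k ξ + symbol d α k' ξ := by
  simp only [symbol_eq]
  rw [← integral_add (integrable_one_sub_cos hd hα0 hα2 hm hK ξ)
    (integrable_one_sub_cos hd hα0 hα2 hm' hK' ξ)]
  congr 1; ext z; ring

lemma symbol_const_mul (c : ℝ) (ξ : E d) :
    symbol d α (fun z => c * k z) ξ = c * symbol d α k ξ := by
  simp only [symbol_eq]
  rw [← integral_const_mul]
  congr 1; ext z; ring

lemma continuous_symbol (hd : 1 ≤ d) (hα0 : 0 < α) (hα2 : α < 2) {K : ℝ}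
    (hm : Measurable k) (hK : ∀ z, |k z| ≤ K) : Continuous (symbol d α k) := by
  refine continuous_iff_continuousAt.2 fun ξ₀ => ?_
  have hK0 : 0 ≤ K := (abs_nonneg _).trans (hK 0)
  refine continuousAt_of_dominated
    (bound := fun z => 2 * (1 + (‖ξ₀‖ + 1) ^ 2) * K * (min (‖z‖ ^ 2) 1 * levy d α z))
    (Eventually.of_forall fun ξ =>
      (integrable_one_sub_cos hd hα0 hα2 hm hK ξ).aestronglyMeasurable) ?_
    ((integrable_min_sq_levy hd hα0 hα2).const_mul _) (ae_of_all _ fun z => by fun_prop)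
  filter_upwards [Metric.ball_mem_nhds ξ₀ one_pos] with ξ hξ
  refine ae_of_all _ fun z => ?_
  have h0 : ‖ξ‖ ≤ ‖ξ₀‖ + 1 := by
    have := norm_sub_norm_le ξ ξ₀
    rw [mem_ball_iff_norm] at hξ
    linarith
  change ‖(1 - Real.cos (inner ℝ ξ z)) * k z * levy d α z‖ ≤ _
  rw [norm_mul, norm_mul, Real.norm_of_nonneg (one_sub_cos_nonneg _),
    Real.norm_of_nonneg (levy_nonneg z), Real.norm_eq_abs]
  have h1 := one_sub_cos_inner_le ξ z
  have h2 := one_sub_cos_nonneg (inner ℝ ξ z)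
  calc _ ≤ 2 * (1 + (‖ξ₀‖ + 1) ^ 2) * min (‖z‖ ^ 2) 1 * K * levy d α z := by
        gcongr
        · exact levy_nonneg z
        · exact h1.trans (by gcongr)
        · exact hK z
    _ = _ := by ring

lemma levy_smul {r : ℝ} (hr : 0 < r) (z : E d) :
    levy d α (r • z) = r ^ (-(d : ℝ) - α) * levy d α z := by
  rw [levy, levy, norm_smul, Real.norm_of_nonneg hr.le, Real.mul_rpow hr.le (norm_nonneg _)]

/-- The jump density is homogeneous of degree `-d-α` and Lebesgue measure scales with degree `d`;
the net exponent is `α`. -/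
lemma levy_integral_comp_smul (f : E d → ℝ) {r : ℝ} (hr : 0 < r) :
    ∫ z, f (r • z) * levy d α z = r ^ α * ∫ z, f z * levy d α z := by
  have h1 : ∀ z : E d, f (r • z) * levy d α z =
      r ^ ((d : ℝ) + α) * (f (r • z) * levy d α (r • z)) := by
    intro z
    rw [levy_smul hr, show r ^ ((d : ℝ) + α) * (f (r • z) * (r ^ (-(d : ℝ) - α) * levy d α z)) =
      (r ^ ((d : ℝ) + α) * r ^ (-(d : ℝ) - α)) * (f (r • z) * levy d α z) by ring,
      ← Real.rpow_add hr]
    simp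
  simp_rw [h1]
  rw [integral_const_mul, Measure.integral_comp_smul volume (fun z => f z * levy d α z) r,
    smul_eq_mul, ← mul_assoc, finrank_euclideanSpace, Fintype.card_fin, abs_of_pos (by positivity),
    ← Real.rpow_natCast, ← Real.rpow_neg hr.le, ← Real.rpow_add hr]
  congr 2; ring

lemma symbol_comp_smul {r : ℝ} (hr : 0 < r) (ξ : E d) :
    symbol d α (fun z => k (r • z)) ξ = r ^ α * symbol d α k (r⁻¹ • ξ) := by
  rw [symbol_eq, symbol_eq,
    ← levy_integral_comp_smul (fun z => (1 - Real.cos (inner ℝ (r⁻¹ • ξ) z)) * k z) hr]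
  congr 1; ext z
  rw [real_inner_smul_left, real_inner_smul_right, inv_mul_cancel_left₀ hr.ne']

/-- The truncation of a density to the unit ball. -/
def smallPart (k : E d → ℝ) (z : E d) : ℝ := (Metric.ball (0 : E d) 1).indicator k z

/-- The truncation of a density to the complement of the unit ball. -/
def largePart (k : E d → ℝ) (z : E d) : ℝ := (Metric.ball (0 : E d) 1)ᶜ.indicator k z

lemma smallPart_add_largePart (k : E d → ℝ) : (fun z => smallPart k z + largePart k z) = k := by
  ext z; exact congrFun (indicator_self_add_compl _ k) z

lemma measurable_smallPart (hm : Measurable k) : Measurable (smallPart k) :=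
  hm.indicator measurableSet_ball

lemma measurable_largePart (hm : Measurable k) : Measurable (largePart k) :=
  hm.indicator measurableSet_ball.compl

lemma abs_smallPart_le {K : ℝ} (hK : ∀ z, |k z| ≤ K) (z : E d) : |smallPart k z| ≤ K := by
  unfold smallPart
  by_cases hz : z ∈ Metric.ball (0 : E d) 1
  · rw [indicator_of_mem hz]; exact hK z
  · rw [indicator_of_notMem hz, abs_zero]; exact (abs_nonneg _).trans (hK 0)

lemma abs_largePart_le {K : ℝ} (hK : ∀ z, |k z| ≤ K) (z : E d) : |largePart k z| ≤ K := by
  unfold largePart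
  by_cases hz : z ∈ (Metric.ball (0 : E d) 1)ᶜ
  · rw [indicator_of_mem hz]; exact hK z
  · rw [indicator_of_notMem hz, abs_zero]; exact (abs_nonneg _).trans (hK 0)

/-- The jump density, the inner product and Lebesgue measure are invariant under isometries. Applied
to reflections, this makes the symbol of the truncated stable process constant on the unit sphere.
-/
lemma symbol_isometry (Φ : E d ≃ₗᵢ[ℝ] E d) (hk : ∀ z, k (Φ z) = k z) (ξ : E d) :
    symbol d α k (Φ ξ) = symbol d α k ξ := by
  rw [symbol_eq, symbol_eq, ← Φ.measurePreserving.integral_comp Φ.toHomeomorph.measurableEmbedding]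
  congr 1; ext z
  rw [Φ.inner_map_map, hk, levy, levy, Φ.norm_map]

lemma symbol_mono (hd : 1 ≤ d) (hα0 : 0 < α) (hα2 : α < 2) {k' : E d → ℝ} {K K' : ℝ}
    (hm : Measurable k) (hm' : Measurable k') (hK : ∀ z, |k z| ≤ K) (hK' : ∀ z, |k' z| ≤ K')
    (h : ∀ z, k z ≤ k' z) (ξ : E d) : symbol d α k ξ ≤ symbol d α k' ξ := by
  rw [symbol_eq, symbol_eq]
  refine integral_mono (integrable_one_sub_cos hd hα0 hα2 hm hK ξ)
    (integrable_one_sub_cos hd hα0 hα2 hm' hK' ξ) fun z => ?_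
  have := one_sub_cos_nonneg (inner ℝ ξ z)
  have := levy_nonneg (α := α) z
  dsimp only
  gcongr
  exact h z

/-- The symbol of the truncated stable process at a unit vector. -/
lemma exists_symbol_unit (hd : 1 ≤ d) (hα0 : 0 < α) (hα2 : α < 2) :
    ∃ c > 0, ∀ e : E d, ‖e‖ = 1 → symbol d α (smallPart fun _ => 1) e = c := by
  let e₀ : E d := EuclideanSpace.single ⟨0, hd⟩ 1
  have he₀ : ‖e₀‖ = 1 := by simp [e₀]
  have h1 : ∀ z : E d, |(1 : ℝ)| ≤ 1 := fun _ => by simp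
  refine ⟨symbol d α (smallPart fun _ => 1) e₀, ?_, fun e he => ?_⟩
  · have hnn : ∀ z : E d, 0 ≤ smallPart (fun _ => (1 : ℝ)) z :=
      fun z => indicator_nonneg (fun _ _ => zero_le_one) z
    rw [symbol_eq, gt_iff_lt, integral_pos_iff_support_of_nonneg
      (fun z => mul_nonneg (mul_nonneg (one_sub_cos_nonneg _) (hnn z)) (levy_nonneg z))
      (integrable_one_sub_cos hd hα0 hα2 (measurable_smallPart measurable_const)
        (abs_smallPart_le h1) e₀)]
    -- On this nonempty open set the integrand is nonzero, because the cosine is strictly below one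
    -- there; positivity of the symbol follows.
    have hopen : IsOpen (Metric.ball (0 : E d) 1 ∩ {z | inner ℝ e₀ z ∈ Ioo (0 : ℝ) 1}) :=
      Metric.isOpen_ball.inter (isOpen_Ioo.preimage (by fun_prop))
    have hne : (Metric.ball (0 : E d) 1 ∩ {z | inner ℝ e₀ z ∈ Ioo (0 : ℝ) 1}).Nonempty := by
      refine ⟨(1 / 2 : ℝ) • e₀, ?_, ?_⟩
      · rw [mem_ball_zero_iff, norm_smul, he₀]; norm_num
      · rw [mem_ofPred_eq, real_inner_smul_right, real_inner_self_eq_norm_sq, he₀]; norm_num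
    refine (hopen.measure_pos volume hne).trans_le (measure_mono fun z hz => ?_)
    rw [Function.mem_support]
    have hz0 : z ≠ 0 := by rintro rfl; simpa using hz.2.1
    have hcos : Real.cos (inner ℝ e₀ z) < 1 := by
      rw [← Real.cos_zero]
      exact Real.cos_lt_cos_of_nonneg_of_le_pi le_rfl (by linarith [hz.2.2, Real.pi_gt_three])
        hz.2.1
    have hs : smallPart (fun _ => (1 : ℝ)) z = 1 := indicator_of_mem hz.1 _
    rw [hs, mul_one]
    exact mul_ne_zero (by linarith) (Real.rpow_pos_of_pos (norm_pos_iff.2 hz0) _).ne'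
  · have := symbol_isometry (α := α) (k := smallPart fun _ => (1 : ℝ)) ((ℝ ∙ (e₀ - e))ᗮ.reflection)
      (fun z => by simp [smallPart, indicator]) e₀
    rwa [Submodule.reflection_sub (he₀.trans he.symm)] at this

/-- Growth of the symbol of the truncated process. -/
lemma exists_le_symbol_smallPart (hd : 1 ≤ d) (hα0 : 0 < α) (hα2 : α < 2) (h0 : 0 < κ₀) :
    ∃ c > 0, ∀ (κ₁ : ℝ) (k : E d → ℝ), IsDensity d κ₀ κ₁ k → ∀ ξ,
      c * (‖ξ‖ ^ α - 1) ≤ symbol d α (smallPart k) ξ := by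
  obtain ⟨c, hc, hce⟩ := exists_symbol_unit hd hα0 hα2
  refine ⟨κ₀ * c, mul_pos h0 hc, fun κ₁ k hk ξ => ?_⟩
  have hnn : 0 ≤ symbol d α (smallPart k) ξ :=
    symbol_nonneg (fun z => indicator_nonneg (fun z _ => h0.le.trans (hk.lower z)) z) ξ
  rcases le_total ‖ξ‖ 1 with h | h
  -- For `|ξ| ≤ 1` the lower bound is nonpositive, which is why `1` is subtracted in the statement.
  · have : ‖ξ‖ ^ α ≤ 1 := Real.rpow_le_one (norm_nonneg _) h hα0.le
    nlinarith [mul_pos h0 hc]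
  have hr : 0 < ‖ξ‖ := by linarith
  have h1 : ∀ z : E d, |(1 : ℝ)| ≤ 1 := fun _ => by simp
  have hms : Measurable (smallPart fun _ : E d => (1 : ℝ)) := measurable_smallPart measurable_const
  have step1 : κ₀ * symbol d α (smallPart fun _ => 1) ξ ≤ symbol d α (smallPart k) ξ := by
    rw [← symbol_const_mul]
    refine symbol_mono hd hα0 hα2 (k := fun z => κ₀ * smallPart (fun _ => 1) z) (K := κ₀)
      (K' := κ₁) (measurable_const.mul hms)
      (measurable_smallPart hk.measurable) (fun z => ?_) (abs_smallPart_le (hk.abs_le h0))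
      (fun z => ?_) ξ
    · rw [abs_mul, abs_of_pos h0]
      exact mul_le_of_le_one_right h0.le (abs_smallPart_le h1 z)
    · by_cases hz : z ∈ Metric.ball (0 : E d) 1
      · simp only [smallPart, indicator_of_mem hz, mul_one]; exact hk.lower z
      · simp only [smallPart, indicator_of_notMem hz, mul_zero, le_refl]
  -- Scaling by `|ξ| ≥ 1` reduces to a unit vector. It shrinks the ball of truncation, so the
  -- rescaled truncation lies below the original one.
  have step2 : ‖ξ‖ ^ α * c ≤ symbol d α (smallPart fun _ => 1) ξ := by
    have he : ‖‖ξ‖⁻¹ • ξ‖ = 1 := by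
      rw [norm_smul, norm_inv, norm_norm, inv_mul_cancel₀ hr.ne']
    rw [← hce _ he, ← symbol_comp_smul hr]
    refine symbol_mono hd hα0 hα2 (k := fun z => smallPart (fun _ => 1) (‖ξ‖ • z)) (K := 1)
      (K' := 1) (hms.comp (measurable_const_smul _)) hms
      (fun z => abs_smallPart_le h1 _) (abs_smallPart_le h1) (fun z => ?_) ξ
    by_cases hz : z ∈ Metric.ball (0 : E d) 1
    · simp only [smallPart, indicator_of_mem hz]
      exact indicator_le_self' (fun _ _ => zero_le_one) _
    · have hz' : ‖ξ‖ • z ∉ Metric.ball (0 : E d) 1 := by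
        rw [mem_ball_zero_iff, not_lt] at *
        rw [norm_smul, norm_norm]; nlinarith
      simp only [smallPart, indicator_of_notMem hz', indicator_of_notMem hz, le_refl]
  nlinarith [mul_le_mul_of_nonneg_left step2 h0.le, mul_pos h0 hc]

/-- Stretched exponentials decay faster than any polynomial. -/
lemma exists_exp_neg_rpow_le {c : ℝ} (hc : 0 < c) (hα0 : 0 < α) (M : ℕ) :
    ∃ C > 0, ∀ r : ℝ, 0 ≤ r → Real.exp (-c * (r ^ α - 1)) ≤ C * (1 + r) ^ (-(M : ℝ)) := by
  -- A single term of the exponential series suffices, provided `α n ≥ M`.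
  obtain ⟨n, hn⟩ := exists_nat_ge ((M : ℝ) / α)
  have hn' : (M : ℝ) ≤ α * n := by rwa [div_le_iff₀ hα0, mul_comm] at hn
  refine ⟨Real.exp c * (n.factorial / c ^ n + 1) * 2 ^ (M : ℝ), by positivity, fun r hr => ?_⟩
  have hexp : Real.exp (-c * (r ^ α - 1)) = Real.exp c * Real.exp (-(c * r ^ α)) := by
    rw [← Real.exp_add]; congr 1; ring
  rw [hexp, mul_assoc, mul_assoc]
  refine mul_le_mul_of_nonneg_left ?_ (Real.exp_pos c).le
  have hfac : (0 : ℝ) ≤ n.factorial / c ^ n := by positivity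
  have key : (2 : ℝ) ^ (M : ℝ) * (1 + r) ^ (-(M : ℝ)) = ((1 + r) / 2) ^ (-(M : ℝ)) := by
    rw [Real.div_rpow (by positivity) (by positivity), Real.rpow_neg zero_le_two, div_eq_mul_inv,
      inv_inv, mul_comm]
  rw [key]
  rcases le_total r 1 with h | h
  · have h1 : Real.exp (-(c * r ^ α)) ≤ 1 := Real.exp_le_one_iff.2 (by
      have : 0 ≤ c * r ^ α := by positivity
      linarith)
    have h2 : 1 ≤ ((1 + r) / 2) ^ (-(M : ℝ)) :=
      Real.one_le_rpow_of_pos_of_le_one_of_nonpos (by positivity) (by linarith) (by simp)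
    nlinarith
  · have hr0 : 0 < r := by linarith
    have h1 := Real.pow_div_factorial_le_exp (c * r ^ α) (by positivity) n
    have h2 : Real.exp (-(c * r ^ α)) ≤ n.factorial / c ^ n * r ^ (-(α * n)) := by
      rw [Real.exp_neg, Real.rpow_neg hr, Real.rpow_mul hr, Real.rpow_natCast, ← div_eq_mul_inv,
        div_div, ← mul_pow, inv_le_comm₀ (Real.exp_pos _) (by positivity), inv_div]
      exact h1
    have h3 : r ^ (-(α * n)) ≤ ((1 + r) / 2) ^ (-(M : ℝ)) :=
      (Real.rpow_le_rpow_of_exponent_le h (by linarith)).trans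
        (Real.rpow_le_rpow_of_nonpos (by positivity) (by linarith) (by simp))
    have h4 : (0 : ℝ) ≤ r ^ (-(α * n)) := by positivity
    nlinarith

lemma symbol_smallPart_le (hd : 1 ≤ d) (hα0 : 0 < α) (hα2 : α < 2) (h0 : 0 < κ₀)
    (hk : IsDensity d κ₀ κ₁ k) (ξ : E d) : symbol d α (smallPart k) ξ ≤ symbol d α k ξ :=
  symbol_mono hd hα0 hα2 (measurable_smallPart hk.measurable) hk.measurable
    (abs_smallPart_le (hk.abs_le h0)) (hk.abs_le h0)
    (fun z => indicator_le_self' (fun z _ => h0.le.trans (hk.lower z)) z) ξ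

/-- Uniform polynomial decay of `exp (-t ψ₁)`, the small-jump characteristic function. -/
lemma exists_exp_neg_symbol_smallPart_le (hd : 1 ≤ d) (hα0 : 0 < α) (hα2 : α < 2) (h0 : 0 < κ₀)
    {t : ℝ} (ht : 0 < t) (M : ℕ) :
    ∃ C > 0, ∀ (κ₁ : ℝ) (k : E d → ℝ), IsDensity d κ₀ κ₁ k → ∀ ξ,
      Real.exp (-t * symbol d α (smallPart k) ξ) ≤ C * (1 + ‖ξ‖) ^ (-(M : ℝ)) := by
  obtain ⟨c, hc, hcs⟩ := exists_le_symbol_smallPart hd hα0 hα2 h0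
  obtain ⟨C, hC, hCs⟩ := exists_exp_neg_rpow_le (mul_pos ht hc) hα0 M
  refine ⟨C, hC, fun κ₁ k hk ξ => le_trans (Real.exp_le_exp.2 ?_) (hCs ‖ξ‖ (norm_nonneg _))⟩
  nlinarith [mul_le_mul_of_nonneg_left (hcs κ₁ k hk ξ) ht.le]

lemma exists_exp_neg_symbol_le (hd : 1 ≤ d) (hα0 : 0 < α) (hα2 : α < 2) (h0 : 0 < κ₀)
    {t : ℝ} (ht : 0 < t) (M : ℕ) :
    ∃ C > 0, ∀ (κ₁ : ℝ) (k : E d → ℝ), IsDensity d κ₀ κ₁ k → ∀ ξ,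
      Real.exp (-t * symbol d α k ξ) ≤ C * (1 + ‖ξ‖) ^ (-(M : ℝ)) := by
  obtain ⟨C, hC, hCs⟩ := exists_exp_neg_symbol_smallPart_le hd hα0 hα2 h0 ht M
  refine ⟨C, hC, fun κ₁ k hk ξ => le_trans (Real.exp_le_exp.2 ?_) (hCs κ₁ k hk ξ)⟩
  nlinarith [mul_le_mul_of_nonneg_left (symbol_smallPart_le hd hα0 hα2 h0 hk ξ) ht.le]

end Symbol

/-! ### Smoothness and localisation of the small-jump part. -/

section Smooth

variable {d : ℕ} {α κ₀ κ₁ : ℝ} {k : E d → ℝ}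

lemma aestronglyMeasurable_smulRight {F : Type*} [NormedAddCommGroup F] [NormedSpace ℝ F]
    {v : E d → F} (hv : AEStronglyMeasurable v) :
    AEStronglyMeasurable (fun z => (innerSL ℝ z).smulRight (v z)) :=
  (ContinuousLinearMap.smulRightL ℝ (E d) F).aestronglyMeasurable_comp₂
    (innerSL ℝ).continuous.aestronglyMeasurable hv

/-- Differentiation under the integral sign for superpositions of plane waves. -/
lemma hasFDerivAt_integral_wave {F : Type*} [NormedAddCommGroup F] [NormedSpace ℝ F]
    {g g' : ℝ → ℝ} (hg : ∀ u, HasDerivAt g (g' u) u) (hg'c : Continuous g') {i : ℕ}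
    (hg' : ∀ u, |g' u| ≤ |u| ^ i) {v : E d → F} (hv : AEStronglyMeasurable v)
    (hvi : Integrable fun z => ‖z‖ ^ (i + 1) * ‖v z‖)
    (hint : ∀ ξ : E d, Integrable fun z => g (inner ℝ z ξ) • v z) (ξ : E d) :
    HasFDerivAt (fun ξ => ∫ z, g (inner ℝ z ξ) • v z)
      (∫ z, g' (inner ℝ z ξ) • (innerSL ℝ z).smulRight (v z)) ξ := by
  have hgc : Continuous g := continuous_iff_continuousAt.2 fun u => (hg u).continuousAt
  have hB := aestronglyMeasurable_smulRight hv
  refine hasFDerivAt_integral_of_dominated_of_fderiv_le (𝕜 := ℝ)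
    (F' := fun ξ z => g' (inner ℝ z ξ) • (innerSL ℝ z).smulRight (v z))
    (bound := fun z => (‖ξ‖ + 1) ^ i * (‖z‖ ^ (i + 1) * ‖v z‖))
    (Metric.ball_mem_nhds ξ one_pos) (Eventually.of_forall fun η => (hint η).aestronglyMeasurable)
    (hint ξ) ?_ ?_ (hvi.const_mul _) ?_
  · exact ((hg'c.comp (by fun_prop)).aestronglyMeasurable).smul hB
  · refine ae_of_all _ fun z η hη => ?_
    have h0 : ‖η‖ ≤ ‖ξ‖ + 1 := by
      have := norm_sub_norm_le η ξ
      rw [mem_ball_iff_norm] at hη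
      linarith
    rw [norm_smul, ContinuousLinearMap.norm_smulRight_apply, innerSL_apply_norm]
    have h1 : ‖g' (inner ℝ z η)‖ ≤ (‖z‖ * (‖ξ‖ + 1)) ^ i :=
      (hg' _).trans (pow_le_pow_left₀ (abs_nonneg _)
        ((abs_real_inner_le_norm z η).trans (by gcongr)) i)
    calc _ ≤ (‖z‖ * (‖ξ‖ + 1)) ^ i * (‖z‖ * ‖v z‖) := by gcongr
      _ = _ := by rw [mul_pow, pow_succ]; ring
  · refine ae_of_all _ fun z η _ => ?_
    have h1 : HasFDerivAt (fun ξ => inner ℝ z ξ) (innerSL ℝ z) η := (innerSL ℝ z).hasFDerivAt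
    have h2 := ((hg (inner ℝ z η)).hasFDerivAt.comp (𝕜 := ℝ) η h1).smul_const (v z)
    convert! h2 using 1
    ext w
    simp [mul_comm, mul_smul]

lemma integrable_smulRight_moment {F : Type*} [NormedAddCommGroup F] [NormedSpace ℝ F]
    {v : E d → F} {n : ℕ} (h : Integrable fun z => ‖z‖ ^ (n + 1) * ‖v z‖) :
    Integrable fun z => ‖z‖ ^ n * ‖(innerSL ℝ z).smulRight (v z)‖ := by
  refine h.congr (ae_of_all _ fun z => ?_)
  simp only [ContinuousLinearMap.norm_smulRight_apply, innerSL_apply_norm]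
  ring

lemma integral_smulRight_moment {F : Type*} [NormedAddCommGroup F] [NormedSpace ℝ F]
    (v : E d → F) (n : ℕ) :
    ∫ z, ‖z‖ ^ n * ‖(innerSL ℝ z).smulRight (v z)‖ = ∫ z, ‖z‖ ^ (n + 1) * ‖v z‖ := by
  refine integral_congr_ae (ae_of_all _ fun z => ?_)
  simp only [ContinuousLinearMap.norm_smulRight_apply, innerSL_apply_norm]
  ring

lemma integrable_wave {F : Type*} [NormedAddCommGroup F] [NormedSpace ℝ F]
    {g : ℝ → ℝ} (hgc : Continuous g) {i : ℕ} (hg : ∀ u, |g u| ≤ |u| ^ i) {v : E d → F}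
    (hv : AEStronglyMeasurable v) (hvi : Integrable fun z => ‖z‖ ^ i * ‖v z‖) (ξ : E d) :
    Integrable fun z => g (inner ℝ z ξ) • v z := by
  refine (hvi.const_mul (‖ξ‖ ^ i)).mono' ((hgc.comp (by fun_prop)).aestronglyMeasurable.smul hv)
    (ae_of_all _ fun z => ?_)
  rw [norm_smul]
  have h1 : ‖g (inner ℝ z ξ)‖ ≤ (‖z‖ * ‖ξ‖) ^ i :=
    (hg _).trans (pow_le_pow_left₀ (abs_nonneg _) (abs_real_inner_le_norm z ξ) i)
  calc _ ≤ (‖z‖ * ‖ξ‖) ^ i * ‖v z‖ := by gcongr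
    _ = _ := by rw [mul_pow]; ring

/-- Smoothness of cosine and sine transforms of functions with finite moments, with bounds on all
the derivatives. -/
lemma contDiff_wave (n : ℕ) : ∀ (F : Type) [NormedAddCommGroup F] [NormedSpace ℝ F]
    (v : E d → F), AEStronglyMeasurable v → (∀ m, Integrable fun z => ‖z‖ ^ m * ‖v z‖) →
    ∀ g ∈ ({Real.cos, Real.sin, fun u => -Real.cos u, fun u => -Real.sin u} : Set (ℝ → ℝ)),
    ContDiff ℝ n (fun ξ : E d => ∫ z, g (inner ℝ z ξ) • v z) ∧
    ∀ ξ, ‖iteratedFDeriv ℝ n (fun ξ : E d => ∫ z, g (inner ℝ z ξ) • v z) ξ‖ ≤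
      ∫ z, ‖z‖ ^ n * ‖v z‖ := by
  -- These four functions are closed under differentiation. Each derivative in `ξ` also moves a
  -- factor `z` into the vector weight and changes its target space, so the induction is over all
  -- targets `F`.
  have prop : ∀ g ∈ ({Real.cos, Real.sin, fun u => -Real.cos u, fun u => -Real.sin u} :
      Set (ℝ → ℝ)), Continuous g ∧ (∀ u, |g u| ≤ |u| ^ 0) ∧ ∃ g' ∈ ({Real.cos, Real.sin,
      fun u => -Real.cos u, fun u => -Real.sin u} : Set (ℝ → ℝ)), ∀ u, HasDerivAt g (g' u) u := by
    rintro g (rfl | rfl | rfl | rfl)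
    · exact ⟨Real.continuous_cos, fun u => by simpa using Real.abs_cos_le_one u,
        fun u => -Real.sin u, by simp, Real.hasDerivAt_cos⟩
    · exact ⟨Real.continuous_sin, fun u => by simpa using Real.abs_sin_le_one u,
        Real.cos, by simp, Real.hasDerivAt_sin⟩
    · exact ⟨Real.continuous_cos.neg, fun u => by simpa using Real.abs_cos_le_one u,
        Real.sin, by simp, fun u => neg_neg (Real.sin u) ▸ (Real.hasDerivAt_cos u).neg⟩
    · exact ⟨Real.continuous_sin.neg, fun u => by simpa using Real.abs_sin_le_one u,
        fun u => -Real.cos u, by simp, fun u => (Real.hasDerivAt_sin u).neg⟩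
  induction n with
  | zero =>
    intro F _ _ v hv hvi g hg
    obtain ⟨hgc, hg1, -⟩ := prop g hg
    have hint := integrable_wave hgc hg1 hv (hvi 0)
    constructor
    · rw [Nat.cast_zero, contDiff_zero]
      refine continuous_of_dominated (bound := fun z => ‖z‖ ^ 0 * ‖v z‖)
        (fun ξ => (hint ξ).aestronglyMeasurable)
        (fun ξ => ae_of_all _ fun z => ?_) (hvi 0)
        (ae_of_all _ fun z => (hgc.comp (by fun_prop)).smul continuous_const)
      rw [norm_smul]
      gcongr
      simpa using hg1 (inner ℝ z ξ)
    · intro ξ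
      rw [norm_iteratedFDeriv_zero]
      refine norm_integral_le_of_norm_le (hvi 0) (ae_of_all _ fun z => ?_)
      rw [norm_smul]
      gcongr
      simpa using hg1 (inner ℝ z ξ)
  | succ n ih =>
    intro F _ _ v hv hvi g hg
    obtain ⟨hgc, hg1, g', hg', hgg'⟩ := prop g hg
    obtain ⟨hgc', hg1', -⟩ := prop g' hg'
    have hderiv := hasFDerivAt_integral_wave hgg' hgc' hg1' hv (hvi _)
      (integrable_wave hgc hg1 hv (hvi 0))
    obtain ⟨ih1, ih2⟩ := ih (E d →L[ℝ] F) (fun z => (innerSL ℝ z).smulRight (v z))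
      (aestronglyMeasurable_smulRight hv) (fun m => integrable_smulRight_moment (hvi (m + 1)))
      g' hg'
    have hfd : fderiv ℝ (fun ξ : E d => ∫ z, g (inner ℝ z ξ) • v z) =
        fun ξ => ∫ z, g' (inner ℝ z ξ) • (innerSL ℝ z).smulRight (v z) :=
      funext fun ξ => (hderiv ξ).fderiv
    constructor
    · rw [Nat.cast_succ, contDiff_succ_iff_fderiv]
      refine ⟨fun ξ => (hderiv ξ).differentiableAt, by simp, ?_⟩
      rwa [hfd]
    · intro ξ
      rw [← norm_iteratedFDeriv_fderiv, hfd, ← integral_smulRight_moment]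
      exact ih2 ξ

/-- Two powers of `|z|` compensate the singularity at the origin. Further powers are at most one on
the unit ball, so the bound does not depend on `n`. -/
lemma integrable_smallPart_moment (hd : 1 ≤ d) (hα0 : 0 < α) (hα2 : α < 2) {K : ℝ}
    (hm : Measurable k) (hK : ∀ z, |k z| ≤ K) (n : ℕ) :
    Integrable (fun z => ‖z‖ ^ (n + 2) * ‖smallPart k z * levy d α z‖) ∧
    ∫ z, ‖z‖ ^ (n + 2) * ‖smallPart k z * levy d α z‖ ≤ K * levyMass d α := by
  have hb : ∀ z : E d, ‖z‖ ^ (n + 2) * ‖smallPart k z * levy d α z‖ ≤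
      K * (min (‖z‖ ^ 2) 1 * levy d α z) := by
    intro z
    have hl := levy_nonneg (α := α) z
    rw [norm_mul, Real.norm_of_nonneg hl, Real.norm_eq_abs]
    have hK0 : 0 ≤ K := (abs_nonneg _).trans (hK z)
    by_cases hz : z ∈ Metric.ball (0 : E d) 1
    · have hz1 : ‖z‖ ≤ 1 := (mem_ball_zero_iff.1 hz).le
      have h1 : min (‖z‖ ^ 2) 1 = ‖z‖ ^ 2 := min_eq_left (by nlinarith [norm_nonneg z])
      have h2 : ‖z‖ ^ (n + 2) ≤ ‖z‖ ^ 2 :=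
        pow_le_pow_of_le_one (norm_nonneg _) hz1 (by omega)
      rw [h1]
      have := abs_smallPart_le hK z
      calc _ ≤ ‖z‖ ^ 2 * (K * levy d α z) := by gcongr
        _ = _ := by ring
    · have : smallPart k z = 0 := indicator_of_notMem hz _
      rw [this]
      simp only [abs_zero, zero_mul, mul_zero]
      positivity
  have hi := (integrable_min_sq_levy hd hα0 hα2).const_mul K
  have hint : Integrable (fun z => ‖z‖ ^ (n + 2) * ‖smallPart k z * levy d α z‖) := by
    refine hi.mono' ?_ (ae_of_all _ fun z => ?_)
    · have h1 : Measurable fun z : E d => ‖z‖ ^ (n + 2) := by fun_prop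
      exact (h1.mul ((measurable_smallPart hm).mul measurable_levy).norm).aestronglyMeasurable
    · rw [Real.norm_of_nonneg (by positivity)]; exact hb z
  refine ⟨hint, ?_⟩
  rw [levyMass, ← integral_const_mul]
  exact integral_mono hint hi hb

lemma symbol_smallPart_eq_wave (ξ : E d) : symbol d α (smallPart k) ξ =
    ∫ z, (1 - Real.cos (inner ℝ z ξ)) • (smallPart k z * levy d α z) := by
  rw [symbol_eq]
  congr 1; ext z
  rw [real_inner_comm, smul_eq_mul, mul_assoc]

/-- The small-jump symbol is smooth, its gradient grows linearly and its higher derivatives are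
bounded. -/
lemma contDiff_symbol_smallPart (hd : 1 ≤ d) (hα0 : 0 < α) (hα2 : α < 2) {K : ℝ}
    (hm : Measurable k) (hK : ∀ z, |k z| ≤ K) (n : ℕ) :
    ContDiff ℝ (n + 2 : ℕ) (symbol d α (smallPart k)) ∧
    (∀ ξ, ‖iteratedFDeriv ℝ 1 (symbol d α (smallPart k)) ξ‖ ≤ K * levyMass d α * ‖ξ‖) ∧
    ∀ ξ, ‖iteratedFDeriv ℝ (n + 2) (symbol d α (smallPart k)) ξ‖ ≤ K * levyMass d α := by
  set w : E d → ℝ := fun z => smallPart k z * levy d α z with hw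
  have hwm : AEStronglyMeasurable w :=
    ((measurable_smallPart hm).mul measurable_levy).aestronglyMeasurable
  have hmom := fun n => (integrable_smallPart_moment hd hα0 hα2 hm hK n).1
  have hψ : symbol d α (smallPart k) = fun ξ => ∫ z, (1 - Real.cos (inner ℝ z ξ)) • w z :=
    funext fun ξ => symbol_smallPart_eq_wave ξ
  have hc0 : ∀ u : ℝ, |1 - Real.cos u| ≤ |u| ^ 2 := fun u => by
    rw [abs_of_nonneg (one_sub_cos_nonneg u), sq_abs]
    nlinarith [Real.one_sub_sq_div_two_le_cos (x := u), sq_nonneg u]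
  have hs1 : ∀ u : ℝ, |Real.sin u| ≤ |u| ^ 1 := fun u => by simpa using Real.abs_sin_le_abs
  have hc1 : ∀ u : ℝ, |Real.cos u| ≤ |u| ^ 0 := fun u => by simpa using Real.abs_cos_le_one u
  -- The weight `w` is only known to have moments of order at least two, so the first two
  -- derivatives are taken by hand, using `1 - cos u ≤ u²` and `|sin u| ≤ |u|`. The resulting weight
  -- `w2` has all moments, and `contDiff_wave` handles the rest.
  have d1 := hasFDerivAt_integral_wave (g := fun u => 1 - Real.cos u) (g' := Real.sin)
    (fun u => by simpa using (Real.hasDerivAt_cos u).const_sub 1) Real.continuous_sin hs1 hwm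
    (hmom 0) (integrable_wave (by fun_prop) hc0 hwm (hmom 0))
  set w1 : E d → (E d →L[ℝ] ℝ) := fun z => (innerSL ℝ z).smulRight (w z) with hw1
  have hw1m : AEStronglyMeasurable w1 := aestronglyMeasurable_smulRight hwm
  have hmom1 : ∀ n, Integrable fun z => ‖z‖ ^ (n + 1) * ‖w1 z‖ :=
    fun n => integrable_smulRight_moment (hmom n)
  have f1 : fderiv ℝ (symbol d α (smallPart k)) = fun ξ => ∫ z, Real.sin (inner ℝ z ξ) • w1 z := by
    rw [hψ]; exact funext fun ξ => (d1 ξ).fderiv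
  have d2 := hasFDerivAt_integral_wave (g := Real.sin) (g' := Real.cos)
    Real.hasDerivAt_sin Real.continuous_cos hc1 hw1m
    (hmom1 0) (integrable_wave Real.continuous_sin hs1 hw1m (hmom1 0))
  set w2 : E d → (E d →L[ℝ] (E d →L[ℝ] ℝ)) := fun z => (innerSL ℝ z).smulRight (w1 z) with hw2
  have hw2m : AEStronglyMeasurable w2 := aestronglyMeasurable_smulRight hw1m
  have hmom2 : ∀ n, Integrable fun z => ‖z‖ ^ n * ‖w2 z‖ :=
    fun n => integrable_smulRight_moment (hmom1 n)
  have f2 : fderiv ℝ (fderiv ℝ (symbol d α (smallPart k))) =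
      fun ξ => ∫ z, Real.cos (inner ℝ z ξ) • w2 z := by
    rw [f1]; exact funext fun ξ => (d2 ξ).fderiv
  obtain ⟨c1, c2⟩ := contDiff_wave n (E d →L[ℝ] (E d →L[ℝ] ℝ)) w2 hw2m hmom2 Real.cos (by simp)
  refine ⟨?_, fun ξ => ?_, fun ξ => ?_⟩
  · have e : ((n + 2 : ℕ) : WithTop ℕ∞) = (n : WithTop ℕ∞) + 1 + 1 := by push_cast; ring
    rw [e, contDiff_succ_iff_fderiv]
    refine ⟨fun ξ => by rw [hψ]; exact (d1 ξ).differentiableAt, by simp, ?_⟩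
    rw [contDiff_succ_iff_fderiv]
    refine ⟨fun ξ => by rw [f1]; exact (d2 ξ).differentiableAt, by simp, ?_⟩
    rwa [f2]
  · rw [← norm_iteratedFDeriv_fderiv, norm_iteratedFDeriv_zero, f1]
    refine (norm_integral_le_of_norm_le ((hmom1 0).const_mul ‖ξ‖)
      (ae_of_all _ fun z => ?_)).trans ?_
    · rw [norm_smul, zero_add, pow_one]
      have : ‖Real.sin (inner ℝ z ξ)‖ ≤ ‖z‖ * ‖ξ‖ :=
        (Real.abs_sin_le_abs).trans (abs_real_inner_le_norm z ξ)
      calc _ ≤ ‖z‖ * ‖ξ‖ * ‖w1 z‖ := by gcongr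
        _ = _ := by ring
    · rw [integral_const_mul, mul_comm]
      refine mul_le_mul_of_nonneg_right ?_ (norm_nonneg _)
      rw [hw1, integral_smulRight_moment w]
      exact (integrable_smallPart_moment hd hα0 hα2 hm hK 0).2
  · rw [← norm_iteratedFDeriv_fderiv, ← norm_iteratedFDeriv_fderiv, f2]
    refine (c2 ξ).trans ?_
    rw [hw2, integral_smulRight_moment, hw1, integral_smulRight_moment]
    exact (integrable_smallPart_moment hd hα0 hα2 hm hK n).2

/-- The characteristic function of the small-jump part at time one, as a complex function. -/
def smallChar (d : ℕ) (α : ℝ) (k : E d → ℝ) (ξ : E d) : ℂ :=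
  ((Real.exp (-symbol d α (smallPart k) ξ) : ℝ) : ℂ)

lemma contDiff_smallChar (hd : 1 ≤ d) (hα0 : 0 < α) (hα2 : α < 2) {K : ℝ}
    (hm : Measurable k) (hK : ∀ z, |k z| ≤ K) (n : ℕ) : ContDiff ℝ n (smallChar d α k) := by
  have h := (contDiff_symbol_smallPart hd hα0 hα2 hm hK n).1.of_le
    (show (n : WithTop ℕ∞) ≤ (n + 2 : ℕ) by exact_mod_cast Nat.le_add_right n 2)
  exact Complex.ofRealCLM.contDiff.comp (Real.contDiff_exp.comp h.neg)

lemma norm_iteratedFDeriv_exp_neg (i : ℕ) (s : ℝ) :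
    ‖iteratedFDeriv ℝ i (fun s : ℝ => Real.exp (-s)) s‖ = Real.exp (-s) := by
  rw [norm_iteratedFDeriv_eq_norm_iteratedDeriv]
  have := congrFun (iteratedDeriv_comp_neg i Real.exp |> fun h => funext h) s
  simp only [iteratedDeriv_eq_iterate, Real.iter_deriv_exp] at this ⊢
  rw [this, norm_smul]
  simp

/-- The Faà di Bruno bound asks that the `i`-th derivative of the symbol be at most `D^i`. The
choice `D = (1 + K·mass)(1 + |ξ|)` covers both the linearly growing gradient and the bounded higher
derivatives, since `D ≥ 1`. -/
lemma norm_iteratedFDeriv_smallChar_le (hd : 1 ≤ d) (hα0 : 0 < α) (hα2 : α < 2) {K : ℝ}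
    (hm : Measurable k) (hK : ∀ z, |k z| ≤ K) (n : ℕ) (ξ : E d) :
    ‖iteratedFDeriv ℝ n (smallChar d α k) ξ‖ ≤
      n.factorial * Real.exp (-symbol d α (smallPart k) ξ) *
        ((1 + K * levyMass d α) * (1 + ‖ξ‖)) ^ n := by
  have hK0 : 0 ≤ K * levyMass d α := mul_nonneg ((abs_nonneg _).trans (hK 0)) levyMass_nonneg
  have h := (contDiff_symbol_smallPart hd hα0 hα2 hm hK n).1.of_le
    (show (n : WithTop ℕ∞) ≤ (n + 2 : ℕ) by exact_mod_cast Nat.le_add_right n 2)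
  have e : smallChar d α k = Complex.ofRealLI ∘
      ((fun s : ℝ => Real.exp (-s)) ∘ symbol d α (smallPart k)) := rfl
  have hexp : ContDiff ℝ n (fun s : ℝ => Real.exp (-s)) := by fun_prop
  rw [e, LinearIsometry.norm_iteratedFDeriv_comp_left _ (hexp.comp h).contDiffAt le_rfl]
  refine norm_iteratedFDeriv_comp_le hexp h le_rfl ξ
    (fun i _ => (norm_iteratedFDeriv_exp_neg i _).le) (fun i h1 hi => ?_)
  have hξ := norm_nonneg ξ
  obtain ⟨c1, c2, c3⟩ := contDiff_symbol_smallPart hd hα0 hα2 hm hK (i - 2)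
  rcases Nat.eq_or_lt_of_le h1 with rfl | h2
  · refine (c2 ξ).trans ?_
    rw [pow_one]
    nlinarith
  · rw [Nat.sub_add_cancel h2] at c3
    refine (c3 ξ).trans ?_
    have h4 : 1 + K * levyMass d α ≤ (1 + K * levyMass d α) * (1 + ‖ξ‖) := by nlinarith
    have h5 : (1 + K * levyMass d α) * (1 + ‖ξ‖) ≤ ((1 + K * levyMass d α) * (1 + ‖ξ‖)) ^ i :=
      le_self_pow₀ (by linarith) (by omega)
    linarith

/-- Integrability, with uniform bounds, of the derivatives of the small-jump characteristic
function. -/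
lemma exists_integral_smallChar_le (hd : 1 ≤ d) (hα0 : 0 < α) (hα2 : α < 2) (h0 : 0 < κ₀) (κ₁ : ℝ)
    (a n : ℕ) : ∃ C, ∀ k : E d → ℝ, IsDensity d κ₀ κ₁ k →
      Integrable (fun ξ => ‖ξ‖ ^ a * ‖iteratedFDeriv ℝ n (smallChar d α k) ξ‖) ∧
      ∫ ξ, ‖ξ‖ ^ a * ‖iteratedFDeriv ℝ n (smallChar d α k) ξ‖ ≤ C := by
  -- The exponent pays `a` for the moment and `n` for the growth of the derivatives; the remaining
  -- `d + 1` is integrable.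
  obtain ⟨C, hC, hCk⟩ := exists_exp_neg_symbol_smallPart_le hd hα0 hα2 h0 one_pos (a + n + d + 1)
  set B : ℝ := n.factorial * C * (1 + κ₁ * levyMass d α) ^ n
  have hi : Integrable (fun ξ : E d => B * (1 + ‖ξ‖) ^ (-((d : ℝ) + 1))) :=
    (integrable_one_add_norm (by simp)).const_mul B
  refine ⟨∫ ξ : E d, B * (1 + ‖ξ‖) ^ (-((d : ℝ) + 1)), fun k hk => ?_⟩
  have hK0 : 0 ≤ κ₁ * levyMass d α := mul_nonneg (hk.upper_nonneg h0) levyMass_nonneg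
  have hb : ∀ ξ : E d, ‖ξ‖ ^ a * ‖iteratedFDeriv ℝ n (smallChar d α k) ξ‖ ≤
      B * (1 + ‖ξ‖) ^ (-((d : ℝ) + 1)) := by
    intro ξ
    have hξ := norm_nonneg ξ
    have h1 := norm_iteratedFDeriv_smallChar_le hd hα0 hα2 hk.measurable (hk.abs_le h0) n ξ
    have h2 := hCk κ₁ k hk ξ
    rw [neg_one_mul] at h2
    calc _ ≤ (1 + ‖ξ‖) ^ a * (n.factorial * (C * (1 + ‖ξ‖) ^ (-((a + n + d + 1 : ℕ) : ℝ))) *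
          ((1 + κ₁ * levyMass d α) * (1 + ‖ξ‖)) ^ n) := by
          refine mul_le_mul (pow_le_pow_left₀ hξ (by linarith) a) (h1.trans ?_) (norm_nonneg _)
            (by positivity)
          gcongr
      _ = B * ((1 + ‖ξ‖) ^ (a : ℝ) * (1 + ‖ξ‖) ^ (n : ℝ) *
            (1 + ‖ξ‖) ^ (-((a + n + d + 1 : ℕ) : ℝ))) := by
          rw [mul_pow, Real.rpow_natCast, Real.rpow_natCast]; ring
      _ = _ := by
          rw [← Real.rpow_add (by positivity), ← Real.rpow_add (by positivity)]
          congr 2; push_cast; ring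
  have hcont : Continuous (fun ξ => ‖ξ‖ ^ a * ‖iteratedFDeriv ℝ n (smallChar d α k) ξ‖) :=
    (by fun_prop : Continuous fun ξ : E d => ‖ξ‖ ^ a).mul
      ((contDiff_smallChar hd hα0 hα2 hk.measurable (hk.abs_le h0) n).continuous_iteratedFDeriv
        le_rfl).norm
  have hint : Integrable (fun ξ => ‖ξ‖ ^ a * ‖iteratedFDeriv ℝ n (smallChar d α k) ξ‖) :=
    hi.mono' hcont.aestronglyMeasurable (ae_of_all _ fun ξ => by
      rw [Real.norm_of_nonneg (by positivity)]; exact hb ξ)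
  exact ⟨hint, integral_mono hint hi hb⟩

open scoped FourierTransform in
/-- Derivatives of the small-jump density decay fast, uniformly in the density. -/
lemma exists_fourier_smallChar_le (hd : 1 ≤ d) (hα0 : 0 < α) (hα2 : α < 2) (h0 : 0 < κ₀) (κ₁ : ℝ)
    (j : ℕ) : ∃ C, ∀ k : E d → ℝ, IsDensity d κ₀ κ₁ k →
      ContDiff ℝ j (𝓕 (smallChar d α k)) ∧
      ∀ x, ‖iteratedFDeriv ℝ j (𝓕 (smallChar d α k)) x‖ ≤ C * decay d α x := by
  have hmain : ∀ n : ℕ, ∃ C, ∀ k : E d → ℝ, IsDensity d κ₀ κ₁ k → ∀ x,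
      ‖x‖ ^ n * ‖iteratedFDeriv ℝ j (𝓕 (smallChar d α k)) x‖ ≤ C := by
    intro n
    choose C hC using fun p : ℕ × ℕ =>
      exists_integral_smallChar_le hd hα0 hα2 h0 κ₁ p.1 p.2
    refine ⟨(2 * Real.pi) ^ j * (2 * j + 2) ^ n *
      ∑ p ∈ Finset.range (j + 1) ×ˢ Finset.range (n + 1), C p, fun k hk x => ?_⟩
    refine (Real.pow_mul_norm_iteratedFDeriv_fourier_le (K := j) (N := n)
      (contDiff_smallChar hd hα0 hα2 hk.measurable (hk.abs_le h0) n)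
      (fun a b _ _ => (hC (a, b) k hk).1) le_rfl le_rfl x).trans ?_
    gcongr with p _
    exact (hC p k hk).2
  -- The moments of order `0` and `d + 2` are enough because `d + α ≤ d + 2`.
  obtain ⟨A, hA⟩ := hmain 0
  obtain ⟨B, hB⟩ := hmain (d + 2)
  refine ⟨2 ^ (d + 1) * (A + B), fun k hk => ⟨?_, fun x => ?_⟩⟩
  · refine Real.contDiff_fourier (N := (j : ℕ∞)) fun a _ => ?_
    obtain ⟨_, hC⟩ := exists_integral_smallChar_le hd hα0 hα2 h0 κ₁ a 0
    simpa using (hC k hk).1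
  · have h1 := hA k hk x
    have h2 := hB k hk x
    rw [pow_zero, one_mul] at h1
    set D := ‖iteratedFDeriv ℝ j (𝓕 (smallChar d α k)) x‖
    have hD : 0 ≤ D := norm_nonneg _
    have h3 : (1 + ‖x‖) ^ (d + 2) ≤ 2 ^ (d + 1) * (1 ^ (d + 2) + ‖x‖ ^ (d + 2)) :=
      add_pow_le zero_le_one (norm_nonneg _) _
    have h4 : (1 + ‖x‖) ^ (d + 2) * D ≤ 2 ^ (d + 1) * (A + B) := by
      calc _ ≤ 2 ^ (d + 1) * (1 ^ (d + 2) + ‖x‖ ^ (d + 2)) * D := by gcongr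
        _ = 2 ^ (d + 1) * (D + ‖x‖ ^ (d + 2) * D) := by ring
        _ ≤ _ := by gcongr
    have hpos : 0 < (1 + ‖x‖) ^ (d + 2) := by positivity
    have h5 : D ≤ 2 ^ (d + 1) * (A + B) * ((1 + ‖x‖) ^ (d + 2))⁻¹ := by
      rwa [← div_eq_mul_inv, le_div_iff₀ hpos, mul_comm D]
    have hAB : 0 ≤ 2 ^ (d + 1) * (A + B) := (by positivity : (0 : ℝ) ≤ _ * D).trans h4
    refine h5.trans (mul_le_mul_of_nonneg_left ?_ hAB)
    rw [← Real.rpow_natCast, ← Real.rpow_neg (by positivity), decay]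
    exact Real.rpow_le_rpow_of_exponent_le (by linarith [norm_nonneg x]) (by push_cast; linarith)

end Smooth

/-! ### From small jumps to all jumps: convolution with the large-jump density. -/

section Transfer

variable {d : ℕ} {α κ₀ κ₁ : ℝ} {k : E d → ℝ}

/-- The unnormalised inverse Fourier transform `∫ e^{i⟨ξ,x⟩} g(ξ) dξ`. -/
def osc {d : ℕ} (g : E d → ℂ) (x : E d) : ℂ :=
  ∫ ξ, Complex.exp (((inner ℝ ξ x : ℝ) : ℂ) * Complex.I) * g ξ

lemma norm_wave (u : ℝ) : ‖Complex.exp ((u : ℂ) * Complex.I)‖ = 1 :=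
  Complex.norm_exp_ofReal_mul_I u

lemma integrable_osc {g : E d → ℂ} (hg : Integrable g) (x : E d) :
    Integrable fun ξ => Complex.exp (((inner ℝ ξ x : ℝ) : ℂ) * Complex.I) * g ξ := by
  refine hg.norm.mono' ((by fun_prop : Continuous fun ξ : E d =>
    Complex.exp (((inner ℝ ξ x : ℝ) : ℂ) * Complex.I)).aestronglyMeasurable.mul
      hg.aestronglyMeasurable) (ae_of_all _ fun ξ => ?_)
  rw [norm_mul, norm_wave, one_mul]

lemma continuous_osc {g : E d → ℂ} (hg : Integrable g) : Continuous (osc g) := by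
  refine continuous_of_dominated (bound := fun ξ => ‖g ξ‖)
    (fun x => (integrable_osc hg x).aestronglyMeasurable)
    (fun x => ae_of_all _ fun ξ => ?_) hg.norm (ae_of_all _ fun ξ => by fun_prop)
  rw [norm_mul, norm_wave, one_mul]

open scoped FourierTransform in
lemma osc_eq_fourier (g : E d → ℂ) (x : E d) :
    osc g x = 𝓕 g ((-(2 * Real.pi)⁻¹) • x) := by
  rw [osc, Real.fourier_eq']
  congr 1; ext ξ
  rw [real_inner_smul_right, smul_eq_mul]
  have hpi := Real.pi_ne_zero
  congr 4
  field_simp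

lemma osc_shift (g : E d → ℂ) (x a : E d) :
    osc (fun ξ => Complex.exp (((inner ℝ ξ a : ℝ) : ℂ) * Complex.I) * g ξ) x = osc g (x + a) := by
  rw [osc, osc]
  congr 1; ext ξ
  rw [← mul_assoc, ← Complex.exp_add, ← add_mul, inner_add_right, Complex.ofReal_add]

lemma osc_const_mul (c : ℂ) (g : E d → ℂ) (x : E d) :
    osc (fun ξ => c * g ξ) x = c * osc g x := by
  rw [osc, osc, ← integral_const_mul]
  congr 1; ext ξ; ring

lemma osc_sub {g g' : E d → ℂ} (hg : Integrable g) (hg' : Integrable g') (x : E d) :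
    osc (fun ξ => g ξ - g' ξ) x = osc g x - osc g' x := by
  rw [osc, osc, osc, ← integral_sub (integrable_osc hg x) (integrable_osc hg' x)]
  congr 1; ext ξ; ring

lemma cos_eq_waves (u : ℝ) : ((Real.cos u : ℝ) : ℂ) =
    (Complex.exp ((u : ℂ) * Complex.I) + Complex.exp (((-u : ℝ) : ℂ) * Complex.I)) / 2 := by
  rw [Complex.ofReal_cos, Complex.cos, Complex.ofReal_neg]

/-- A cosine factor averages two shifts. -/
lemma osc_cos {g : E d → ℂ} (hg : Integrable g) (x z : E d) :
    osc (fun ξ => ((Real.cos (inner ℝ ξ z) : ℝ) : ℂ) * g ξ) x =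
      (osc g (x + z) + osc g (x - z)) / 2 := by
  rw [osc, osc, osc, ← integral_add (integrable_osc hg _) (integrable_osc hg _),
    ← integral_div]
  congr 1; ext ξ
  rw [cos_eq_waves, sub_eq_add_neg x z, inner_add_right, inner_add_right, inner_neg_right,
    Complex.ofReal_add, Complex.ofReal_add, add_mul, add_mul, Complex.exp_add, Complex.exp_add]
  ring

/-- Multiplying by a cosine transform averages translates. -/
lemma osc_cosTransform {g : E d → ℂ} (hg : Integrable g) {ν : E d → ℝ} (hν : Integrable ν)
    (x : E d) :
    osc (fun ξ => ((∫ z, Real.cos (inner ℝ ξ z) * ν z : ℝ) : ℂ) * g ξ) x =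
      ∫ z, (osc g (x + z) + osc g (x - z)) / 2 * (ν z : ℂ) := by
  have hmeas : AEStronglyMeasurable (fun p : E d × E d =>
      Complex.exp (((inner ℝ p.1 x : ℝ) : ℂ) * Complex.I) *
        (((Real.cos (inner ℝ p.1 p.2) : ℝ) : ℂ) * g p.1) * (ν p.2 : ℂ))
      (volume.prod volume) := by
    refine AEStronglyMeasurable.mul (AEStronglyMeasurable.mul ?_ (AEStronglyMeasurable.mul ?_
      hg.aestronglyMeasurable.comp_fst)) ?_
    · exact (by fun_prop : Continuous fun p : E d × E d =>
        Complex.exp (((inner ℝ p.1 x : ℝ) : ℂ) * Complex.I)).aestronglyMeasurable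
    · exact (by fun_prop : Continuous fun p : E d × E d =>
        ((Real.cos (inner ℝ p.1 p.2) : ℝ) : ℂ)).aestronglyMeasurable
    · exact (Complex.continuous_ofReal.comp_aestronglyMeasurable
        hν.aestronglyMeasurable).comp_snd
  have hint : Integrable (fun p : E d × E d =>
      Complex.exp (((inner ℝ p.1 x : ℝ) : ℂ) * Complex.I) *
        (((Real.cos (inner ℝ p.1 p.2) : ℝ) : ℂ) * g p.1) * (ν p.2 : ℂ))
      (volume.prod volume) := by
    refine (hg.norm.mul_prod hν.norm).mono' hmeas (ae_of_all _ fun p => ?_)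
    rw [norm_mul, norm_mul, norm_wave, one_mul, norm_mul, Complex.norm_real, Complex.norm_real]
    refine mul_le_mul_of_nonneg_right ?_ (norm_nonneg _)
    exact mul_le_of_le_one_left (norm_nonneg _) (Real.abs_cos_le_one _)
  have h1 : ∀ ξ, Complex.exp (((inner ℝ ξ x : ℝ) : ℂ) * Complex.I) *
      (((∫ z, Real.cos (inner ℝ ξ z) * ν z : ℝ) : ℂ) * g ξ) =
      ∫ z, Complex.exp (((inner ℝ ξ x : ℝ) : ℂ) * Complex.I) *
        (((Real.cos (inner ℝ ξ z) : ℝ) : ℂ) * g ξ) * (ν z : ℂ) := by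
    intro ξ
    rw [← integral_complex_ofReal, mul_left_comm, ← integral_mul_const]
    congr 1; ext z
    push_cast; ring
  rw [osc]
  simp_rw [h1]
  rw [integral_integral_swap hint]
  congr 1; ext z
  rw [integral_mul_const, ← osc_cos hg x z, osc]

/-- The part of the Lévy density away from the origin. -/
def bigJump (d : ℕ) (α : ℝ) (k : E d → ℝ) (z : E d) : ℝ := largePart k z * levy d α z

lemma abs_bigJump_le (hα : 0 < α) {K : ℝ} (hK : ∀ z, |k z| ≤ K) (z : E d) :
    |bigJump d α k z| ≤ K * 2 ^ ((d : ℝ) + α) * decay d α z := by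
  have hK0 : 0 ≤ K := (abs_nonneg _).trans (hK z)
  have hd := (decay_pos (α := α) z).le
  unfold bigJump
  by_cases hz : z ∈ Metric.ball (0 : E d) 1
  · have : largePart k z = 0 := indicator_of_notMem (not_not.2 hz) _
    rw [this, zero_mul, abs_zero]; positivity
  · have hz1 : 1 ≤ ‖z‖ := by rwa [mem_ball_zero_iff, not_lt] at hz
    rw [abs_mul, abs_of_nonneg (levy_nonneg z), mul_assoc]
    exact mul_le_mul (abs_largePart_le hK z) (levy_le_decay hα hz1) (levy_nonneg z) hK0

lemma integrable_bigJump (hα : 0 < α) {K : ℝ} (hm : Measurable k) (hK : ∀ z, |k z| ≤ K) :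
    Integrable (bigJump d α k) :=
  ((integrable_decay hα).const_mul (K * 2 ^ ((d : ℝ) + α))).mono'
    ((measurable_largePart hm).mul measurable_levy).aestronglyMeasurable
    (ae_of_all _ fun z => abs_bigJump_le hα hK z)

/-- The growth constant of convolution with the big-jump density. -/
def jumpConst (d : ℕ) (α K : ℝ) : ℝ := K * 2 ^ ((d : ℝ) + α) * decayConst d α

/-- On the space side the multiplier averages translates against a density dominated by `decay`, so
the convolution inequality returns the same decay with one more factor `jumpConst`. -/
lemma norm_osc_mul_cosTransform_le (hα : 0 < α) {K : ℝ} (hm : Measurable k)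
    (hK : ∀ z, |k z| ≤ K) {g : E d → ℂ} (hg : Integrable g) {B : ℝ} (hB : 0 ≤ B)
    (hgB : ∀ x, ‖osc g x‖ ≤ B * decay d α x) (x : E d) :
    ‖osc (fun ξ => ((∫ z, Real.cos (inner ℝ ξ z) * bigJump d α k z : ℝ) : ℂ) * g ξ) x‖ ≤
      B * jumpConst d α K * decay d α x := by
  rw [osc_cosTransform hg (integrable_bigJump hα hm hK)]
  have hK0 : 0 ≤ K := (abs_nonneg _).trans (hK 0)
  have i1 := integrable_decay_mul (d := d) hα x
  have i2 : Integrable (fun z => decay d α (x - z) * decay d α z +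
      decay d α (x - (-z)) * decay d α (-z)) := i1.add i1.comp_neg
  refine (norm_integral_le_of_norm_le (i2.const_mul (B / 2 * (K * 2 ^ ((d : ℝ) + α))))
    (ae_of_all _ fun z => ?_)).trans ?_
  · rw [norm_mul, Complex.norm_real, norm_div, Complex.norm_ofNat, sub_neg_eq_add, decay_neg]
    have h1 : ‖osc g (x + z) + osc g (x - z)‖ ≤ B * (decay d α (x + z) + decay d α (x - z)) :=
      (norm_add_le _ _).trans (by linarith [hgB (x + z), hgB (x - z)])
    have h2 := abs_bigJump_le hα hK z
    have h3 := (decay_pos (α := α) (x + z)).le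
    have h4 := (decay_pos (α := α) (x - z)).le
    have h5 := (decay_pos (α := α) z).le
    calc _ ≤ B * (decay d α (x + z) + decay d α (x - z)) / 2 *
          (K * 2 ^ ((d : ℝ) + α) * decay d α z) := by gcongr; exact h2
      _ = _ := by ring
  · rw [integral_const_mul, integral_add i1 i1.comp_neg,
      integral_neg_eq_self (fun z => decay d α (x - z) * decay d α z)]
    have := integral_decay_mul_le hα x
    calc _ ≤ B / 2 * (K * 2 ^ ((d : ℝ) + α)) * (decayConst d α * decay d α x +
        decayConst d α * decay d α x) := by gcongr
      _ = _ := by rw [jumpConst]; ring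

/-- Away from the origin the jump density is integrable, so the `1` and the cosine may be integrated
separately. The first part becomes the constant factor `e^{-∫ν}`. -/
lemma symbol_largePart (hα0 : 0 < α) {K : ℝ}
    (hm : Measurable k) (hK : ∀ z, |k z| ≤ K) (ξ : E d) :
    symbol d α (largePart k) ξ =
      (∫ z, bigJump d α k z) - ∫ z, Real.cos (inner ℝ ξ z) * bigJump d α k z := by
  have hi := integrable_bigJump hα0 hm hK
  rw [symbol_eq, ← integral_sub hi]
  · congr 1; ext z; rw [bigJump]; ring
  · refine hi.norm.mono' ((by fun_prop : Continuous fun z : E d =>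
      Real.cos (inner ℝ ξ z)).aestronglyMeasurable.mul hi.aestronglyMeasurable)
      (ae_of_all _ fun z => ?_)
    rw [norm_mul]
    exact mul_le_of_le_one_left (norm_nonneg _) (Real.abs_cos_le_one _)

lemma abs_cosTransform_le {ν : E d → ℝ} (hν : Integrable ν) (ξ : E d) :
    |∫ z, Real.cos (inner ℝ ξ z) * ν z| ≤ ∫ z, ‖ν z‖ := by
  rw [← Real.norm_eq_abs]
  refine norm_integral_le_of_norm_le hν.norm (ae_of_all _ fun z => ?_)
  rw [norm_mul]
  exact mul_le_of_le_one_left (norm_nonneg _) (Real.abs_cos_le_one _)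

lemma continuous_cosTransform {ν : E d → ℝ} (hν : Integrable ν) :
    Continuous fun ξ : E d => ∫ z, Real.cos (inner ℝ ξ z) * ν z := by
  refine continuous_of_dominated (F := fun (ξ z : E d) => Real.cos (inner ℝ ξ z) * ν z)
    (bound := fun z => ‖ν z‖) (fun ξ => (by fun_prop : Continuous fun z : E d =>
      Real.cos (inner ℝ ξ z)).aestronglyMeasurable.mul hν.aestronglyMeasurable)
    (fun ξ => ae_of_all _ fun z => ?_) hν.norm (ae_of_all _ fun z => by fun_prop)
  rw [norm_mul]
  exact mul_le_of_le_one_left (norm_nonneg _) (Real.abs_cos_le_one _)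

/-- Decay at infinity is preserved when the big jumps are added. -/
lemma norm_osc_mul_largePart_le (hα : 0 < α) {K : ℝ} (hm : Measurable k)
    (hK : ∀ z, |k z| ≤ K) (hk : ∀ z, 0 ≤ k z) {g : E d → ℂ} (hg : Integrable g) {B : ℝ}
    (hB : 0 ≤ B) (hgB : ∀ x, ‖osc g x‖ ≤ B * decay d α x) (x : E d) :
    ‖osc (fun ξ => ((Real.exp (-symbol d α (largePart k) ξ) : ℝ) : ℂ) * g ξ) x‖ ≤
      B * Real.exp (jumpConst d α K) * decay d α x := by
  set ν := bigJump d α k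
  have hν : Integrable ν := integrable_bigJump hα hm hK
  set c : E d → ℝ := fun ξ => ∫ z, Real.cos (inner ℝ ξ z) * ν z
  have hcb : ∀ ξ, |c ξ| ≤ ∫ z, ‖ν z‖ := abs_cosTransform_le hν
  have hcc : Continuous c := continuous_cosTransform hν
  have hpow : ∀ n : ℕ, Integrable (fun ξ => ((c ξ ^ n : ℝ) : ℂ) * g ξ) ∧
      ∀ x, ‖osc (fun ξ => ((c ξ ^ n : ℝ) : ℂ) * g ξ) x‖ ≤
        B * jumpConst d α K ^ n * decay d α x := by
    intro n
    induction n with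
    | zero => simpa using ⟨hg, hgB⟩
    | succ n ih =>
      have hK0 : 0 ≤ K := (abs_nonneg _).trans (hK 0)
      have hj : 0 ≤ jumpConst d α K := by
        have := decayConst_nonneg (d := d) (α := α); unfold jumpConst; positivity
      have e : ∀ ξ, ((c ξ ^ (n + 1) : ℝ) : ℂ) * g ξ =
          ((c ξ : ℝ) : ℂ) * (((c ξ ^ n : ℝ) : ℂ) * g ξ) := fun ξ => by push_cast; ring
      simp_rw [e]
      refine ⟨?_, fun x => ?_⟩
      · refine (ih.1.norm.const_mul (∫ z, ‖ν z‖)).mono'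
          ((Complex.continuous_ofReal.comp hcc).aestronglyMeasurable.mul
            ih.1.aestronglyMeasurable) (ae_of_all _ fun ξ => ?_)
        rw [norm_mul, Complex.norm_real]
        exact mul_le_mul_of_nonneg_right (hcb ξ) (norm_nonneg _)
      · refine (norm_osc_mul_cosTransform_le hα hm hK ih.1 (by positivity) ih.2 x).trans_eq ?_
        ring
  -- The exponential of the cosine transform is expanded and inverted term by term: this is the
  -- compound Poisson series over the number of large jumps.
  have hsum : HasSum (fun n : ℕ => osc (fun ξ => ((c ξ ^ n / n.factorial : ℝ) : ℂ) * g ξ) x)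
      (osc (fun ξ => ((Real.exp (c ξ) : ℝ) : ℂ) * g ξ) x) := by
    have hF : ∀ n : ℕ, Integrable fun ξ => Complex.exp (((inner ℝ ξ x : ℝ) : ℂ) * Complex.I) *
        (((c ξ ^ n / n.factorial : ℝ) : ℂ) * g ξ) := by
      intro n
      refine integrable_osc (((hpow n).1.const_mul ((n.factorial : ℂ)⁻¹)).congr
        (ae_of_all _ fun ξ => ?_)) x
      push_cast; ring
    have hS : Summable fun n : ℕ => ∫ ξ, ‖Complex.exp (((inner ℝ ξ x : ℝ) : ℂ) * Complex.I) *
        (((c ξ ^ n / n.factorial : ℝ) : ℂ) * g ξ)‖ := by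
      refine Summable.of_nonneg_of_le (fun n => integral_nonneg fun ξ => norm_nonneg _)
        (fun n => ?_) ((Real.summable_pow_div_factorial (∫ z, ‖ν z‖)).mul_right (∫ ξ, ‖g ξ‖))
      rw [← integral_const_mul]
      refine integral_mono (hF n).norm (hg.norm.const_mul _) fun ξ => ?_
      simp only [norm_mul, norm_wave, one_mul, Complex.norm_real]
      refine mul_le_mul_of_nonneg_right ?_ (norm_nonneg _)
      rw [norm_div, norm_pow, Real.norm_eq_abs, Real.norm_of_nonneg (by positivity)]
      gcongr
      exact hcb ξ
    have := hasSum_integral_of_summable_integral_norm hF hS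
    convert! this using 1
    rw [osc]
    congr 1; ext ξ
    rw [tsum_mul_left, tsum_mul_right, ← Complex.ofReal_tsum, Real.exp_eq_exp_ℝ,
      NormedSpace.exp_eq_tsum_div]
  have hterm : ∀ n : ℕ, ‖osc (fun ξ => ((c ξ ^ n / n.factorial : ℝ) : ℂ) * g ξ) x‖ ≤
      B * decay d α x * (jumpConst d α K ^ n / n.factorial) := by
    intro n
    have e : ∀ ξ, ((c ξ ^ n / n.factorial : ℝ) : ℂ) * g ξ =
        ((n.factorial : ℂ)⁻¹) * (((c ξ ^ n : ℝ) : ℂ) * g ξ) := fun ξ => by push_cast; ring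
    simp_rw [e]
    rw [osc_const_mul, norm_mul, norm_inv, Complex.norm_natCast]
    calc _ ≤ ((n.factorial : ℝ))⁻¹ * (B * jumpConst d α K ^ n * decay d α x) := by
          gcongr; exact (hpow n).2 x
      _ = _ := by ring
  have hexp : HasSum (fun n : ℕ => B * decay d α x * (jumpConst d α K ^ n / n.factorial))
      (B * decay d α x * Real.exp (jumpConst d α K)) := by
    rw [Real.exp_eq_exp_ℝ]
    exact (NormedSpace.expSeries_div_hasSum_exp (jumpConst d α K)).mul_left _
  have hle := tsum_of_norm_bounded hexp hterm
  rw [hsum.tsum_eq] at hle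
  have e : ∀ ξ, ((Real.exp (-symbol d α (largePart k) ξ) : ℝ) : ℂ) * g ξ =
      ((Real.exp (-∫ z, ν z) : ℝ) : ℂ) * (((Real.exp (c ξ) : ℝ) : ℂ) * g ξ) := by
    intro ξ
    rw [← mul_assoc, ← Complex.ofReal_mul, ← Real.exp_add, symbol_largePart hα hm hK]
    congr 3; ring
  simp_rw [e]
  rw [osc_const_mul, norm_mul, Complex.norm_real, Real.norm_of_nonneg (Real.exp_pos _).le]
  -- Nonnegativity of the density is used only here, to bound the factor `e^{-∫ν}` by one.
  have hν0 : 0 ≤ ∫ z, ν z := integral_nonneg fun z =>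
    mul_nonneg (indicator_nonneg (fun z _ => hk z) z) (levy_nonneg z)
  have : Real.exp (-∫ z, ν z) ≤ 1 := Real.exp_le_one_iff.2 (by linarith)
  calc _ ≤ 1 * (B * decay d α x * Real.exp (jumpConst d α K)) := by gcongr
    _ = _ := by ring

end Transfer

/-! ### The semigroup in Fourier variables and finite differences of its kernel at time one. -/

section TimeOne

variable {d : ℕ} {α κ₀ κ₁ : ℝ} {k : E d → ℝ}

/-- The characteristic function `exp (-t ψ)`. -/
def charFn (d : ℕ) (α : ℝ) (k : E d → ℝ) (t : ℝ) (ξ : E d) : ℂ :=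
  ((Real.exp (-t * symbol d α k ξ) : ℝ) : ℂ)

/-- An integrable envelope of `(1 + |ξ|²) exp (-t ψ)`, uniform in the density. -/
lemma exists_dominating (hd : 1 ≤ d) (hα0 : 0 < α) (hα2 : α < 2) (h0 : 0 < κ₀) {t : ℝ}
    (ht : 0 < t) : ∃ G : E d → ℝ, Integrable G ∧ ∀ (κ₁ : ℝ) (k : E d → ℝ),
      IsDensity d κ₀ κ₁ k → ∀ ξ, (1 + ‖ξ‖ ^ 2) * Real.exp (-t * symbol d α k ξ) ≤ G ξ := by
  obtain ⟨C, hC, hCk⟩ := exists_exp_neg_symbol_le hd hα0 hα2 h0 ht (d + 3)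
  refine ⟨fun ξ => C * (1 + ‖ξ‖) ^ (-((d : ℝ) + 1)),
    (integrable_one_add_norm (by simp)).const_mul C, fun κ₁ k hk ξ => ?_⟩
  have hξ := norm_nonneg ξ
  calc _ ≤ (1 + ‖ξ‖) ^ (2 : ℝ) * (C * (1 + ‖ξ‖) ^ (-((d + 3 : ℕ) : ℝ))) := by
        refine mul_le_mul ?_ (hCk κ₁ k hk ξ) (Real.exp_pos _).le (by positivity)
        rw [Real.rpow_two]; nlinarith
    _ = C * ((1 + ‖ξ‖) ^ (2 : ℝ) * (1 + ‖ξ‖) ^ (-((d + 3 : ℕ) : ℝ))) := by ring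
    _ = _ := by
        rw [← Real.rpow_add (by positivity)]
        congr 2; push_cast; ring

lemma continuous_charFn (hd : 1 ≤ d) (hα0 : 0 < α) (hα2 : α < 2) (h0 : 0 < κ₀)
    (hk : IsDensity d κ₀ κ₁ k) (t : ℝ) : Continuous (charFn d α k t) := by
  have := continuous_symbol hd hα0 hα2 hk.measurable (hk.abs_le h0)
  unfold charFn; fun_prop

lemma norm_charFn (t : ℝ) (ξ : E d) :
    ‖charFn d α k t ξ‖ = Real.exp (-t * symbol d α k ξ) := by
  rw [charFn, Complex.norm_real, Real.norm_of_nonneg (Real.exp_pos _).le]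

lemma integrable_sq_charFn (hd : 1 ≤ d) (hα0 : 0 < α) (hα2 : α < 2) (h0 : 0 < κ₀)
    (hk : IsDensity d κ₀ κ₁ k) {t : ℝ} (ht : 0 < t) :
    Integrable fun ξ => (1 + ‖ξ‖ ^ 2) * ‖charFn d α k t ξ‖ := by
  obtain ⟨G, hG, hGk⟩ := exists_dominating hd hα0 hα2 h0 ht
  have hc := continuous_charFn hd hα0 hα2 h0 hk t
  refine hG.mono' (by fun_prop : Continuous fun ξ =>
    (1 + ‖ξ‖ ^ 2) * ‖charFn d α k t ξ‖).aestronglyMeasurable (ae_of_all _ fun ξ => ?_)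
  rw [Real.norm_of_nonneg (by positivity), norm_charFn]
  exact hGk κ₁ k hk ξ

lemma integrable_of_integrable_sq {g : E d → ℂ} (hm : AEStronglyMeasurable g)
    (hg : Integrable fun ξ => (1 + ‖ξ‖ ^ 2) * ‖g ξ‖) : Integrable g :=
  hg.mono' hm (ae_of_all _ fun ξ => by
    nlinarith [norm_nonneg (g ξ), mul_nonneg (sq_nonneg ‖ξ‖) (norm_nonneg (g ξ))])

lemma integrable_charFn (hd : 1 ≤ d) (hα0 : 0 < α) (hα2 : α < 2) (h0 : 0 < κ₀)
    (hk : IsDensity d κ₀ κ₁ k) {t : ℝ} (ht : 0 < t) : Integrable (charFn d α k t) :=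
  integrable_of_integrable_sq (continuous_charFn hd hα0 hα2 h0 hk t).aestronglyMeasurable
    (integrable_sq_charFn hd hα0 hα2 h0 hk ht)

lemma heatKernel_eq_osc (hd : 1 ≤ d) (hα0 : 0 < α) (hα2 : α < 2) (h0 : 0 < κ₀)
    (hk : IsDensity d κ₀ κ₁ k) {t : ℝ} (ht : 0 < t) (x : E d) :
    heatKernel d α k t x = (2 * Real.pi) ^ (-(d : ℝ)) * (osc (charFn d α k t) x).re := by
  rw [heatKernel, osc]
  have h := integrable_osc (integrable_charFn hd hα0 hα2 h0 hk ht) x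
  rw [← RCLike.re_eq_complex_re, ← integral_re h]
  congr 2; ext ξ
  rw [charFn, RCLike.re_eq_complex_re, Complex.re_mul_ofReal, Complex.exp_ofReal_mul_I_re]

/-- Multiplication by a symbol is minus the corresponding nonlocal operator. -/
lemma osc_symbol (hd : 1 ≤ d) (hα0 : 0 < α) (hα2 : α < 2) {K : ℝ} (hm : Measurable k)
    (hK : ∀ z, |k z| ≤ K) {g : E d → ℂ} (hgm : AEStronglyMeasurable g)
    (hg : Integrable fun ξ => (1 + ‖ξ‖ ^ 2) * ‖g ξ‖) (x : E d) :
    Integrable (fun w => (osc g (x + w) + osc g (x - w) - 2 * osc g x) *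
      ((k w * levy d α w : ℝ) : ℂ)) ∧
    osc (fun ξ => ((symbol d α k ξ : ℝ) : ℂ) * g ξ) x =
      -(1 / 2) * ∫ w, (osc g (x + w) + osc g (x - w) - 2 * osc g x) *
        ((k w * levy d α w : ℝ) : ℂ) := by
  have hgi := integrable_of_integrable_sq hgm hg
  have hK0 : 0 ≤ K := (abs_nonneg _).trans (hK 0)
  -- Both claims come from Fubini for `f`. It is dominated by a product, because `1 - cos⟨ξ,z⟩` is
  -- at most `2(1+|ξ|²)(|z|²∧1)`. Integrating first in `ξ` produces the second difference,
  -- integrating first in `z` the symbol.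
  set f : E d × E d → ℂ := fun p => Complex.exp (((inner ℝ p.1 x : ℝ) : ℂ) * Complex.I) *
    (((1 - Real.cos (inner ℝ p.1 p.2) : ℝ) : ℂ) * g p.1) * ((k p.2 * levy d α p.2 : ℝ) : ℂ)
    with hf
  have hmeas : AEStronglyMeasurable f (volume.prod volume) := by
    refine AEStronglyMeasurable.mul (AEStronglyMeasurable.mul ?_ (AEStronglyMeasurable.mul ?_
      hgm.comp_fst)) ?_
    · exact (by fun_prop : Continuous fun p : E d × E d =>
        Complex.exp (((inner ℝ p.1 x : ℝ) : ℂ) * Complex.I)).aestronglyMeasurable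
    · exact (by fun_prop : Continuous fun p : E d × E d =>
        ((1 - Real.cos (inner ℝ p.1 p.2) : ℝ) : ℂ)).aestronglyMeasurable
    · exact (Complex.continuous_ofReal.comp_aestronglyMeasurable
        (hm.mul measurable_levy).aestronglyMeasurable).comp_snd
  have hint : Integrable f (volume.prod volume) := by
    refine ((hg.const_mul (2 * K)).mul_prod
      (integrable_min_sq_levy hd hα0 hα2)).mono' hmeas (ae_of_all _ fun p => ?_)
    rw [hf]
    simp only [norm_mul, norm_wave, one_mul, Complex.norm_real]
    rw [Real.norm_of_nonneg (one_sub_cos_nonneg _), Real.norm_of_nonneg (levy_nonneg _),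
      Real.norm_eq_abs]
    have h1 := one_sub_cos_inner_le p.1 p.2
    have h2 := hK p.2
    have h3 := levy_nonneg (α := α) p.2
    have h4 := one_sub_cos_nonneg (inner ℝ p.1 p.2)
    calc _ ≤ 2 * (1 + ‖p.1‖ ^ 2) * min (‖p.2‖ ^ 2) 1 * ‖g p.1‖ * (K * levy d α p.2) := by
          gcongr
      _ = _ := by ring
  have hinner : ∀ w, ∫ ξ, f (ξ, w) = -(1 / 2) *
      ((osc g (x + w) + osc g (x - w) - 2 * osc g x) * ((k w * levy d α w : ℝ) : ℂ)) := by
    intro w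
    have hcos : Integrable fun ξ => ((Real.cos (inner ℝ ξ w) : ℝ) : ℂ) * g ξ := by
      refine hgi.norm.mono' ((by fun_prop : Continuous fun ξ : E d =>
        ((Real.cos (inner ℝ ξ w) : ℝ) : ℂ)).aestronglyMeasurable.mul hgm)
        (ae_of_all _ fun ξ => ?_)
      rw [norm_mul, Complex.norm_real]
      exact mul_le_of_le_one_left (norm_nonneg _) (Real.abs_cos_le_one _)
    rw [hf]
    dsimp only
    rw [integral_mul_const]
    have h2 := osc_sub hgi hcos x
    rw [osc_cos hgi x w, osc] at h2
    have h3 : ∀ ξ, ((1 - Real.cos (inner ℝ ξ w) : ℝ) : ℂ) * g ξ =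
        g ξ - ((Real.cos (inner ℝ ξ w) : ℝ) : ℂ) * g ξ := fun ξ => by push_cast; ring
    simp_rw [h3]
    rw [h2]
    ring
  constructor
  · have h1 := hint.integral_prod_right
    simp_rw [hinner] at h1
    have h2 := h1.const_mul (-2)
    refine h2.congr (ae_of_all _ fun w => ?_)
    dsimp only; ring
  · have h1 : ∀ ξ, Complex.exp (((inner ℝ ξ x : ℝ) : ℂ) * Complex.I) *
        (((symbol d α k ξ : ℝ) : ℂ) * g ξ) = ∫ w, f (ξ, w) := by
      intro ξ
      rw [symbol_eq, ← integral_complex_ofReal, mul_left_comm, ← integral_mul_const]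
      congr 1; ext w
      rw [hf]
      push_cast; ring
    rw [osc]
    simp_rw [h1]
    rw [integral_integral_swap hint]
    simp_rw [hinner]
    rw [integral_const_mul]

/-- A difference in the space variable gains a derivative and loses a constant. -/
lemma norm_iteratedFDeriv_fwdDiff_le (hα : 0 < α) {f : E d → ℂ} {n : ℕ}
    (hf : ContDiff ℝ (n + 1 : ℕ) f) {B : ℝ}
    (hB : ∀ x, ‖iteratedFDeriv ℝ (n + 1) f x‖ ≤ B * decay d α x) {a : E d} (ha : ‖a‖ ≤ 1) :
    ContDiff ℝ n (fwdDiff a f) ∧ ∀ x, ‖iteratedFDeriv ℝ n (fwdDiff a f) x‖ ≤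
      2 ^ ((d : ℝ) + α) * B * ‖a‖ * decay d α x := by
  have hn : (n : WithTop ℕ∞) ≤ ((n + 1 : ℕ) : WithTop ℕ∞) := by exact_mod_cast n.le_succ
  have hlt : (n : WithTop ℕ∞) < ((n + 1 : ℕ) : WithTop ℕ∞) := by exact_mod_cast n.lt_succ_self
  have hf' := hf.of_le hn
  have hfa : ContDiff ℝ n fun x => f (x + a) := hf'.comp (by fun_prop)
  refine ⟨hfa.sub hf', fun x => ?_⟩
  have e : iteratedFDeriv ℝ n (fwdDiff a f) x =
      iteratedFDeriv ℝ n f (x + a) - iteratedFDeriv ℝ n f x := by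
    rw [← iteratedFDeriv_comp_add_right]
    exact iteratedFDeriv_sub_apply hfa.contDiffAt hf'.contDiffAt
  have hB0 : 0 ≤ B := by
    have := (norm_nonneg _).trans (hB 0)
    exact nonneg_of_mul_nonneg_left this (decay_pos 0)
  rw [e]
  -- The segment from `x` to `x + a` stays in the unit ball around `x`, where all values of `decay`
  -- are comparable to the value at `x`.
  have hmv := (convex_closedBall x 1).norm_image_sub_le_of_norm_fderiv_le (𝕜 := ℝ)
    (f := iteratedFDeriv ℝ n f) (C := B * (2 ^ ((d : ℝ) + α) * decay d α x)) (x := x) (y := x + a)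
    (fun y _ => (hf.differentiable_iteratedFDeriv hlt) y) (fun y hy => ?_)
    (Metric.mem_closedBall_self zero_le_one) (by simpa using ha)
  · rw [add_sub_cancel_left] at hmv
    refine hmv.trans_eq ?_
    ring
  · rw [norm_fderiv_iteratedFDeriv]
    refine (hB y).trans (mul_le_mul_of_nonneg_left ?_ hB0)
    have := decay_add_le hα x (a := y - x) (by simpa [dist_eq_norm] using hy)
    rwa [add_sub_cancel] at this

/-- Iterated differences are controlled by derivatives. -/
lemma norm_foldr_fwdDiff_le (hα : 0 < α) (l : List (E d)) : ∀ (f : E d → ℂ) (B : ℝ) (n : ℕ),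
    ContDiff ℝ (n + l.length : ℕ) f →
    (∀ x, ‖iteratedFDeriv ℝ (n + l.length) f x‖ ≤ B * decay d α x) → (∀ a ∈ l, ‖a‖ ≤ 1) →
    ContDiff ℝ n (l.foldr fwdDiff f) ∧ ∀ x, ‖iteratedFDeriv ℝ n (l.foldr fwdDiff f) x‖ ≤
      (2 ^ ((d : ℝ) + α)) ^ l.length * B * (l.map fun a => ‖a‖).prod * decay d α x := by
  induction l with
  | nil => intro f B n hf hB _; simpa using ⟨hf, hB⟩
  | cons a l ih =>
    intro f B n hf hB hl
    have e : n + (a :: l).length = n + 1 + l.length := by simp; ring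
    rw [e] at hf hB
    obtain ⟨h1, h2⟩ := ih f B (n + 1) hf hB fun b hb => hl b (List.mem_cons_of_mem a hb)
    obtain ⟨h3, h4⟩ := norm_iteratedFDeriv_fwdDiff_le hα h1 h2 (hl a List.mem_cons_self)
    refine ⟨h3, fun x => (h4 x).trans_eq ?_⟩
    simp only [List.length_cons, List.map_cons, List.prod_cons]
    ring

/-- The Fourier multiplier of an iterated difference. -/
def diffMult {d : ℕ} (l : List (E d)) (ξ : E d) : ℂ :=
  (l.map fun a => Complex.exp (((inner ℝ ξ a : ℝ) : ℂ) * Complex.I) - 1).prod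

lemma continuous_diffMult (l : List (E d)) : Continuous (diffMult l) := by
  induction l with
  | nil => exact continuous_const
  | cons a l ih =>
    have : diffMult (a :: l) = fun ξ =>
      (Complex.exp (((inner ℝ ξ a : ℝ) : ℂ) * Complex.I) - 1) * diffMult l ξ := by
      ext ξ; simp [diffMult]
    rw [this]; fun_prop

lemma norm_diffMult_le (l : List (E d)) (ξ : E d) : ‖diffMult l ξ‖ ≤ 2 ^ l.length := by
  induction l with
  | nil => simp [diffMult]
  | cons a l ih =>
    have e : diffMult (a :: l) ξ =
      (Complex.exp (((inner ℝ ξ a : ℝ) : ℂ) * Complex.I) - 1) * diffMult l ξ := by simp [diffMult]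
    rw [e, norm_mul, List.length_cons, pow_succ']
    refine mul_le_mul ((norm_sub_le _ _).trans ?_) ih (norm_nonneg _) zero_le_two
    rw [norm_wave, norm_one]; norm_num

lemma integrable_diffMult_mul {g : E d → ℂ} (hg : Integrable g) (l : List (E d)) :
    Integrable fun ξ => diffMult l ξ * g ξ :=
  (hg.norm.const_mul (2 ^ l.length)).mono'
    ((continuous_diffMult l).aestronglyMeasurable.mul hg.aestronglyMeasurable)
    (ae_of_all _ fun ξ => by
      rw [norm_mul]; exact mul_le_mul_of_nonneg_right (norm_diffMult_le l ξ) (norm_nonneg _))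

/-- Differences are used in place of derivatives because their multipliers are bounded and commute
with the one for the large jumps. They can be estimated on the smooth part first and then carried
through the transfer argument. -/
lemma osc_diffMult {g : E d → ℂ} (hg : Integrable g) (l : List (E d)) :
    osc (fun ξ => diffMult l ξ * g ξ) = l.foldr fwdDiff (osc g) := by
  induction l with
  | nil => simp [diffMult]
  | cons a l ih =>
    ext x
    have hi := integrable_diffMult_mul hg l
    have hi' : Integrable fun ξ => Complex.exp (((inner ℝ ξ a : ℝ) : ℂ) * Complex.I) *
      (diffMult l ξ * g ξ) := integrable_osc hi a
    rw [List.foldr_cons, ← ih, fwdDiff, ← osc_shift, ← osc_sub hi' hi]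
    congr 1; ext ξ
    simp [diffMult]; ring

lemma foldr_fwdDiff_comp_smul (c : ℝ) (F : E d → ℂ) (l : List (E d)) (x : E d) :
    l.foldr fwdDiff (fun x => F (c • x)) x = (l.map (c • ·)).foldr fwdDiff F (c • x) := by
  induction l generalizing x with
  | nil => rfl
  | cons a l ih => simp only [List.foldr_cons, List.map_cons, fwdDiff, ih, smul_add]

lemma exists_osc_smallChar_le (hd : 1 ≤ d) (hα0 : 0 < α) (hα2 : α < 2) (h0 : 0 < κ₀) (κ₁ : ℝ)
    (m : ℕ) : ∃ B, 0 ≤ B ∧ ∀ k : E d → ℝ, IsDensity d κ₀ κ₁ k → ∀ l : List (E d), l.length = m →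
      (∀ a ∈ l, ‖a‖ ≤ 1) → ∀ x, ‖osc (fun ξ => diffMult l ξ * smallChar d α k ξ) x‖ ≤
        B * (l.map fun a => ‖a‖).prod * decay d α x := by
  obtain ⟨C, hC⟩ := exists_fourier_smallChar_le hd hα0 hα2 h0 κ₁ m
  obtain ⟨_, hI⟩ := exists_integral_smallChar_le hd hα0 hα2 h0 κ₁ 0 0
  -- The factor with `8` accounts for the `2π` in the normalisation of the Fourier transform, since
  -- `2π ≤ 8`.
  refine ⟨(2 ^ ((d : ℝ) + α)) ^ m * |C| * 8 ^ ((d : ℝ) + α), by positivity,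
    fun k hk l hl ha x => ?_⟩
  have hint : Integrable (smallChar d α k) := by
    have h := (hI k hk).1
    simp only [pow_zero, one_mul, norm_iteratedFDeriv_zero] at h
    exact (integrable_norm_iff (contDiff_smallChar hd hα0 hα2 hk.measurable
      (hk.abs_le h0) 0).continuous.aestronglyMeasurable).1 h
  rw [osc_diffMult hint]
  have e : osc (smallChar d α k) = fun x =>
      FourierTransform.fourier (smallChar d α k) ((-(2 * Real.pi)⁻¹) • x) :=
    funext fun x => osc_eq_fourier _ x
  set c : ℝ := -(2 * Real.pi)⁻¹
  have hpi := Real.pi_gt_three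
  have hpi4 := Real.pi_le_four
  have hc : |c| = (2 * Real.pi)⁻¹ := by rw [abs_neg, abs_of_pos (by positivity)]
  have hc1 : |c| ≤ 1 := by rw [hc]; exact inv_le_one_of_one_le₀ (by linarith)
  have hcn : ∀ a : E d, ‖c • a‖ ≤ ‖a‖ := fun a => by
    rw [norm_smul]; exact mul_le_of_le_one_left (norm_nonneg _) hc1
  rw [e, foldr_fwdDiff_comp_smul]
  obtain ⟨hsm, hb⟩ := hC k hk
  obtain ⟨-, h2⟩ := norm_foldr_fwdDiff_le hα0 (l.map (c • ·)) _ |C| 0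
    (by simpa [hl] using hsm)
    (fun x => by
      have h3 : 0 + (l.map (c • ·)).length = m := by simpa using hl
      rw [h3]
      exact (hb x).trans (mul_le_mul_of_nonneg_right (le_abs_self C) (decay_pos x).le))
    (fun b hb => by
      obtain ⟨a, hal, rfl⟩ := List.mem_map.1 hb
      exact (hcn a).trans (ha a hal))
  have h3 := h2 (c • x)
  rw [norm_iteratedFDeriv_zero, List.length_map, hl, List.map_map] at h3
  have hprod : (l.map ((fun a => ‖a‖) ∘ (c • ·))).prod ≤ (l.map fun a => ‖a‖).prod ∧
      0 ≤ (l.map ((fun a => ‖a‖) ∘ (c • ·))).prod := by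
    clear ha hl h2 h3
    induction l with
    | nil => simp
    | cons a l ih =>
      simp only [List.map_cons, List.prod_cons, Function.comp_apply] at ih ⊢
      exact ⟨mul_le_mul (hcn a) ih.1 ih.2 (norm_nonneg _), mul_nonneg (norm_nonneg _) ih.2⟩
  have hdec : decay d α (c • x) ≤ 8 ^ ((d : ℝ) + α) * decay d α x := by
    refine decay_le_mul hα0 (by norm_num) ?_
    rw [norm_smul, Real.norm_eq_abs, hc]
    have hx := norm_nonneg x
    have : 1 ≤ 8 * (2 * Real.pi)⁻¹ := by
      rw [← div_eq_mul_inv, le_div_iff₀ (by positivity)]; linarith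
    nlinarith
  have hd0 := (decay_pos (α := α) x).le
  have hp0 := hprod.2.trans hprod.1
  calc _ ≤ _ := h3
    _ ≤ (2 ^ ((d : ℝ) + α)) ^ m * |C| * (l.map fun a => ‖a‖).prod *
        (8 ^ ((d : ℝ) + α) * decay d α x) := by
      gcongr
      · exact (decay_pos _).le
      · exact hprod.1
    _ = _ := by ring

/-- Iterated differences of the heat kernel at time one, uniformly in the density. -/
lemma exists_osc_charFn_le (hd : 1 ≤ d) (hα0 : 0 < α) (hα2 : α < 2) (h0 : 0 < κ₀) (κ₁ : ℝ)
    (m : ℕ) : ∃ B, 0 ≤ B ∧ ∀ k : E d → ℝ, IsDensity d κ₀ κ₁ k → ∀ l : List (E d), l.length = m →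
      (∀ a ∈ l, ‖a‖ ≤ 1) → ∀ x, ‖l.foldr fwdDiff (osc (charFn d α k 1)) x‖ ≤
        B * (l.map fun a => ‖a‖).prod * decay d α x := by
  obtain ⟨B, hB, h⟩ := exists_osc_smallChar_le hd hα0 hα2 h0 κ₁ m
  obtain ⟨_, hI⟩ := exists_integral_smallChar_le hd hα0 hα2 h0 κ₁ 0 0
  refine ⟨B * Real.exp (jumpConst d α κ₁), by positivity, fun k hk l hl ha x => ?_⟩
  have hint : Integrable (smallChar d α k) := by
    have h := (hI k hk).1
    simp only [pow_zero, one_mul, norm_iteratedFDeriv_zero] at h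
    exact (integrable_norm_iff (contDiff_smallChar hd hα0 hα2 hk.measurable
      (hk.abs_le h0) 0).continuous.aestronglyMeasurable).1 h
  rw [← osc_diffMult (integrable_charFn hd hα0 hα2 h0 hk one_pos)]
  -- Additivity of the symbol factors the characteristic function into small and large jumps; the
  -- difference multiplier is grouped with the small ones.
  have e : (fun ξ => diffMult l ξ * charFn d α k 1 ξ) = fun ξ =>
      ((Real.exp (-symbol d α (largePart k) ξ) : ℝ) : ℂ) *
        (diffMult l ξ * smallChar d α k ξ) := by
    ext ξ
    have h1 := symbol_add hd hα0 hα2 (measurable_smallPart hk.measurable)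
      (measurable_largePart hk.measurable) (abs_smallPart_le (hk.abs_le h0))
      (abs_largePart_le (hk.abs_le h0)) ξ
    rw [smallPart_add_largePart] at h1
    rw [charFn, smallChar, h1, neg_one_mul, neg_add, Real.exp_add, Complex.ofReal_mul]
    ring
  have hp : 0 ≤ (l.map fun a => ‖a‖).prod := List.prod_nonneg fun b hb => by
    obtain ⟨a, -, rfl⟩ := List.mem_map.1 hb
    exact norm_nonneg a
  rw [e]
  refine (norm_osc_mul_largePart_le hα0 hk.measurable (hk.abs_le h0)
    (fun z => h0.le.trans (hk.lower z)) (integrable_diffMult_mul hint l) (mul_nonneg hB hp)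
    (h k hk l hl ha) x).trans_eq ?_
  ring

end TimeOne

/-! ### Second differences at time one and dependence on the density. -/

section Regularity

variable {d : ℕ} {α κ₀ κ₁ : ℝ} {k : E d → ℝ}

/-- The second difference of a complex function. -/
def cSecondDiff {d : ℕ} (f : E d → ℂ) (x z : E d) : ℂ := f (x + z) + f (x - z) - 2 * f x

lemma cSecondDiff_eq (f : E d → ℂ) (x z : E d) :
    cSecondDiff f x z = fwdDiff z (fwdDiff z f) (x - z) := by
  simp only [cSecondDiff, fwdDiff, sub_add_cancel]
  ring

/-- For small `z` the second difference is an iterated forward difference based at `x - z`, which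
gives `|z|²`. For large `z` the triangle inequality is enough. -/
lemma norm_cSecondDiff_le {f : E d → ℂ} {B : ℝ} (hB : 0 ≤ B)
    (h1 : ∀ x, ‖f x‖ ≤ B * decay d α x)
    (h2 : ∀ z, ‖z‖ ≤ 1 → ∀ x, ‖fwdDiff z (fwdDiff z f) x‖ ≤ B * ‖z‖ ^ 2 * decay d α x)
    (x z : E d) : ‖cSecondDiff f x z‖ ≤ 2 * B * diffWeight d α x z := by
  have d1 := (decay_pos (α := α) x).le
  have d2 := (decay_pos (α := α) (x + z)).le
  have d3 := (decay_pos (α := α) (x - z)).le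
  rcases le_total ‖z‖ 1 with hz | hz
  · rw [cSecondDiff_eq, diffWeight, min_eq_left (by nlinarith [norm_nonneg z])]
    refine (h2 z hz _).trans ?_
    have : 0 ≤ B * ‖z‖ ^ 2 := by positivity
    nlinarith [mul_nonneg this d1, mul_nonneg this d2, mul_nonneg this d3]
  · rw [diffWeight, min_eq_right (by nlinarith), one_mul, cSecondDiff]
    have h3 : ‖(2 : ℂ) * f x‖ = 2 * ‖f x‖ := by simp
    have h4 := norm_sub_le (f (x + z) + f (x - z)) (2 * f x)
    have h5 := norm_add_le (f (x + z)) (f (x - z))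
    nlinarith [h1 x, h1 (x + z), h1 (x - z), mul_nonneg hB d2, mul_nonneg hB d3]

/-- Convex combination of two densities. -/
lemma IsDensity.interp {k' : E d → ℝ} (hk : IsDensity d κ₀ κ₁ k) (hk' : IsDensity d κ₀ κ₁ k')
    {θ : ℝ} (h0 : 0 ≤ θ) (h1 : θ ≤ 1) :
    IsDensity d κ₀ κ₁ (fun z => k' z + θ * (k z - k' z)) where
  measurable := hk'.measurable.add (measurable_const.mul (hk.measurable.sub hk'.measurable))
  lower z := by nlinarith [hk.lower z, hk'.lower z]
  upper z := by nlinarith [hk.upper z, hk'.upper z]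
  symm z := by rw [← hk.symm, ← hk'.symm]

lemma symbol_interp (hd : 1 ≤ d) (hα0 : 0 < α) (hα2 : α < 2) (h0 : 0 < κ₀) {k' : E d → ℝ}
    (hk : IsDensity d κ₀ κ₁ k) (hk' : IsDensity d κ₀ κ₁ k') (θ : ℝ) (ξ : E d) :
    symbol d α (fun z => k' z + θ * (k z - k' z)) ξ =
      symbol d α k' ξ + θ * (symbol d α k ξ - symbol d α k' ξ) := by
  have hb : ∀ z, |k z - k' z| ≤ κ₁ + κ₁ := fun z =>
    (abs_sub _ _).trans (add_le_add (hk.abs_le h0 z) (hk'.abs_le h0 z))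
  have hm := hk.measurable.sub hk'.measurable
  rw [symbol_add hd hα0 hα2 (k' := fun z => θ * (k z - k' z)) (K := κ₁) (K' := |θ| * (κ₁ + κ₁)) hk'.measurable
    (measurable_const.mul hm) (hk'.abs_le h0) (fun z => by rw [abs_mul]; gcongr; exact hb z),
    symbol_const_mul, symbol_sub hd hα0 hα2 hk.measurable hk'.measurable (hk.abs_le h0)
    (hk'.abs_le h0)]

lemma hasDerivAt_exp_interp (a b θ : ℝ) :
    HasDerivAt (fun θ => Real.exp (-1 * (b + θ * (a - b))))
      ((b - a) * Real.exp (-1 * (b + θ * (a - b)))) θ := by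
  have h : HasDerivAt (fun θ : ℝ => -1 * (b + θ * (a - b))) (b - a) θ := by
    have := (((hasDerivAt_id θ).mul_const (a - b)).const_add b).const_mul (-1)
    convert! this using 1
    ring
  convert! h.exp using 1
  ring

lemma exp_sub_exp_eq_integral (a b : ℝ) : Real.exp (-1 * a) - Real.exp (-1 * b) =
    ∫ θ in Ioc (0 : ℝ) 1, (b - a) * Real.exp (-1 * (b + θ * (a - b))) := by
  have h := intervalIntegral.integral_eq_sub_of_hasDerivAt (a := 0) (b := 1)
    (fun θ _ => hasDerivAt_exp_interp a b θ)
    (by fun_prop : Continuous fun θ : ℝ =>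
      (b - a) * Real.exp (-1 * (b + θ * (a - b)))).continuousOn.intervalIntegrable
  rw [intervalIntegral.integral_of_le zero_le_one] at h
  rw [h]
  congr 3 <;> ring

/-- Duhamel's formula for the dependence of the semigroup on the density. -/
lemma osc_charFn_sub (hd : 1 ≤ d) (hα0 : 0 < α) (hα2 : α < 2) (h0 : 0 < κ₀) {k' : E d → ℝ}
    (hk : IsDensity d κ₀ κ₁ k) (hk' : IsDensity d κ₀ κ₁ k') (l : List (E d)) (x : E d) :
    l.foldr fwdDiff (osc (charFn d α k 1)) x - l.foldr fwdDiff (osc (charFn d α k' 1)) x =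
      ∫ θ in Ioc (0 : ℝ) 1, osc (fun ξ => ((symbol d α (fun z => k' z - k z) ξ : ℝ) : ℂ) *
        (diffMult l ξ * charFn d α (fun z => k' z + θ * (k z - k' z)) 1 ξ)) x := by
  have hψ := continuous_symbol hd hα0 hα2 hk.measurable (hk.abs_le h0)
  have hψ' := continuous_symbol hd hα0 hα2 hk'.measurable (hk'.abs_le h0)
  have hL := continuous_diffMult l
  have hi := integrable_charFn hd hα0 hα2 h0 hk one_pos
  have hi' := integrable_charFn hd hα0 hα2 h0 hk' one_pos
  rw [← osc_diffMult hi, ← osc_diffMult hi', ← osc_sub (integrable_diffMult_mul hi l)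
    (integrable_diffMult_mul hi' l)]
  simp only [charFn, symbol_interp hd hα0 hα2 h0 hk hk',
    symbol_sub hd hα0 hα2 hk'.measurable hk.measurable (hk'.abs_le h0) (hk.abs_le h0)]
  simp only [osc]
  set f : E d × ℝ → ℂ := fun p => Complex.exp (((inner ℝ p.1 x : ℝ) : ℂ) * Complex.I) *
    (((symbol d α k' p.1 - symbol d α k p.1 : ℝ) : ℂ) * (diffMult l p.1 *
      ((Real.exp (-1 * (symbol d α k' p.1 + p.2 * (symbol d α k p.1 - symbol d α k' p.1))) :
        ℝ) : ℂ))) with hf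
  have hfc : Continuous f := by fun_prop
  -- One envelope serves for every `θ`, because convex combinations of two densities stay in the
  -- class.
  have hint : Integrable f (volume.prod (volume.restrict (Ioc 0 1))) := by
    obtain ⟨G, hG, hGk⟩ := exists_dominating hd hα0 hα2 h0 (one_pos)
    set A : ℝ := 2 ^ l.length * (4 * κ₁ * levyMass d α)
    have hA := hG.const_mul A
    refine (hA.mul_prod (integrable_const (1 : ℝ))).mono' hfc.aestronglyMeasurable ?_
    have e : (volume : Measure (E d)).prod ((volume : Measure ℝ).restrict (Ioc 0 1)) =
        ((volume : Measure (E d)).prod volume).restrict (univ ×ˢ Ioc 0 1) := by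
      rw [← Measure.prod_restrict, Measure.restrict_univ]
    rw [e]
    refine ae_restrict_of_forall_mem (MeasurableSet.univ.prod measurableSet_Ioc) fun p hp => ?_
    obtain ⟨-, hp0, hp1⟩ := hp
    have h1 := hGk κ₁ _ (hk.interp hk' hp0.le hp1) p.1
    rw [symbol_interp hd hα0 hα2 h0 hk hk'] at h1
    have h2 : |symbol d α k' p.1 - symbol d α k p.1| ≤
        4 * κ₁ * levyMass d α * (1 + ‖p.1‖ ^ 2) := by
      refine (abs_sub _ _).trans ((add_le_add (abs_symbol_le hd hα0 hα2 (hk'.abs_le h0) p.1)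
        (abs_symbol_le hd hα0 hα2 (hk.abs_le h0) p.1)).trans_eq ?_)
      ring
    have h3 := hk.upper_nonneg h0
    have h4 := levyMass_nonneg (d := d) (α := α)
    rw [hf]
    simp only [norm_mul, norm_wave, one_mul, Complex.norm_real, mul_one]
    rw [Real.norm_eq_abs, Real.norm_of_nonneg (Real.exp_pos _).le]
    calc _ ≤ (4 * κ₁ * levyMass d α * (1 + ‖p.1‖ ^ 2)) * (2 ^ l.length *
          Real.exp (-1 * (symbol d α k' p.1 + p.2 * (symbol d α k p.1 - symbol d α k' p.1)))) := by
          gcongr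
          exact norm_diffMult_le l p.1
      _ = A * ((1 + ‖p.1‖ ^ 2) * Real.exp (-1 * (symbol d α k' p.1 +
          p.2 * (symbol d α k p.1 - symbol d α k' p.1)))) := by ring
      _ ≤ A * G p.1 := by gcongr
  rw [← integral_integral_swap (f := fun ξ θ => f (ξ, θ)) hint]
  congr 1; ext ξ
  simp only [hf]
  rw [integral_const_mul, integral_const_mul, ← mul_sub, ← Complex.ofReal_sub,
    exp_sub_exp_eq_integral, integral_const_mul, integral_const_mul]
  push_cast [← integral_complex_ofReal]
  ring

lemma length_pair_prod (z : E d) (l : List (E d)) :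
    ((z :: z :: l).map fun a => ‖a‖).prod = ‖z‖ ^ 2 * (l.map fun a => ‖a‖).prod := by
  simp only [List.map_cons, List.prod_cons]; ring

lemma prod_norm_nonneg (l : List (E d)) : 0 ≤ (l.map fun a => ‖a‖).prod :=
  List.prod_nonneg fun b hb => by
    obtain ⟨a, -, rfl⟩ := List.mem_map.1 hb
    exact norm_nonneg a

lemma exists_cSecondDiff_charFn_le (hd : 1 ≤ d) (hα0 : 0 < α) (hα2 : α < 2) (h0 : 0 < κ₀)
    (κ₁ : ℝ) (m : ℕ) : ∃ B, 0 ≤ B ∧ ∀ k : E d → ℝ, IsDensity d κ₀ κ₁ k → ∀ l : List (E d),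
      l.length = m → (∀ a ∈ l, ‖a‖ ≤ 1) → ∀ x z,
      ‖cSecondDiff (l.foldr fwdDiff (osc (charFn d α k 1))) x z‖ ≤
        B * (l.map fun a => ‖a‖).prod * diffWeight d α x z := by
  obtain ⟨B, hB, hBk⟩ := exists_osc_charFn_le hd hα0 hα2 h0 κ₁ m
  obtain ⟨B', hB', hBk'⟩ := exists_osc_charFn_le hd hα0 hα2 h0 κ₁ (m + 2)
  refine ⟨2 * (B + B'), by positivity, fun k hk l hl ha x z => ?_⟩
  have hp := prod_norm_nonneg l
  refine (norm_cSecondDiff_le (α := α) (B := (B + B') * (l.map fun a => ‖a‖).prod) (by positivity)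
    (fun x => ?_) (fun z hz x => ?_) x z).trans_eq (by ring)
  · have hdx := (decay_pos (α := α) x).le
    refine (hBk k hk l hl ha x).trans ?_
    gcongr
    linarith
  · have h := hBk' k hk (z :: z :: l) (by simp [hl]) (by
      intro a haz
      rcases List.mem_cons.1 haz with rfl | haz
      · exact hz
      rcases List.mem_cons.1 haz with rfl | haz
      · exact hz
      · exact ha a haz) x
    rw [length_pair_prod] at h
    have hdx := (decay_pos (α := α) x).le
    refine h.trans ?_
    calc _ = B' * (‖z‖ ^ 2 * (l.map fun a => ‖a‖).prod * decay d α x) := by ring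
      _ ≤ (B + B') * (‖z‖ ^ 2 * (l.map fun a => ‖a‖).prod * decay d α x) := by
        gcongr; linarith
      _ = _ := by ring

/-- Lipschitz dependence on the density of the iterated differences. -/
lemma exists_osc_charFn_sub_le (hd : 1 ≤ d) (hα0 : 0 < α) (hα2 : α < 2) (h0 : 0 < κ₀)
    (κ₁ : ℝ) (m : ℕ) : ∃ B, 0 ≤ B ∧ ∀ k k' : E d → ℝ, IsDensity d κ₀ κ₁ k →
      IsDensity d κ₀ κ₁ k' → ∀ ε, (∀ z, |k z - k' z| ≤ ε) → ∀ l : List (E d), l.length = m →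
      (∀ a ∈ l, ‖a‖ ≤ 1) → ∀ x,
      ‖l.foldr fwdDiff (osc (charFn d α k 1)) x - l.foldr fwdDiff (osc (charFn d α k' 1)) x‖ ≤
        B * ε * (l.map fun a => ‖a‖).prod * decay d α x := by
  obtain ⟨B, hB, hBk⟩ := exists_cSecondDiff_charFn_le hd hα0 hα2 h0 κ₁ m
  have hdc := diffConst_nonneg (d := d) (α := α)
  refine ⟨B * diffConst d α, by positivity, fun k k' hk hk' ε hε l hl ha x => ?_⟩
  have hε0 : 0 ≤ ε := (abs_nonneg _).trans (hε 0)
  have hp := prod_norm_nonneg l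
  rw [osc_charFn_sub hd hα0 hα2 h0 hk hk']
  refine (norm_setIntegral_le_of_norm_le_const (C := B * diffConst d α * ε *
    (l.map fun a => ‖a‖).prod * decay d α x) (by simp) fun θ hθ => ?_).trans (by simp)
  have hkθ := hk.interp hk' hθ.1.le hθ.2
  have hε' : ∀ z, |k' z - k z| ≤ ε := fun z => by rw [abs_sub_comm]; exact hε z
  have hi := integrable_charFn hd hα0 hα2 h0 hkθ one_pos
  have hsq := integrable_sq_charFn hd hα0 hα2 h0 hkθ one_pos
  have hm := (integrable_diffMult_mul hi l).aestronglyMeasurable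
  have hsq' : Integrable fun ξ => (1 + ‖ξ‖ ^ 2) *
      ‖diffMult l ξ * charFn d α (fun z => k' z + θ * (k z - k' z)) 1 ξ‖ := by
    refine (hsq.const_mul (2 ^ l.length)).mono' ((by fun_prop : Continuous fun ξ : E d =>
      1 + ‖ξ‖ ^ 2).aestronglyMeasurable.mul hm.norm) (ae_of_all _ fun ξ => ?_)
    rw [Real.norm_of_nonneg (by positivity), norm_mul, mul_left_comm]
    gcongr
    exact norm_diffMult_le l ξ
  -- The multiplier `ψ' - ψ` is, up to sign, the nonlocal operator with density `k' - k`. It acts on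
  -- the interpolated kernel, whose second differences are already controlled, and its density
  -- supplies the factor `ε`.
  rw [(osc_symbol hd hα0 hα2 (k := fun z => k' z - k z) (hk'.measurable.sub hk.measurable) hε' hm hsq' x).2,
    osc_diffMult hi, norm_mul]
  have hw := integrable_diffWeight hd hα0 hα2 x
  have h1 := norm_integral_le_of_norm_le
    (f := fun w => cSecondDiff (l.foldr fwdDiff
      (osc (charFn d α (fun z => k' z + θ * (k z - k' z)) 1))) x w *
      (((k' w - k w) * levy d α w : ℝ) : ℂ))
    (hw.const_mul (B * (l.map fun a => ‖a‖).prod * ε)) (ae_of_all _ fun w => by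
      rw [norm_mul, Complex.norm_real, norm_mul, Real.norm_of_nonneg (levy_nonneg w)]
      have h2 := hBk _ hkθ l hl ha x w
      have h3 := hε' w
      have h4 := levy_nonneg (α := α) w
      have h5 := diffWeight_nonneg (α := α) x w
      calc _ ≤ B * (l.map fun a => ‖a‖).prod * diffWeight d α x w * (ε * levy d α w) := by
            gcongr
            exact h3
        _ = _ := by ring)
  rw [integral_const_mul] at h1
  have h2 := integral_diffWeight_le hd hα0 hα2 x
  have hn : ‖(-(1 / 2) : ℂ)‖ ≤ 1 := by rw [norm_neg]; norm_num
  have hdx := (decay_pos (α := α) x).le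
  calc _ ≤ 1 * (B * (l.map fun a => ‖a‖).prod * ε * (diffConst d α * decay d α x)) := by
        gcongr
        exact h1.trans (by gcongr)
    _ = _ := by ring

/-- Uniform estimates for the heat kernel at time one: size, second differences, their modulus of
continuity, and their dependence on the density. -/
lemma exists_heatKernel_one_bounds (hd : 1 ≤ d) (hα0 : 0 < α) (hα2 : α < 2) (h0 : 0 < κ₀)
    (κ₁ : ℝ) : ∃ C, 0 < C ∧ ∀ k : E d → ℝ, IsDensity d κ₀ κ₁ k →
      (∀ x, |heatKernel d α k 1 x| ≤ C * decay d α x) ∧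
      (∀ x z, |secondDiff (heatKernel d α k 1) x z| ≤ C * diffWeight d α x z) ∧
      (∀ x x' z, |secondDiff (heatKernel d α k 1) x z - secondDiff (heatKernel d α k 1) x' z| ≤
        C * min ‖x - x'‖ 1 * (diffWeight d α x z + diffWeight d α x' z)) ∧
      ∀ k' : E d → ℝ, IsDensity d κ₀ κ₁ k' → ∀ ε, (∀ z, |k z - k' z| ≤ ε) → ∀ x z,
        |secondDiff (heatKernel d α k 1) x z - secondDiff (heatKernel d α k' 1) x z| ≤
          C * ε * diffWeight d α x z := by
  obtain ⟨B0, hB0, hb0⟩ := exists_osc_charFn_le hd hα0 hα2 h0 κ₁ 0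
  obtain ⟨B2, hB2, hb2⟩ := exists_cSecondDiff_charFn_le hd hα0 hα2 h0 κ₁ 0
  obtain ⟨B3, hB3, hb3⟩ := exists_cSecondDiff_charFn_le hd hα0 hα2 h0 κ₁ 1
  obtain ⟨D0, hD0, hd0⟩ := exists_osc_charFn_sub_le hd hα0 hα2 h0 κ₁ 0
  obtain ⟨D2, hD2, hd2⟩ := exists_osc_charFn_sub_le hd hα0 hα2 h0 κ₁ 2
  set c : ℝ := (2 * Real.pi) ^ (-(d : ℝ)) with hc
  have hc0 : 0 < c := by have := Real.pi_pos; positivity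
  have hp : ∀ k : E d → ℝ, IsDensity d κ₀ κ₁ k → ∀ x,
      heatKernel d α k 1 x = c * (osc (charFn d α k 1) x).re :=
    fun k hk x => heatKernel_eq_osc hd hα0 hα2 h0 hk one_pos x
  have hsd : ∀ k : E d → ℝ, IsDensity d κ₀ κ₁ k → ∀ x z,
      secondDiff (heatKernel d α k 1) x z = c * (cSecondDiff (osc (charFn d α k 1)) x z).re := by
    intro k hk x z
    simp only [secondDiff, cSecondDiff, hp k hk, Complex.add_re, Complex.sub_re, Complex.mul_re,
      Complex.re_ofNat, Complex.im_ofNat]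
    ring
  have hre : ∀ w : ℂ, |c * w.re| ≤ c * ‖w‖ := fun w => by
    rw [abs_mul, abs_of_pos hc0]; gcongr; exact Complex.abs_re_le_norm w
  have h2 : ∀ k : E d → ℝ, IsDensity d κ₀ κ₁ k → ∀ x z,
      |secondDiff (heatKernel d α k 1) x z| ≤ c * B2 * diffWeight d α x z := by
    intro k hk x z
    rw [hsd k hk]
    have := hb2 k hk [] rfl (by simp) x z
    simp only [List.foldr_nil, List.map_nil, List.prod_nil, mul_one] at this
    exact (hre _).trans (by rw [mul_assoc]; gcongr)
  set S := B0 + B2 + B3 + 2 * (D0 + D2) + 1 with hS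
  have hSpos : 0 < S := by positivity
  refine ⟨c * S, by positivity, fun k hk => ⟨fun x => ?_, fun x z => ?_, fun x x' z => ?_,
    fun k' hk' ε hε x z => ?_⟩⟩
  · rw [hp k hk]
    have := hb0 k hk [] rfl (by simp) x
    simp only [List.foldr_nil, List.map_nil, List.prod_nil, mul_one] at this
    have hdx := (decay_pos (α := α) x).le
    refine (hre _).trans ?_
    rw [mul_assoc]
    gcongr
    refine this.trans ?_
    gcongr
    linarith
  · have hw := diffWeight_nonneg (α := α) x z
    refine (h2 k hk x z).trans ?_
    gcongr
    linarith
  · have hw := diffWeight_nonneg (α := α) x z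
    have hw' := diffWeight_nonneg (α := α) x' z
    rcases le_total ‖x - x'‖ 1 with hx | hx
    · rw [min_eq_left hx, hsd k hk, hsd k hk, ← mul_sub, ← Complex.sub_re]
      have := hb3 k hk [x - x'] rfl (by simpa using hx) x' z
      simp only [List.foldr_cons, List.foldr_nil, List.map_cons, List.map_nil, List.prod_cons,
        List.prod_nil, mul_one] at this
      -- The increment in the base point is one further difference, with step `x - x'`; the case of
      -- one prescribed difference therefore applies.
      have e : cSecondDiff (osc (charFn d α k 1)) x z - cSecondDiff (osc (charFn d α k 1)) x' z =
          cSecondDiff (fwdDiff (x - x') (osc (charFn d α k 1))) x' z := by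
        simp only [cSecondDiff, fwdDiff, add_sub_cancel]
        rw [show x' + z + (x - x') = x + z by abel, show x' - z + (x - x') = x - z by abel]
        ring
      rw [e]
      refine (hre _).trans ?_
      rw [mul_assoc, mul_assoc]
      gcongr
      refine this.trans ?_
      rw [mul_assoc]
      gcongr
      · linarith
      · linarith
    · rw [min_eq_right hx, mul_one]
      refine (abs_sub _ _).trans ((add_le_add (h2 k hk x z) (h2 k hk x' z)).trans ?_)
      rw [← mul_add]
      gcongr
      linarith
  · have hε0 : 0 ≤ ε := (abs_nonneg _).trans (hε 0)
    have hw := diffWeight_nonneg (α := α) x z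
    rw [hsd k hk, hsd k' hk', ← mul_sub, ← Complex.sub_re]
    have e : cSecondDiff (osc (charFn d α k 1)) x z - cSecondDiff (osc (charFn d α k' 1)) x z =
        cSecondDiff (fun x => osc (charFn d α k 1) x - osc (charFn d α k' 1) x) x z := by
      simp only [cSecondDiff]; ring
    rw [e]
    have hk0 := fun x => hd0 k k' hk hk' ε hε [] rfl (by simp) x
    simp only [List.foldr_nil, List.map_nil, List.prod_nil, mul_one] at hk0
    have key := norm_cSecondDiff_le (α := α)
      (f := fun x => osc (charFn d α k 1) x - osc (charFn d α k' 1) x)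
      (B := (D0 + D2) * ε) (by positivity) (fun x => by
        have hdx := (decay_pos (α := α) x).le
        refine (hk0 x).trans ?_
        gcongr
        linarith)
      (fun z hz x => by
        have hdx := (decay_pos (α := α) x).le
        have := hd2 k k' hk hk' ε hε [z, z] rfl (by simpa using hz) x
        rw [length_pair_prod] at this
        simp only [List.foldr_cons, List.foldr_nil, List.map_nil, List.prod_nil, mul_one] at this
        have e2 : fwdDiff z (fwdDiff z fun x =>
            osc (charFn d α k 1) x - osc (charFn d α k' 1) x) x =
            fwdDiff z (fwdDiff z (osc (charFn d α k 1))) x -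
              fwdDiff z (fwdDiff z (osc (charFn d α k' 1))) x := by
          simp only [fwdDiff]; ring
        rw [e2]
        refine this.trans ?_
        gcongr
        linarith) x z
    refine (hre _).trans ?_
    rw [mul_assoc, mul_assoc]
    gcongr
    refine key.trans ?_
    calc _ = 2 * (D0 + D2) * (ε * diffWeight d α x z) := by ring
      _ ≤ S * (ε * diffWeight d α x z) := by gcongr; linarith

end Regularity

/-! ### Scaling to arbitrary times. -/

section Scaling

variable {d : ℕ} {α κ₀ κ₁ : ℝ} {k : E d → ℝ}

/-- The weight `(t^{1/α} + |x|)^{-d-α}`. -/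
def kern (d : ℕ) (α t : ℝ) (x : E d) : ℝ := (t ^ (1 / α) + ‖x‖) ^ (-(d : ℝ) - α)

lemma kern_pos {t : ℝ} (ht : 0 < t) (x : E d) : 0 < kern d α t x := by unfold kern; positivity

lemma decay_inv_smul {t : ℝ} (ht : 0 < t) (x : E d) :
    decay d α ((t ^ (1 / α))⁻¹ • x) = (t ^ (1 / α)) ^ ((d : ℝ) + α) * kern d α t x := by
  have hr : 0 < t ^ (1 / α) := by positivity
  have e : 1 + ‖(t ^ (1 / α))⁻¹ • x‖ = (t ^ (1 / α))⁻¹ * (t ^ (1 / α) + ‖x‖) := by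
    rw [norm_smul, norm_inv, Real.norm_of_nonneg hr.le, mul_add, inv_mul_cancel₀ hr.ne']
  rw [decay, e, Real.mul_rpow (by positivity) (by positivity), kern, Real.inv_rpow hr.le,
    ← Real.rpow_neg hr.le]
  congr 2; ring

lemma rpow_one_div_rpow (hα : 0 < α) {t : ℝ} (ht : 0 < t) : (t ^ (1 / α)) ^ α = t := by
  rw [← Real.rpow_mul ht.le, one_div_mul_cancel hα.ne', Real.rpow_one]

/-- Scaling of the heat kernel to time one. -/
lemma heatKernel_scaling (hα : 0 < α) {t : ℝ} (ht : 0 < t) (x : E d) :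
    heatKernel d α k t x = (t ^ (1 / α)) ^ (-(d : ℝ)) *
      heatKernel d α (fun z => k (t ^ (1 / α) • z)) 1 ((t ^ (1 / α))⁻¹ • x) := by
  set r := t ^ (1 / α) with hr'
  have hr : 0 < r := by positivity
  have hrα : r ^ α = t := rpow_one_div_rpow hα ht
  rw [heatKernel, heatKernel]
  have e : ∀ ξ : E d, Real.cos (inner ℝ ξ (r⁻¹ • x)) *
      Real.exp (-1 * symbol d α (fun z => k (r • z)) ξ) =
      (fun η => Real.cos (inner ℝ η x) * Real.exp (-t * symbol d α k η)) (r⁻¹ • ξ) := by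
    intro ξ
    simp only [symbol_comp_smul hr, hrα, real_inner_smul_left, real_inner_smul_right]
    ring_nf
  rw [(integral_congr_ae (ae_of_all _ e)).trans (Measure.integral_comp_inv_smul volume
    (fun η => Real.cos (inner ℝ η x) * Real.exp (-t * symbol d α k η)) r),
    finrank_euclideanSpace, Fintype.card_fin, abs_of_pos (by positivity), smul_eq_mul, Real.rpow_neg hr.le, Real.rpow_natCast]
  field_simp

lemma secondDiff_scaling (hα : 0 < α) {t : ℝ} (ht : 0 < t) (x z : E d) :
    secondDiff (heatKernel d α k t) x z = (t ^ (1 / α)) ^ (-(d : ℝ)) *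
      secondDiff (heatKernel d α (fun z => k (t ^ (1 / α) • z)) 1) ((t ^ (1 / α))⁻¹ • x)
        ((t ^ (1 / α))⁻¹ • z) := by
  simp only [secondDiff]
  rw [heatKernel_scaling hα ht (x + z), heatKernel_scaling hα ht (x - z),
    heatKernel_scaling hα ht x, smul_add, smul_sub]
  ring

lemma integrable_comp_smul_levy {F : E d → ℝ} (hF : Integrable fun z => F z * levy d α z) {r : ℝ}
    (hr : 0 < r) : Integrable fun z => F (r • z) * levy d α z := by
  have h := (hF.comp_smul hr.ne').const_mul (r ^ ((d : ℝ) + α))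
  refine h.congr (ae_of_all _ fun z => ?_)
  dsimp only
  rw [levy_smul hr, show r ^ ((d : ℝ) + α) * (F (r • z) * (r ^ (-(d : ℝ) - α) * levy d α z)) =
      (r ^ ((d : ℝ) + α) * r ^ (-(d : ℝ) - α)) * (F (r • z) * levy d α z) by ring,
      ← Real.rpow_add hr]
  simp

/-- Rescaling a bound by the time-one weight. -/
lemma integral_scaled_le (hd : 1 ≤ d) (hα0 : 0 < α) (hα2 : α < 2) {t : ℝ} (ht : 0 < t)
    {F : E d → ℝ} (hF : Measurable F) {A : ℝ} (hA : 0 ≤ A) {W : E d → ℝ} {x : E d}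
    (hW : W = fun z => diffWeight d α ((t ^ (1 / α))⁻¹ • x) z)
    (hb : ∀ z, |F z| ≤ (t ^ (1 / α)) ^ (-(d : ℝ)) * (A * W ((t ^ (1 / α))⁻¹ • z))) :
    Integrable (fun z => F z * levy d α z) ∧
    ∫ z, |F z| * levy d α z ≤ A * diffConst d α * kern d α t x := by
  set r := t ^ (1 / α) with hr'
  have hr : 0 < r := by positivity
  have hri : 0 < r⁻¹ := by positivity
  have hWi : Integrable fun z => W z * levy d α z := by
    rw [hW]; exact integrable_diffWeight hd hα0 hα2 _
  have hWs := (integrable_comp_smul_levy hWi hri).const_mul (r ^ (-(d : ℝ)) * A)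
  have hb' : ∀ z, |F z| * levy d α z ≤
      r ^ (-(d : ℝ)) * A * (W (r⁻¹ • z) * levy d α z) := fun z =>
    (mul_le_mul_of_nonneg_right (hb z) (levy_nonneg z)).trans_eq (by ring)
  have hFi : Integrable (fun z => F z * levy d α z) := by
    refine hWs.mono' (hF.mul measurable_levy).aestronglyMeasurable (ae_of_all _ fun z => ?_)
    rw [norm_mul, Real.norm_of_nonneg (levy_nonneg z)]
    exact hb' z
  refine ⟨hFi, ?_⟩
  have hFa : Integrable (fun z => |F z| * levy d α z) := by
    refine hFi.norm.congr (ae_of_all _ fun z => ?_)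
    simp only [norm_mul, Real.norm_eq_abs, abs_of_nonneg (levy_nonneg z)]
  refine (integral_mono hFa hWs hb').trans ?_
  rw [integral_const_mul, levy_integral_comp_smul W hri]
  have h1 : ∫ z, W z * levy d α z ≤ diffConst d α * (r ^ ((d : ℝ) + α) * kern d α t x) := by
    rw [hW, ← decay_inv_smul ht]; exact integral_diffWeight_le hd hα0 hα2 _
  calc _ ≤ r ^ (-(d : ℝ)) * A * (r⁻¹ ^ α *
        (diffConst d α * (r ^ ((d : ℝ) + α) * kern d α t x))) := by gcongr
    _ = (r ^ (-(d : ℝ)) * r⁻¹ ^ α * r ^ ((d : ℝ) + α)) *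
        (A * diffConst d α * kern d α t x) := by ring
    _ = _ := by
      rw [Real.inv_rpow hr.le, ← Real.rpow_neg hr.le, ← Real.rpow_add hr, ← Real.rpow_add hr,
        show -(d : ℝ) + -α + (d + α) = 0 by ring, Real.rpow_zero, one_mul]

lemma continuous_heatKernel (hd : 1 ≤ d) (hα0 : 0 < α) (hα2 : α < 2) (h0 : 0 < κ₀)
    (hk : IsDensity d κ₀ κ₁ k) {t : ℝ} (ht : 0 < t) : Continuous (heatKernel d α k t) := by
  have e : heatKernel d α k t = fun x =>
      (2 * Real.pi) ^ (-(d : ℝ)) * (osc (charFn d α k t) x).re :=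
    funext fun x => heatKernel_eq_osc hd hα0 hα2 h0 hk ht x
  have := continuous_osc (integrable_charFn hd hα0 hα2 h0 hk ht)
  rw [e]; fun_prop

lemma measurable_secondDiff (hd : 1 ≤ d) (hα0 : 0 < α) (hα2 : α < 2) (h0 : 0 < κ₀)
    (hk : IsDensity d κ₀ κ₁ k) {t : ℝ} (ht : 0 < t) (x : E d) :
    Measurable (secondDiff (heatKernel d α k t) x) := by
  have := continuous_heatKernel hd hα0 hα2 h0 hk ht
  unfold secondDiff
  exact (by fun_prop : Continuous _).measurable

/-- The heat kernel estimates at all times, uniform in the density. -/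
structure HeatKernelBounds (d : ℕ) (α κ₀ κ₁ C : ℝ) : Prop where
  pos : 0 < C
  integrable : ∀ k : E d → ℝ, IsDensity d κ₀ κ₁ k → ∀ t, 0 < t → ∀ x,
    Integrable fun z => secondDiff (heatKernel d α k t) x z * levy d α z
  diff : ∀ k : E d → ℝ, IsDensity d κ₀ κ₁ k → ∀ t, 0 < t → ∀ x,
    ∫ z, |secondDiff (heatKernel d α k t) x z| * levy d α z ≤ C * kern d α t x
  diff_sub : ∀ k : E d → ℝ, IsDensity d κ₀ κ₁ k → ∀ t, 0 < t → ∀ x x',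
    ∫ z, |secondDiff (heatKernel d α k t) x z - secondDiff (heatKernel d α k t) x' z| *
      levy d α z ≤ C * min ((t ^ (1 / α))⁻¹ * ‖x - x'‖) 1 * (kern d α t x + kern d α t x')
  dens_sub : ∀ k : E d → ℝ, IsDensity d κ₀ κ₁ k → ∀ k' : E d → ℝ, IsDensity d κ₀ κ₁ k' →
    ∀ ε, (∀ z, |k z - k' z| ≤ ε) → ∀ t, 0 < t → ∀ x,
    ∫ z, |secondDiff (heatKernel d α k t) x z - secondDiff (heatKernel d α k' t) x z| *
      levy d α z ≤ C * ε * kern d α t x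

/-- The kernel at time `t` is the rescaled time-one kernel of the density `z ↦ k (t^{1/α} z)`, which
satisfies the same bounds as `k`. The time-one constants thus hold at all times, and increments in
space are measured in units of `t^{1/α}`. -/
lemma exists_heatKernelBounds (hd : 1 ≤ d) (hα0 : 0 < α) (hα2 : α < 2) (h0 : 0 < κ₀)
    (κ₁ : ℝ) : ∃ C, HeatKernelBounds d α κ₀ κ₁ C := by
  obtain ⟨C, hC, hCk⟩ := exists_heatKernel_one_bounds hd hα0 hα2 h0 κ₁
  have hdc := diffConst_nonneg (d := d) (α := α)
  have hC' : C * diffConst d α ≤ C * (1 + diffConst d α) := by gcongr; linarith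
  refine ⟨C * (1 + diffConst d α), by positivity, fun k hk t ht x => ?_,
    fun k hk t ht x => ?_, fun k hk t ht x x' => ?_, fun k hk k' hk' ε hε t ht x => ?_⟩
  · refine (integral_scaled_le hd hα0 hα2 ht (measurable_secondDiff hd hα0 hα2 h0 hk ht x)
      hC.le (x := x) rfl fun z => ?_).1
    rw [secondDiff_scaling hα0 ht, abs_mul, abs_of_pos (by positivity)]
    gcongr
    exact (hCk _ (hk.comp_smul _)).2.1 _ _
  · refine ((integral_scaled_le hd hα0 hα2 ht (measurable_secondDiff hd hα0 hα2 h0 hk ht x)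
      hC.le (x := x) rfl fun z => ?_).2).trans
      (mul_le_mul_of_nonneg_right hC' (kern_pos ht x).le)
    rw [secondDiff_scaling hα0 ht, abs_mul, abs_of_pos (by positivity)]
    gcongr
    exact (hCk _ (hk.comp_smul _)).2.1 _ _
  · set r := t ^ (1 / α) with hr'
    have hr : 0 < r := by positivity
    have hmx := measurable_secondDiff hd hα0 hα2 h0 hk ht x
    have hmx' := measurable_secondDiff hd hα0 hα2 h0 hk ht x'
    set F := fun z => secondDiff (heatKernel d α k t) x z - secondDiff (heatKernel d α k t) x' z
      with hF
    set m := min (r⁻¹ * ‖x - x'‖) 1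
    have hm0 : 0 ≤ m := le_min (by positivity) zero_le_one
    set G := fun (x z : E d) => r ^ (-(d : ℝ)) * (C * m * diffWeight d α (r⁻¹ • x) (r⁻¹ • z))
    have hGn : ∀ x z, 0 ≤ G x z := fun x z =>
      mul_nonneg (by positivity) (mul_nonneg (by positivity) (diffWeight_nonneg _ _))
    have hGm : ∀ x, Measurable (G x) := fun x =>
      (((measurable_diffWeight _).comp (measurable_const_smul _)).const_mul _).const_mul _
    have hG : ∀ x, Integrable (fun z => G x z * levy d α z) ∧
        ∫ z, |G x z| * levy d α z ≤ C * m * diffConst d α * kern d α t x := fun x =>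
      integral_scaled_le hd hα0 hα2 ht (hGm x) (by positivity) (x := x) rfl
        fun z => by rw [abs_of_nonneg (hGn x z)]
    have hFG : ∀ z, |F z| ≤ G x z + G x' z := by
      intro z
      have h1 := (hCk _ (hk.comp_smul r)).2.2.1 (r⁻¹ • x) (r⁻¹ • x') (r⁻¹ • z)
      rw [← smul_sub, norm_smul, norm_inv, Real.norm_of_nonneg hr.le] at h1
      simp only [hF]
      rw [secondDiff_scaling hα0 ht, secondDiff_scaling hα0 ht x', ← hr', ← mul_sub, abs_mul,
        abs_of_pos (by positivity), ← mul_add, ← mul_add]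
      gcongr
    have hi := (hG x).1.add (hG x').1
    have hle : ∫ z, |F z| * levy d α z ≤ ∫ z, (G x z * levy d α z + G x' z * levy d α z) := by
      refine integral_mono_of_nonneg (ae_of_all _ fun z =>
        mul_nonneg (abs_nonneg _) (levy_nonneg z)) hi (ae_of_all _ fun z => ?_)
      dsimp only
      rw [← add_mul]
      exact mul_le_mul_of_nonneg_right (hFG z) (levy_nonneg z)
    refine hle.trans ?_
    rw [integral_add (hG x).1 (hG x').1]
    have h1 := (hG x).2
    have h2 := (hG x').2
    simp only [abs_of_nonneg (hGn _ _)] at h1 h2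
    have hkx := (kern_pos (α := α) ht x).le
    have hkx' := (kern_pos (α := α) ht x').le
    calc _ ≤ C * diffConst d α * m * (kern d α t x + kern d α t x') := by linarith
      _ ≤ _ := by gcongr
  · have hε0 : 0 ≤ ε := (abs_nonneg _).trans (hε 0)
    refine ((integral_scaled_le hd hα0 hα2 ht ((measurable_secondDiff hd hα0 hα2 h0 hk ht x).sub
      (measurable_secondDiff hd hα0 hα2 h0 hk' ht x)) (A := C * ε) (by positivity) (x := x) rfl
      fun z => ?_).2).trans ?_
    · rw [Pi.sub_apply, secondDiff_scaling hα0 ht, secondDiff_scaling hα0 ht, ← mul_sub, abs_mul,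
        abs_of_pos (by positivity)]
      gcongr
      exact (hCk _ (hk.comp_smul _)).2.2.2 _ (hk'.comp_smul _) ε (fun z => hε _) _ _
    · have hkx := (kern_pos (α := α) ht x).le
      calc _ = C * diffConst d α * ε * kern d α t x := by ring
        _ ≤ _ := by gcongr

end Scaling

/-! ### Integrability, initial condition and evolution equation for the heat kernel. -/

section HeatKernel

variable {d : ℕ} {α κ₀ κ₁ : ℝ} {k : E d → ℝ}

lemma integrable_heatKernel_one (hd : 1 ≤ d) (hα0 : 0 < α) (hα2 : α < 2) (h0 : 0 < κ₀)
    (hk : IsDensity d κ₀ κ₁ k) : Integrable (heatKernel d α k 1) := by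
  obtain ⟨C, -, hC⟩ := exists_heatKernel_one_bounds hd hα0 hα2 h0 κ₁
  exact ((integrable_decay hα0).const_mul C).mono'
    (continuous_heatKernel hd hα0 hα2 h0 hk one_pos).aestronglyMeasurable
    (ae_of_all _ fun x => (hC k hk).1 x)

lemma integrable_heatKernel (hd : 1 ≤ d) (hα0 : 0 < α) (hα2 : α < 2) (h0 : 0 < κ₀)
    (hk : IsDensity d κ₀ κ₁ k) {t : ℝ} (ht : 0 < t) : Integrable (heatKernel d α k t) := by
  have hr : 0 < t ^ (1 / α) := by positivity
  have h := ((integrable_heatKernel_one hd hα0 hα2 h0 (hk.comp_smul (t ^ (1 / α)))).comp_smul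
    (inv_ne_zero hr.ne')).const_mul ((t ^ (1 / α)) ^ (-(d : ℝ)))
  exact h.congr (ae_of_all _ fun x => (heatKernel_scaling hα0 ht x).symm)

open scoped FourierTransform in
/-- The heat kernel has total mass one. -/
lemma integral_heatKernel_one (hd : 1 ≤ d) (hα0 : 0 < α) (hα2 : α < 2) (h0 : 0 < κ₀)
    (hk : IsDensity d κ₀ κ₁ k) : ∫ x, heatKernel d α k 1 x = 1 := by
  have hg := integrable_charFn hd hα0 hα2 h0 hk one_pos
  have hgc := continuous_charFn hd hα0 hα2 h0 hk 1
  obtain ⟨B, -, hB⟩ := exists_osc_charFn_le hd hα0 hα2 h0 κ₁ 0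
  have hosc : Integrable (osc (charFn d α k 1)) :=
    ((integrable_decay hα0).const_mul B).mono' (continuous_osc hg).aestronglyMeasurable
      (ae_of_all _ fun x => by simpa using hB k hk [] rfl (by simp) x)
  have hpi := Real.pi_pos
  have hF : 𝓕 (charFn d α k 1) = fun y => osc (charFn d α k 1) ((-(2 * Real.pi)) • y) := by
    ext y
    rw [osc_eq_fourier, smul_smul, neg_mul_neg, inv_mul_cancel₀ (by positivity), one_smul]
  have hFi : Integrable (𝓕 (charFn d α k 1)) := by
    rw [hF]; exact hosc.comp_smul (by simp [hpi.ne'])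
  -- Fourier inversion at the origin computes the mass, as the characteristic function equals one
  -- there.
  have hinv := congrFun (hgc.fourierInv_fourier_eq hg hFi) 0
  rw [Real.fourierInv_eq', hF] at hinv
  simp only [inner_zero_right, mul_zero, Complex.ofReal_zero, zero_mul, Complex.exp_zero,
    one_smul] at hinv
  rw [Measure.integral_comp_smul, finrank_euclideanSpace, Fintype.card_fin] at hinv
  have h1 : charFn d α k 1 0 = 1 := by simp [charFn, symbol_zero]
  have habs : |((-(2 * Real.pi)) ^ d)⁻¹| = (2 * Real.pi) ^ (-(d : ℝ)) := by
    rw [abs_inv, abs_pow, abs_neg, abs_of_pos (by positivity), Real.rpow_neg (by positivity),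
      Real.rpow_natCast]
  rw [h1, habs] at hinv
  simp_rw [heatKernel_eq_osc hd hα0 hα2 h0 hk one_pos]
  rw [integral_const_mul]
  have h2 := congrArg Complex.re hinv
  rw [Complex.real_smul, Complex.re_ofReal_mul, Complex.one_re] at h2
  have h3 := integral_re hosc
  simp only [RCLike.re_eq_complex_re] at h3
  rw [h3, h2]

/-- After substituting `x = t^{1/α} u` the kernel is a time-one kernel of mass one. Its density
still varies with `t`, so it need not converge, but it stays below a fixed multiple of `decay`.
Dominated convergence is applied to that majorant times `|f(t^{1/α} u) - f(0)|`. -/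
lemma tendsto_heatKernel (hd : 1 ≤ d) (hα0 : 0 < α) (hα2 : α < 2) (h0 : 0 < κ₀)
    (hk : IsDensity d κ₀ κ₁ k) (f : E d →ᵇ ℝ) :
    Tendsto (fun t => ∫ x, heatKernel d α k t x * f x) (𝓝[>] 0) (𝓝 (f 0)) := by
  obtain ⟨C, hC, hCk⟩ := exists_heatKernel_one_bounds hd hα0 hα2 h0 κ₁
  have hcomp : ∀ t, 0 < t → ∫ x, heatKernel d α k t x * f x =
      f 0 + ∫ u, heatKernel d α (fun z => k (t ^ (1 / α) • z)) 1 u *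
        (f (t ^ (1 / α) • u) - f 0) := by
    intro t ht
    set r := t ^ (1 / α) with hr'
    have hr : 0 < r := by positivity
    have hkr := hk.comp_smul r
    have hi := integrable_heatKernel_one hd hα0 hα2 h0 hkr
    have hi1 : Integrable fun u => heatKernel d α (fun z => k (r • z)) 1 u * f (r • u) :=
      hi.mul_bdd (c := ‖f‖) (f.continuous.comp (continuous_const_smul r)).aestronglyMeasurable
        (ae_of_all _ fun u => f.norm_coe_le_norm _)
    simp_rw [mul_sub]
    rw [integral_sub hi1 (hi.mul_const _), integral_mul_const,
      integral_heatKernel_one hd hα0 hα2 h0 hkr, one_mul, add_sub_cancel]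
    have e : ∀ x, heatKernel d α k t x * f x = r ^ (-(d : ℝ)) *
        (fun u => heatKernel d α (fun z => k (r • z)) 1 u * f (r • u)) (r⁻¹ • x) := by
      intro x
      rw [heatKernel_scaling hα0 ht, ← hr']
      simp only [smul_smul, mul_inv_cancel₀ hr.ne', one_smul]
      ring
    rw [integral_congr_ae (ae_of_all _ e), integral_const_mul,
      Measure.integral_comp_inv_smul volume
        (fun u => heatKernel d α (fun z => k (r • z)) 1 u * f (r • u)) r, finrank_euclideanSpace,
      Fintype.card_fin, abs_of_pos (by positivity), smul_eq_mul, ← mul_assoc,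
      Real.rpow_neg hr.le, Real.rpow_natCast, inv_mul_cancel₀ (by positivity), one_mul]
  have hr0 : Tendsto (fun t : ℝ => t ^ (1 / α)) (𝓝[>] 0) (𝓝 0) := by
    have h := (Real.continuousAt_rpow_const 0 (1 / α) (Or.inr (by positivity))).tendsto
    rw [Real.zero_rpow (by positivity)] at h
    exact h.mono_left nhdsWithin_le_nhds
  have hdom : Tendsto (fun t : ℝ => ∫ u, C * decay d α u * |f (t ^ (1 / α) • u) - f 0|)
      (𝓝[>] 0) (𝓝 0) := by
    have h := tendsto_integral_filter_of_dominated_convergence (l := 𝓝[>] (0 : ℝ))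
      (F := fun t u => C * decay d α u * |f (t ^ (1 / α) • u) - f 0|) (f := fun _ => (0 : ℝ))
      (μ := volume) (fun u => C * decay d α u * (2 * ‖f‖))
      (Eventually.of_forall fun t => by
        have : Measurable fun u : E d => |f (t ^ (1 / α) • u) - f 0| :=
          (by fun_prop : Continuous fun u : E d => |f (t ^ (1 / α) • u) - f 0|).measurable
        exact ((measurable_decay.const_mul C).mul this).aestronglyMeasurable)
      (Eventually.of_forall fun t => ae_of_all _ fun u => by
        have hdu := (decay_pos (α := α) u).le
        rw [Real.norm_of_nonneg (by positivity)]
        gcongr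
        have h1 := f.norm_coe_le_norm (t ^ (1 / α) • u)
        have h2 := f.norm_coe_le_norm 0
        have h3 := norm_sub_le (f (t ^ (1 / α) • u)) (f 0)
        rw [← Real.norm_eq_abs]
        linarith)
      (((integrable_decay hα0).const_mul C).mul_const _)
      (ae_of_all _ fun u => by
        have h1 : Tendsto (fun t : ℝ => f (t ^ (1 / α) • u)) (𝓝[>] 0) (𝓝 (f ((0 : ℝ) • u))) :=
          (f.continuous.tendsto _).comp (hr0.smul_const u)
        rw [zero_smul] at h1
        have h2 := ((h1.sub_const (f 0)).abs).const_mul (C * decay d α u)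
        simpa using h2)
    simpa using h
  have hz : Tendsto (fun t : ℝ => ∫ u, heatKernel d α (fun z => k (t ^ (1 / α) • z)) 1 u *
      (f (t ^ (1 / α) • u) - f 0)) (𝓝[>] 0) (𝓝 0) := by
    refine squeeze_zero_norm (fun t => ?_) hdom
    refine norm_integral_le_of_norm_le ?_ (ae_of_all _ fun u => ?_)
    · refine (((integrable_decay hα0).const_mul C).mul_bdd (c := 2 * ‖f‖)
        (by fun_prop : Continuous fun u : E d => |f (t ^ (1 / α) • u) - f 0|).aestronglyMeasurable
        (ae_of_all _ fun u => ?_))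
      have h1 := f.norm_coe_le_norm (t ^ (1 / α) • u)
      have h2 := f.norm_coe_le_norm 0
      have h3 := norm_sub_le (f (t ^ (1 / α) • u)) (f 0)
      rw [Real.norm_eq_abs, abs_abs, ← Real.norm_eq_abs]
      linarith
    · rw [norm_mul]
      exact mul_le_mul_of_nonneg_right ((hCk _ (hk.comp_smul _)).1 u) (norm_nonneg _)
  have := hz.const_add (f 0)
  rw [add_zero] at this
  refine this.congr' ?_
  filter_upwards [self_mem_nhdsWithin] with t ht
  exact (hcomp t ht).symm

lemma hasDerivAt_heatKernel (hd : 1 ≤ d) (hα0 : 0 < α) (hα2 : α < 2) (h0 : 0 < κ₀)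
    (hk : IsDensity d κ₀ κ₁ k) {t : ℝ} (ht : 0 < t) (x : E d) :
    HasDerivAt (fun s => heatKernel d α k s x) (opL d α k (heatKernel d α k t) x) t := by
  have hψ := continuous_symbol hd hα0 hα2 hk.measurable (hk.abs_le h0)
  have hψ0 : ∀ ξ, 0 ≤ symbol d α k ξ := symbol_nonneg fun z => h0.le.trans (hk.lower z)
  have hκ := hk.upper_nonneg h0
  have hlm := levyMass_nonneg (d := d) (α := α)
  -- The envelope is taken at time `t/2`, below every `s` in the ball of radius `t/2` around `t`.
  -- Its factor `1 + |ξ|²` absorbs the symbol produced by the derivative.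
  obtain ⟨G, hG, hGk⟩ := exists_dominating hd hα0 hα2 h0 (half_pos ht)
  set A : ℝ := 2 * κ₁ * levyMass d α
  have hF : ∀ s : ℝ, Continuous fun ξ : E d =>
      Real.cos (inner ℝ ξ x) * Real.exp (-s * symbol d α k ξ) := fun s => by fun_prop
  have hF' : Continuous fun ξ : E d => Real.cos (inner ℝ ξ x) *
      (-symbol d α k ξ * Real.exp (-t * symbol d α k ξ)) := by fun_prop
  have hder := (hasDerivAt_integral_of_dominated_loc_of_deriv_le
    (F := fun s ξ => Real.cos (inner ℝ ξ x) * Real.exp (-s * symbol d α k ξ))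
    (F' := fun s ξ => Real.cos (inner ℝ ξ x) *
      (-symbol d α k ξ * Real.exp (-s * symbol d α k ξ))) (μ := volume) (x₀ := t)
    (bound := fun ξ => A * G ξ) (Metric.ball_mem_nhds t (half_pos ht))
    (Eventually.of_forall fun s => (hF s).aestronglyMeasurable)
    (by
      refine (integrable_charFn hd hα0 hα2 h0 hk ht).norm.mono' (hF t).aestronglyMeasurable
        (ae_of_all _ fun ξ => ?_)
      rw [norm_mul, norm_charFn, Real.norm_of_nonneg (Real.exp_pos _).le]
      exact mul_le_of_le_one_left (Real.exp_pos _).le (Real.abs_cos_le_one _))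
    hF'.aestronglyMeasurable
    (ae_of_all _ fun ξ s hs => by
      rw [norm_mul, norm_mul, norm_neg, Real.norm_of_nonneg (hψ0 ξ),
        Real.norm_of_nonneg (Real.exp_pos _).le]
      have h1 : symbol d α k ξ ≤ A * (1 + ‖ξ‖ ^ 2) :=
        (le_abs_self _).trans ((abs_symbol_le hd hα0 hα2 (hk.abs_le h0) ξ).trans_eq
          (by simp only [A]; ring))
      have hs' : t / 2 ≤ s := by
        rw [Metric.mem_ball, Real.dist_eq, abs_lt] at hs; linarith [hs.1]
      have h2 : Real.exp (-s * symbol d α k ξ) ≤ Real.exp (-(t / 2) * symbol d α k ξ) :=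
        Real.exp_le_exp.2 (by nlinarith [hψ0 ξ])
      have h3 := hGk κ₁ k hk ξ
      have h4 : |Real.cos (inner ℝ ξ x)| ≤ 1 := Real.abs_cos_le_one _
      have h5 := hψ0 ξ
      calc _ ≤ 1 * (A * (1 + ‖ξ‖ ^ 2) * Real.exp (-(t / 2) * symbol d α k ξ)) := by
            gcongr
            exact h4
        _ = A * ((1 + ‖ξ‖ ^ 2) * Real.exp (-(t / 2) * symbol d α k ξ)) := by ring
        _ ≤ A * G ξ := by gcongr)
    (hG.const_mul A)
    (ae_of_all _ fun ξ s _ => by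
      have h : HasDerivAt (fun s : ℝ => -s * symbol d α k ξ) (-symbol d α k ξ) s := by
        simpa using ((hasDerivAt_id s).neg).mul_const (symbol d α k ξ)
      convert! (h.exp.const_mul (Real.cos (inner ℝ ξ x))) using 1
      ring)).2
  have hd1 := hder.const_mul ((2 * Real.pi) ^ (-(d : ℝ)))
  refine hd1.congr_deriv ?_
  have hg := integrable_charFn hd hα0 hα2 h0 hk ht
  obtain ⟨hos1, hos2⟩ := osc_symbol hd hα0 hα2 hk.measurable (hk.abs_le h0)
    hg.aestronglyMeasurable (integrable_sq_charFn hd hα0 hα2 h0 hk ht) x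
  have hsi : Integrable fun ξ => ((symbol d α k ξ : ℝ) : ℂ) * charFn d α k t ξ := by
    refine ((integrable_sq_charFn hd hα0 hα2 h0 hk ht).const_mul A).mono'
      ((Complex.continuous_ofReal.comp hψ).aestronglyMeasurable.mul hg.aestronglyMeasurable)
      (ae_of_all _ fun ξ => ?_)
    rw [norm_mul, Complex.norm_real, Real.norm_eq_abs, ← mul_assoc]
    refine mul_le_mul_of_nonneg_right ?_ (norm_nonneg _)
    exact (abs_symbol_le hd hα0 hα2 (hk.abs_le h0) ξ).trans_eq (by simp only [A]; ring)
  have hre : ∫ ξ, Real.cos (inner ℝ ξ x) * (-symbol d α k ξ * Real.exp (-t * symbol d α k ξ)) =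
      -(osc (fun ξ => ((symbol d α k ξ : ℝ) : ℂ) * charFn d α k t ξ) x).re := by
    rw [osc, ← RCLike.re_eq_complex_re, ← integral_re (integrable_osc hsi x), ← integral_neg]
    congr 1; ext ξ
    rw [charFn, ← Complex.ofReal_mul, RCLike.re_eq_complex_re, Complex.re_mul_ofReal,
      Complex.exp_ofReal_mul_I_re]
    ring
  rw [hre, hos2, opL]
  have hre2 : (-(1 / 2) * ∫ w, (osc (charFn d α k t) (x + w) + osc (charFn d α k t) (x - w) -
      2 * osc (charFn d α k t) x) * ((k w * levy d α w : ℝ) : ℂ)).re =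
      -(1 / 2) * ∫ w, ((osc (charFn d α k t) (x + w) + osc (charFn d α k t) (x - w) -
      2 * osc (charFn d α k t) x) * ((k w * levy d α w : ℝ) : ℂ)).re := by
    have h1 := integral_re hos1
    simp only [RCLike.re_eq_complex_re] at h1
    rw [h1, show (-(1 / 2) : ℂ) = ((-(1 / 2) : ℝ) : ℂ) by push_cast; rfl, Complex.re_ofReal_mul]
  rw [hre2, ← neg_mul, neg_neg, mul_left_comm, ← integral_const_mul]
  congr 1
  congr 1; ext w
  simp only [secondDiff, heatKernel_eq_osc hd hα0 hα2 h0 hk ht]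
  rw [Complex.re_mul_ofReal, levy]
  simp only [Complex.add_re, Complex.sub_re, Complex.mul_re, Complex.re_ofNat, Complex.im_ofNat]
  ring

lemma isHeatKernel (hd : 1 ≤ d) (hα0 : 0 < α) (hα2 : α < 2) (h0 : 0 < κ₀)
    (hk : IsDensity d κ₀ κ₁ k) : IsHeatKernel d α k (heatKernel d α k) where
  integrable _ ht := integrable_heatKernel hd hα0 hα2 h0 hk ht
  hasDerivAt _ x ht := hasDerivAt_heatKernel hd hα0 hα2 h0 hk ht x
  tendsto_dirac f := tendsto_heatKernel hd hα0 hα2 h0 hk f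

end HeatKernel

/-! ### Estimates for `q₀`: size, increments in space, simultaneous shifts. -/

section Parametrix

variable {d : ℕ} {α β κ₀ κ₁ κ₂ : ℝ}

/-- The weight `((t^{1/α} + |x|)^b ∧ 1) (t^{1/α} + |x|)^{-d-α}`. -/
def wt (d : ℕ) (α b t : ℝ) (x : E d) : ℝ :=
  min ((t ^ (1 / α) + ‖x‖) ^ b) 1 * kern d α t x

lemma wt_nonneg {b t : ℝ} (ht : 0 < t) (x : E d) : 0 ≤ wt d α b t x := by
  have := (kern_pos (α := α) ht x).le
  unfold wt; positivity

lemma opL_eq (k f : E d → ℝ) (x : E d) :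
    opL d α k f x = 1 / 2 * ∫ z, secondDiff f x z * levy d α z * k z := by
  rw [opL]
  congr 2; ext z
  rw [levy]; ring

lemma integrable_mul_density {F k : E d → ℝ} (hF : Integrable F) (hm : Measurable k) {K : ℝ}
    (hK : ∀ z, |k z| ≤ K) : Integrable fun z => F z * k z :=
  hF.mul_bdd (c := K) hm.aestronglyMeasurable (ae_of_all _ hK)

lemma abs_integral_mul_density_le {F k : E d → ℝ} (hF : Integrable F) {ε : ℝ}
    (hε : ∀ z, |k z| ≤ ε) : |∫ z, F z * k z| ≤ ε * ∫ z, |F z| := by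
  rw [← integral_const_mul, ← Real.norm_eq_abs]
  refine norm_integral_le_of_norm_le (hF.abs.const_mul ε) (ae_of_all _ fun z => ?_)
  rw [norm_mul, mul_comm]
  exact mul_le_mul_of_nonneg_right (hε z) (abs_nonneg _)

/-- The combined modulus of continuity of `κ`. -/
lemma IsKernel.abs_sub_le {κ : E d → E d → ℝ} (h : IsKernel d β κ₀ κ₁ κ₂ κ) (h0 : 0 < κ₀)
    (x y z : E d) : |κ x z - κ y z| ≤ (|κ₂| + 2 * |κ₁|) * min (‖x - y‖ ^ β) 1 := by
  have h1 := h.holder x y z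
  have h2 : |κ x z - κ y z| ≤ 2 * |κ₁| := by
    have a := (h.isDensity x).abs_le h0 z
    have b := (h.isDensity y).abs_le h0 z
    have c := abs_sub (κ x z) (κ y z)
    linarith [le_abs_self κ₁]
  have h3 : 0 ≤ ‖x - y‖ ^ β := by positivity
  rcases min_cases (‖x - y‖ ^ β) 1 with ⟨h, _⟩ | ⟨h, _⟩ <;> rw [h]
  · nlinarith [mul_le_mul_of_nonneg_right (le_abs_self κ₂) h3, mul_nonneg (abs_nonneg κ₁) h3]
  · linarith [abs_nonneg κ₂]

/-- The weighted second difference of the heat kernel frozen at `y`. -/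
def diffKernel (d : ℕ) (α : ℝ) (κ : E d → E d → ℝ) (t : ℝ) (y v z : E d) : ℝ :=
  secondDiff (heatKernel d α (κ y) t) v z * levy d α z

lemma abs_mul_levy (u : ℝ) (z : E d) : |u * levy d α z| = |u| * levy d α z := by
  rw [abs_mul, abs_of_nonneg (levy_nonneg z)]

variable {C : ℝ} {κ : E d → E d → ℝ}

/-- Both operators act on the same kernel, so only `κ(x,·) - κ(y,·)` remains, and its Hölder
smallness compensates part of the time singularity. -/
lemma q0_eq (hB : HeatKernelBounds d α κ₀ κ₁ C) (h : IsKernel d β κ₀ κ₁ κ₂ κ) (h0 : 0 < κ₀)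
    {t : ℝ} (ht : 0 < t) (x y : E d) :
    q0 d α κ t x y = 1 / 2 * ∫ z, diffKernel d α κ t y (x - y) z * (κ x z - κ y z) := by
  have hi := hB.integrable _ (h.isDensity y) t ht (x - y)
  rw [q0, opL_eq, opL_eq, ← mul_sub, ← integral_sub
    (integrable_mul_density hi (h.isDensity x).measurable ((h.isDensity x).abs_le h0))
    (integrable_mul_density hi (h.isDensity y).measurable ((h.isDensity y).abs_le h0))]
  congr 2; ext z
  rw [diffKernel]; ring

lemma min_rpow_le {b r s : ℝ} (hb : 0 ≤ b) (hr : 0 ≤ r) (h : r ≤ s) :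
    min (r ^ b) 1 ≤ min (s ^ b) 1 :=
  min_le_min_right _ (Real.rpow_le_rpow hr h hb)

lemma min_rpow_le_wt (hβ : 0 ≤ β) {t : ℝ} (ht : 0 < t) {r : ℝ} (hr : 0 ≤ r) {x : E d}
    (h : r ≤ t ^ (1 / α) + ‖x‖) : min (r ^ β) 1 * kern d α t x ≤ wt d α β t x :=
  mul_le_mul_of_nonneg_right (min_rpow_le hβ hr h) (kern_pos ht x).le

lemma q0_abs_le (hB : HeatKernelBounds d α κ₀ κ₁ C) (h : IsKernel d β κ₀ κ₁ κ₂ κ) (h0 : 0 < κ₀)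
    (hβ : 0 ≤ β) {t : ℝ} (ht : 0 < t) (x y : E d) :
    |q0 d α κ t x y| ≤ (|κ₂| + 2 * |κ₁|) * C * wt d α β t (x - y) := by
  have hi := hB.integrable _ (h.isDensity y) t ht (x - y)
  have hd := hB.diff _ (h.isDensity y) t ht (x - y)
  have hC := hB.pos
  have hk := (kern_pos (α := α) ht (x - y)).le
  have h1 := abs_integral_mul_density_le hi (h.abs_sub_le h0 x y)
  simp only [abs_mul_levy] at h1
  have h2 := min_rpow_le_wt (α := α) hβ ht (norm_nonneg (x - y)) (x := x - y)
    (by have : 0 ≤ t ^ (1 / α) := by positivity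
        linarith)
  rw [q0_eq hB h h0 ht, abs_mul, abs_of_pos (by norm_num : (0 : ℝ) < 1 / 2)]
  calc _ ≤ 1 / 2 * ((|κ₂| + 2 * |κ₁|) * min (‖x - y‖ ^ β) 1 * (C * kern d α t (x - y))) := by
        gcongr
        exact h1.trans (by gcongr)
    _ = 1 / 2 * ((|κ₂| + 2 * |κ₁|) * C * (min (‖x - y‖ ^ β) 1 * kern d α t (x - y))) := by ring
    _ ≤ 1 / 2 * ((|κ₂| + 2 * |κ₁|) * C * wt d α β t (x - y)) := by gcongr
    _ ≤ _ := by
      have : 0 ≤ (|κ₂| + 2 * |κ₁|) * C * wt d α β t (x - y) :=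
        mul_nonneg (by positivity) (wt_nonneg ht _)
      linarith

/-- Beyond the scale `t^{1/α}` the size bound suffices. Below it, put `v = t^{-1/α}|x - x'| ≤ 1`.
Moving the base point of the second difference costs `v`; replacing `κ(x,·)` by `κ(x',·)` costs `|x
- x'|^β = v^β t^{β/α}`, and the weight absorbs `t^{β/α}`. Finally `v` and `v^β` are at most `v^η`.
-/
lemma q0_sub_le (hB : HeatKernelBounds d α κ₀ κ₁ C) (h : IsKernel d β κ₀ κ₁ κ₂ κ) (h0 : 0 < κ₀)
    (hα : 0 < α) (hβ : 0 < β) (hβ1 : β ≤ 1) {η : ℝ} (hη0 : 0 ≤ η) (hη : η ≤ β) {t : ℝ}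
    (ht : 0 < t) (ht1 : t ≤ 1) (x x' y : E d) :
    |q0 d α κ t x y - q0 d α κ t x' y| ≤ (|κ₂| + 2 * |κ₁|) * C *
      ((t ^ (1 / α))⁻¹ * ‖x - x'‖) ^ η * (wt d α β t (x - y) + wt d α β t (x' - y)) := by
  set M := |κ₂| + 2 * |κ₁| with hM
  have hM0 : 0 ≤ M := by positivity
  have hC := hB.pos
  set r := t ^ (1 / α) with hr'
  have hr : 0 < r := by positivity
  have hr1 : r ≤ 1 := Real.rpow_le_one ht.le ht1 (by positivity)
  set u := ‖x - x'‖ with hu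
  have hu0 : 0 ≤ u := norm_nonneg _
  have hw := wt_nonneg (α := α) (b := β) ht (x - y)
  have hw' := wt_nonneg (α := α) (b := β) ht (x' - y)
  rcases le_or_gt r u with hru | hru
  · have h1 : 1 ≤ (r⁻¹ * u) ^ η := by
      refine Real.one_le_rpow ?_ hη0
      rw [inv_mul_eq_div, le_div_iff₀ hr]; linarith
    refine (abs_sub _ _).trans ((add_le_add (q0_abs_le hB h h0 hβ.le ht x y)
      (q0_abs_le hB h h0 hβ.le ht x' y)).trans ?_)
    rw [← mul_add]
    have : 0 ≤ M * C := by positivity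
    nlinarith [mul_nonneg (mul_nonneg this (add_nonneg hw hw')) (sub_nonneg.2 h1)]
  have hv0 : 0 ≤ r⁻¹ * u := by positivity
  have hv1 : r⁻¹ * u ≤ 1 := by rw [inv_mul_eq_div, div_le_one hr]; exact hru.le
  set v := r⁻¹ * u with hv
  have hvη : v ≤ v ^ η := by
    rcases hv0.eq_or_lt with hv0' | hv0'
    · rw [← hv0']; positivity
    · exact (Real.rpow_one v).symm.le.trans
        (Real.rpow_le_rpow_of_exponent_ge hv0' hv1 (by linarith))
  have hkx := (kern_pos (α := α) ht (x - y)).le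
  have hkx' := (kern_pos (α := α) ht (x' - y)).le
  have hi := hB.integrable _ (h.isDensity y) t ht (x - y)
  have hi' := hB.integrable _ (h.isDensity y) t ht (x' - y)
  have hmx := (h.isDensity x).measurable
  have hmy := (h.isDensity y).measurable
  have hmx' := (h.isDensity x').measurable
  have e : q0 d α κ t x y - q0 d α κ t x' y =
      1 / 2 * (∫ z, (diffKernel d α κ t y (x - y) z - diffKernel d α κ t y (x' - y) z) *
        (κ x z - κ y z)) + 1 / 2 * ∫ z, diffKernel d α κ t y (x' - y) z * (κ x z - κ x' z) := by
    have i1 : Integrable fun z => diffKernel d α κ t y (x - y) z * (κ x z - κ y z) :=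
      integrable_mul_density hi (hmx.sub hmy) (h.abs_sub_le h0 x y)
    have i2 : Integrable fun z => diffKernel d α κ t y (x' - y) z * (κ x' z - κ y z) :=
      integrable_mul_density hi' (hmx'.sub hmy) (h.abs_sub_le h0 x' y)
    have i3 : Integrable fun z => (diffKernel d α κ t y (x - y) z -
        diffKernel d α κ t y (x' - y) z) * (κ x z - κ y z) :=
      integrable_mul_density (hi.sub hi') (hmx.sub hmy) (h.abs_sub_le h0 x y)
    have i4 : Integrable fun z => diffKernel d α κ t y (x' - y) z * (κ x z - κ x' z) :=
      integrable_mul_density hi' (hmx.sub hmx') (h.abs_sub_le h0 x x')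
    rw [q0_eq hB h h0 ht, q0_eq hB h h0 ht, ← mul_sub, ← integral_sub i1 i2, ← mul_add,
      ← integral_add i3 i4]
    congr 2; ext z; ring
  have b1 := abs_integral_mul_density_le (hi.sub hi') (h.abs_sub_le h0 x y)
  have b2 := abs_integral_mul_density_le hi' (h.abs_sub_le h0 x x')
  have d1 := hB.diff_sub _ (h.isDensity y) t ht (x - y) (x' - y)
  have d2 := hB.diff _ (h.isDensity y) t ht (x' - y)
  rw [sub_sub_sub_cancel_right, min_eq_left hv1] at d1
  simp only [Pi.sub_apply, ← sub_mul, abs_mul_levy] at b1 b2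
  have hxx' : ‖x - y‖ ≤ r + ‖x' - y‖ := by
    have := norm_add_le (x - x') (x' - y)
    rw [sub_add_sub_cancel] at this
    linarith
  have c1 := min_rpow_le_wt (α := α) hβ.le ht (norm_nonneg (x - y)) (x := x - y) (by linarith)
  have c2 := min_rpow_le_wt (α := α) hβ.le ht (norm_nonneg (x - y)) (x := x' - y) hxx'
  have c3 : u ^ β * kern d α t (x' - y) ≤ v ^ η * wt d α β t (x' - y) := by
    have e1 : u ^ β = v ^ β * r ^ β := by
      rw [← Real.mul_rpow hv0 hr.le, hv]; congr 1; field_simp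
    have e2 : v ^ β ≤ v ^ η := by
      rcases hv0.eq_or_lt with hv0' | hv0'
      · rw [← hv0', Real.zero_rpow hβ.ne']; positivity
      · exact Real.rpow_le_rpow_of_exponent_ge hv0' hv1 hη
    have e3 : r ^ β * kern d α t (x' - y) ≤ wt d α β t (x' - y) := by
      have := min_rpow_le_wt (α := α) hβ.le ht hr.le (x := x' - y)
        (by linarith [norm_nonneg (x' - y)])
      rwa [min_eq_left (Real.rpow_le_one hr.le hr1 hβ.le)] at this
    rw [e1, mul_assoc]
    have : 0 ≤ v ^ β := by positivity
    exact mul_le_mul e2 e3 (by positivity) (by positivity)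
  have hm0 : 0 ≤ min (‖x - y‖ ^ β) 1 := by positivity
  have t1 : |∫ z, (diffKernel d α κ t y (x - y) z - diffKernel d α κ t y (x' - y) z) *
      (κ x z - κ y z)| ≤ M * C * v ^ η * (wt d α β t (x - y) + wt d α β t (x' - y)) := by
    simp only [diffKernel, ← sub_mul]
    refine b1.trans ?_
    calc _ ≤ M * min (‖x - y‖ ^ β) 1 *
          (C * v * (kern d α t (x - y) + kern d α t (x' - y))) := by gcongr
      _ = M * C * v * (min (‖x - y‖ ^ β) 1 * kern d α t (x - y) +
          min (‖x - y‖ ^ β) 1 * kern d α t (x' - y)) := by ring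
      _ ≤ _ := by gcongr
  have t2 : |∫ z, diffKernel d α κ t y (x' - y) z * (κ x z - κ x' z)| ≤
      M * C * v ^ η * wt d α β t (x' - y) := by
    simp only [diffKernel]
    refine b2.trans ?_
    calc _ ≤ M * u ^ β * (C * kern d α t (x' - y)) := by
          gcongr
          · exact integral_nonneg fun z => mul_nonneg (abs_nonneg _) (levy_nonneg z)
          · exact min_le_left _ _
      _ = M * C * (u ^ β * kern d α t (x' - y)) := by ring
      _ ≤ M * C * (v ^ η * wt d α β t (x' - y)) := by gcongr
      _ = _ := by ring
  rw [e]
  refine (abs_add_le _ _).trans ?_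
  rw [abs_mul, abs_mul, abs_of_pos (by norm_num : (0 : ℝ) < 1 / 2)]
  have : 0 ≤ M * C * v ^ η * wt d α β t (x - y) := by positivity
  nlinarith

/-- Interpolation: the `β`-th power of the smaller of `u` and `v` is at most `u^η v^γ`. It splits
the Hölder exponent between the size of a shift and the decay in `x - y`. -/
lemma min_modulus_le {β η γ u v r : ℝ} (hη : 0 < η) (hγ : 0 < γ) (hβ : β = η + γ) (hu0 : 0 ≤ u)
    (hu1 : u ≤ 1) (hv : 0 ≤ v) (hvr : v ≤ r) :
    min (u ^ β) (min (v ^ β) 1) ≤ u ^ η * min (r ^ γ) 1 := by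
  have hle : min (v ^ γ) 1 ≤ min (r ^ γ) 1 := min_rpow_le hγ.le hv hvr
  refine le_trans ?_ (mul_le_mul_of_nonneg_left hle (by positivity))
  have hub : u ^ β = u ^ η * u ^ γ := by
    rcases hu0.eq_or_lt with rfl | hu
    · rw [Real.zero_rpow hη.ne', Real.zero_rpow (by linarith), zero_mul]
    · rw [hβ, Real.rpow_add hu]
  have hvb : v ^ β = v ^ η * v ^ γ := by
    rcases hv.eq_or_lt with rfl | hv
    · rw [Real.zero_rpow hη.ne', Real.zero_rpow (by linarith), zero_mul]
    · rw [hβ, Real.rpow_add hv]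
  rcases le_total v u with h | h
  · have h1 : v ^ γ ≤ 1 := Real.rpow_le_one hv (h.trans hu1) hγ.le
    rw [min_eq_left h1]
    refine (min_le_right _ _).trans ((min_le_left _ _).trans ?_)
    rw [hvb]
    gcongr
  · refine (min_le_left _ _).trans ?_
    rw [hub]
    refine mul_le_mul_of_nonneg_left (le_min ?_ ?_) (by positivity)
    · gcongr
    · exact Real.rpow_le_one hu0 hu1 hγ.le

/-- Translating both space variables: regularity in the direction of the diagonal. -/
lemma q0_shift_le (hB : HeatKernelBounds d α κ₀ κ₁ C) (h : IsKernel d β κ₀ κ₁ κ₂ κ) (h0 : 0 < κ₀)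
    {η γ : ℝ} (hη : 0 < η) (hγ : 0 < γ) (hβ : β = η + γ) {t : ℝ}
    (ht : 0 < t) (x y a : E d) (ha : ‖a‖ ≤ 1) :
    |q0 d α κ t (x + a) (y + a) - q0 d α κ t x y| ≤
      ((|κ₂| + 2 * |κ₁|) * C + (|κ₂| + 2 * |κ₁|) * (|κ₂| + 2 * |κ₁|) * C) * ‖a‖ ^ η *
        wt d α γ t (x - y) := by
  set M := |κ₂| + 2 * |κ₁| with hM
  have hM0 : 0 ≤ M := by positivity
  have hC := hB.pos
  have hβ0 : 0 < β := by linarith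
  have hk := (kern_pos (α := α) ht (x - y)).le
  have hi := hB.integrable _ (h.isDensity y) t ht (x - y)
  have hi' := hB.integrable _ (h.isDensity (y + a)) t ht (x - y)
  have hm := fun x => (h.isDensity x).measurable
  have hmin : min (‖a‖ ^ β) (min (‖x - y‖ ^ β) 1) ≤
      ‖a‖ ^ η * min ((t ^ (1 / α) + ‖x - y‖) ^ γ) 1 :=
    min_modulus_le hη hγ hβ (norm_nonneg a) ha (norm_nonneg _)
      (by have : 0 ≤ t ^ (1 / α) := by positivity
          linarith)
  -- The mixed difference of `κ` can be paired in two ways, giving a bound by `|x - y|^β` or by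
  -- `|a|^β`; the minimum is then interpolated.
  have hbr : ∀ z, |(κ (x + a) z - κ (y + a) z) - (κ x z - κ y z)| ≤
      2 * M * min (‖a‖ ^ β) (min (‖x - y‖ ^ β) 1) := by
    intro z
    have a1 := h.abs_sub_le h0 (x + a) (y + a) z
    have a2 := h.abs_sub_le h0 x y z
    have a3 := h.abs_sub_le h0 (x + a) x z
    have a4 := h.abs_sub_le h0 (y + a) y z
    rw [add_sub_add_right_eq_sub] at a1
    rw [add_sub_cancel_left, min_eq_left (Real.rpow_le_one (norm_nonneg a) ha hβ0.le)] at a3 a4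
    have a5 := abs_sub (κ (x + a) z - κ (y + a) z) (κ x z - κ y z)
    have a6 := abs_sub (κ (x + a) z - κ x z) (κ (y + a) z - κ y z)
    rw [show κ (x + a) z - κ x z - (κ (y + a) z - κ y z) =
      κ (x + a) z - κ (y + a) z - (κ x z - κ y z) by ring] at a6
    rcases min_cases (‖a‖ ^ β) (min (‖x - y‖ ^ β) 1) with ⟨e, _⟩ | ⟨e, _⟩ <;> rw [e] <;> linarith
  have e : q0 d α κ t (x + a) (y + a) - q0 d α κ t x y =
      1 / 2 * (∫ z, diffKernel d α κ t (y + a) (x - y) z *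
        ((κ (x + a) z - κ (y + a) z) - (κ x z - κ y z))) +
      1 / 2 * ∫ z, (diffKernel d α κ t (y + a) (x - y) z - diffKernel d α κ t y (x - y) z) *
        (κ x z - κ y z) := by
    have i1 : Integrable fun z =>
        diffKernel d α κ t (y + a) (x - y) z * (κ (x + a) z - κ (y + a) z) :=
      integrable_mul_density hi' ((hm _).sub (hm _)) (h.abs_sub_le h0 (x + a) (y + a))
    have i2 : Integrable fun z => diffKernel d α κ t y (x - y) z * (κ x z - κ y z) :=
      integrable_mul_density hi ((hm _).sub (hm _)) (h.abs_sub_le h0 x y)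
    have i3 : Integrable fun z => diffKernel d α κ t (y + a) (x - y) z *
        ((κ (x + a) z - κ (y + a) z) - (κ x z - κ y z)) :=
      integrable_mul_density hi' (((hm _).sub (hm _)).sub ((hm _).sub (hm _))) hbr
    have i4 : Integrable fun z => (diffKernel d α κ t (y + a) (x - y) z -
        diffKernel d α κ t y (x - y) z) * (κ x z - κ y z) :=
      integrable_mul_density (hi'.sub hi) ((hm _).sub (hm _)) (h.abs_sub_le h0 x y)
    rw [q0_eq hB h h0 ht, q0_eq hB h h0 ht, add_sub_add_right_eq_sub, ← mul_sub,
      ← integral_sub i1 i2, ← mul_add, ← integral_add i3 i4]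
    congr 2; ext z; ring
  have b1 := abs_integral_mul_density_le hi' hbr
  have b2 := abs_integral_mul_density_le (hi'.sub hi) (h.abs_sub_le h0 x y)
  have d1 := hB.diff _ (h.isDensity (y + a)) t ht (x - y)
  -- The joint shift leaves `x - y` fixed, so the kernel changes only through its frozen density.
  -- Hence no negative power of `t` appears beyond those in the weight.
  have d2 := hB.dens_sub _ (h.isDensity (y + a)) _ (h.isDensity y) (M * ‖a‖ ^ β) (fun z => by
    have := h.abs_sub_le h0 (y + a) y z
    rwa [add_sub_cancel_left, min_eq_left (Real.rpow_le_one (norm_nonneg a) ha hβ0.le)] at this)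
    t ht (x - y)
  simp only [Pi.sub_apply, ← sub_mul, abs_mul_levy] at b1 b2
  have hmm : ‖a‖ ^ β * min (‖x - y‖ ^ β) 1 ≤ min (‖a‖ ^ β) (min (‖x - y‖ ^ β) 1) :=
    le_min (mul_le_of_le_one_right (by positivity) (min_le_right _ _))
      (mul_le_of_le_one_left (by positivity) (Real.rpow_le_one (norm_nonneg a) ha hβ0.le))
  have t1 : |∫ z, diffKernel d α κ t (y + a) (x - y) z *
      ((κ (x + a) z - κ (y + a) z) - (κ x z - κ y z))| ≤
      2 * M * C * (‖a‖ ^ η * wt d α γ t (x - y)) := by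
    simp only [diffKernel]
    refine b1.trans ?_
    calc _ ≤ 2 * M * (‖a‖ ^ η * min ((t ^ (1 / α) + ‖x - y‖) ^ γ) 1) *
          (C * kern d α t (x - y)) := by
          gcongr
          exact integral_nonneg fun z => mul_nonneg (abs_nonneg _) (levy_nonneg z)
      _ = _ := by rw [wt]; ring
  have t2 : |∫ z, (diffKernel d α κ t (y + a) (x - y) z - diffKernel d α κ t y (x - y) z) *
      (κ x z - κ y z)| ≤ M * M * C * (‖a‖ ^ η * wt d α γ t (x - y)) := by
    simp only [diffKernel, ← sub_mul]
    refine b2.trans ?_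
    calc _ ≤ M * min (‖x - y‖ ^ β) 1 * (C * (M * ‖a‖ ^ β) * kern d α t (x - y)) := by gcongr
      _ = M * M * C * (‖a‖ ^ β * min (‖x - y‖ ^ β) 1) * kern d α t (x - y) := by ring
      _ ≤ M * M * C * (‖a‖ ^ η * min ((t ^ (1 / α) + ‖x - y‖) ^ γ) 1) * kern d α t (x - y) := by
        exact mul_le_mul_of_nonneg_right
          (mul_le_mul_of_nonneg_left (hmm.trans hmin) (by positivity)) hk
      _ = _ := by rw [wt]; ring
  rw [e]
  refine (abs_add_le _ _).trans ?_
  rw [abs_mul, abs_mul, abs_of_pos (by norm_num : (0 : ℝ) < 1 / 2)]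
  have : 0 ≤ M * M * C * (‖a‖ ^ η * wt d α γ t (x - y)) :=
    mul_nonneg (by positivity) (mul_nonneg (by positivity) (wt_nonneg ht _))
  nlinarith

end Parametrix

/-! ### Joint measurability of the kernels and iterates. -/

section Measurability

variable {d : ℕ} {α : ℝ}

lemma measurable_integral_param {X Y : Type*} [MeasurableSpace X] [MeasurableSpace Y]
    {μ : Measure Y} [SFinite μ] {f : X → Y → ℝ} (hf : Measurable fun p : X × Y => f p.1 p.2) :
    Measurable fun x => ∫ y, f x y ∂μ :=
  (hf.stronglyMeasurable.integral_prod_right (ν := μ)).measurable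

lemma measurable_symbol_param {κ : E d → E d → ℝ} (hκ : Measurable (Function.uncurry κ)) :
    Measurable fun p : E d × E d => symbol d α (κ p.1) p.2 := by
  have h1 : Measurable fun p : (E d × E d) × E d => κ p.1.1 p.2 :=
    hκ.comp (measurable_fst.fst.prodMk measurable_snd)
  have h2 : Measurable fun p : (E d × E d) × E d => 1 - Real.cos (inner ℝ p.1.2 p.2) := by
    fun_prop
  have h3 : Measurable fun p : (E d × E d) × E d => ‖p.2‖ ^ (-(d : ℝ) - α) := by fun_prop
  exact measurable_integral_param ((h2.mul h1).mul h3)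

lemma measurable_heatKernel_param {κ : E d → E d → ℝ} (hκ : Measurable (Function.uncurry κ)) :
    Measurable fun p : ℝ × E d × E d => heatKernel d α (κ p.2.1) p.1 p.2.2 := by
  have h1 : Measurable fun p : (ℝ × E d × E d) × E d => symbol d α (κ p.1.2.1) p.2 :=
    Measurable.comp (f := fun p : (ℝ × E d × E d) × E d => (p.1.2.1, p.2))
      (g := fun q : E d × E d => symbol d α (κ q.1) q.2) (measurable_symbol_param hκ)
      (measurable_fst.snd.fst.prodMk measurable_snd)
  have h2 : Measurable fun p : (ℝ × E d × E d) × E d => Real.cos (inner ℝ p.2 p.1.2.2) := by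
    fun_prop
  have h3 : Measurable fun p : (ℝ × E d × E d) × E d => -p.1.1 := by fun_prop
  exact (measurable_integral_param (h2.mul (Real.measurable_exp.comp (h3.mul h1)))).const_mul _

lemma measurable_opL_param {X : Type*} [MeasurableSpace X] {k f : X → E d → ℝ} {v : X → E d}
    (hk : Measurable fun p : X × E d => k p.1 p.2) (hf : Measurable fun p : X × E d => f p.1 p.2)
    (hv : Measurable v) : Measurable fun x => opL d α (k x) (f x) (v x) := by
  have hc : ∀ a : X × E d → E d, Measurable a → Measurable fun p : X × E d => f p.1 (a p) :=
    fun a ha => hf.comp (measurable_fst.prodMk ha)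
  have hv' : Measurable fun p : X × E d => v p.1 := hv.comp measurable_fst
  have h2 : Measurable fun p : X × E d => secondDiff (f p.1) (v p.1) p.2 :=
    ((hc _ (hv'.add measurable_snd)).add (hc _ (hv'.sub measurable_snd))).sub
      ((hc _ hv').const_mul 2)
  have h3 : Measurable fun p : X × E d => ‖p.2‖ ^ (-(d : ℝ) - α) := by fun_prop
  exact (measurable_integral_param ((h2.mul hk).mul h3)).const_mul _

lemma measurable_q0 {κ : E d → E d → ℝ} (hκ : Measurable (Function.uncurry κ)) :
    Measurable fun p : ℝ × E d × E d => q0 d α κ p.1 p.2.1 p.2.2 := by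
  have hp : Measurable fun p : (ℝ × E d × E d) × E d =>
      heatKernel d α (κ p.1.2.2) p.1.1 p.2 :=
    Measurable.comp (f := fun p : (ℝ × E d × E d) × E d => (p.1.1, p.1.2.2, p.2))
      (g := fun q : ℝ × E d × E d => heatKernel d α (κ q.2.1) q.1 q.2.2)
      (measurable_heatKernel_param hκ) (measurable_fst.fst.prodMk (measurable_fst.snd.snd.prodMk measurable_snd))
  have hv : Measurable fun p : ℝ × E d × E d => p.2.1 - p.2.2 := by fun_prop
  have hk1 : Measurable fun p : (ℝ × E d × E d) × E d => κ p.1.2.1 p.2 :=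
    hκ.comp (measurable_fst.snd.fst.prodMk measurable_snd)
  have hk2 : Measurable fun p : (ℝ × E d × E d) × E d => κ p.1.2.2 p.2 :=
    hκ.comp (measurable_fst.snd.snd.prodMk measurable_snd)
  exact (measurable_opL_param (k := fun p : ℝ × E d × E d => κ p.2.1)
    (f := fun p => heatKernel d α (κ p.2.2) p.1) hk1 hp hv).sub
    (measurable_opL_param (k := fun p : ℝ × E d × E d => κ p.2.2)
    (f := fun p => heatKernel d α (κ p.2.2) p.1) hk2 hp hv)

lemma measurable_conv {f g : ℝ → E d → E d → ℝ}
    (hf : Measurable fun p : ℝ × E d × E d => f p.1 p.2.1 p.2.2)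
    (hg : Measurable fun p : ℝ × E d × E d => g p.1 p.2.1 p.2.2) :
    Measurable fun p : ℝ × E d × E d => conv f g p.1 p.2.1 p.2.2 := by
  have hin : Measurable fun q : (ℝ × E d × E d) × ℝ =>
      ∫ z, f (q.1.1 - q.2) q.1.2.1 z * g q.2 z q.1.2.2 := by
    refine measurable_integral_param (f := fun (q : (ℝ × E d × E d) × ℝ) z =>
      f (q.1.1 - q.2) q.1.2.1 z * g q.2 z q.1.2.2) ?_
    have h1 : Measurable fun q : ((ℝ × E d × E d) × ℝ) × E d => f (q.1.1.1 - q.1.2) q.1.1.2.1 q.2 :=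
      hf.comp ((measurable_fst.fst.fst.sub measurable_fst.snd).prodMk
        (measurable_fst.fst.snd.fst.prodMk measurable_snd))
    have h2 : Measurable fun q : ((ℝ × E d × E d) × ℝ) × E d => g q.1.2 q.2 q.1.1.2.2 :=
      hg.comp (measurable_fst.snd.prodMk (measurable_snd.prodMk measurable_fst.fst.snd.snd))
    exact h1.mul h2
  -- The domain of integration moves with `t`; an indicator turns this into an integral over a fixed
  -- space. The oriented integral needs both `Ioc 0 t` and `Ioc t 0`, as no sign of `t` is assumed.
  have hset : ∀ S : ℝ → Set ℝ, (∀ t, MeasurableSet (S t)) →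
      MeasurableSet {q : (ℝ × E d × E d) × ℝ | q.2 ∈ S q.1.1} →
      Measurable fun p : ℝ × E d × E d =>
        ∫ s in S p.1, ∫ z, f (p.1 - s) p.2.1 z * g s z p.2.2 := by
    intro S hS hS'
    have e : ∀ p : ℝ × E d × E d, ∫ s in S p.1, ∫ z, f (p.1 - s) p.2.1 z * g s z p.2.2 =
        ∫ s, {q : (ℝ × E d × E d) × ℝ | q.2 ∈ S q.1.1}.indicator (fun q =>
          ∫ z, f (q.1.1 - q.2) q.1.2.1 z * g q.2 z q.1.2.2) (p, s) := by
      intro p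
      rw [← integral_indicator (hS _)]
      rfl
    simp_rw [e]
    exact measurable_integral_param (f := fun (p : ℝ × E d × E d) s =>
      {q : (ℝ × E d × E d) × ℝ | q.2 ∈ S q.1.1}.indicator (fun q =>
          ∫ z, f (q.1.1 - q.2) q.1.2.1 z * g q.2 z q.1.2.2) (p, s)) (hin.indicator hS')
  unfold conv intervalIntegral
  refine (hset (fun t => Ioc 0 t) (fun _ => measurableSet_Ioc) ?_).sub
    (hset (fun t => Ioc t 0) (fun _ => measurableSet_Ioc) ?_)
  · exact (measurableSet_lt measurable_const measurable_snd).inter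
      (measurableSet_le measurable_snd measurable_fst.fst)
  · exact (measurableSet_lt measurable_fst.fst measurable_snd).inter
      (measurableSet_le measurable_snd measurable_const)

lemma measurable_qIter {κ : E d → E d → ℝ} (hκ : Measurable (Function.uncurry κ)) (n : ℕ) :
    Measurable fun p : ℝ × E d × E d => qIter d α κ n p.1 p.2.1 p.2.2 := by
  induction n with
  | zero => exact measurable_q0 hκ
  | succ n ih => exact measurable_conv (measurable_q0 hκ) ih

end Measurability

/-! ### Convolution estimates for the weights. -/

section Weights

variable {d : ℕ} {α : ℝ}

/-- The profile `(r^b ∧ 1) r^{-d-α}` of the weight `wt`. -/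
def radialWt (d : ℕ) (α b r : ℝ) : ℝ := min (r ^ b) 1 * r ^ (-(d : ℝ) - α)

lemma wt_eq_radialWt (b t : ℝ) (x : E d) : wt d α b t x = radialWt d α b (t ^ (1 / α) + ‖x‖) := rfl

lemma radialWt_eq_min {b r : ℝ} (hr : 0 < r) :
    radialWt d α b r = min (r ^ (b + (-(d : ℝ) - α))) (r ^ (-(d : ℝ) - α)) := by
  rw [radialWt, min_mul_of_nonneg _ _ (by positivity), one_mul, Real.rpow_add hr]

/-- The condition `b ≤ d + α` makes the profile a minimum of two nonincreasing powers, so only the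
loss from the dilation by `a` has to be counted. -/
lemma radialWt_le (hα : 0 < α) {b : ℝ} (hb0 : 0 ≤ b) (hb : b ≤ d + α) {a r R : ℝ} (ha : 0 < a)
    (ha1 : a ≤ 1) (hR : 0 < R) (h : a * R ≤ r) :
    radialWt d α b r ≤ a ^ (-(d : ℝ) - α) * radialWt d α b R := by
  have hd : (0 : ℝ) ≤ d := d.cast_nonneg
  have haR : 0 < a * R := by positivity
  calc radialWt d α b r ≤ radialWt d α b (a * R) := by
        rw [radialWt_eq_min (haR.trans_le h), radialWt_eq_min haR]
        exact min_le_min (Real.rpow_le_rpow_of_nonpos haR h (by linarith))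
          (Real.rpow_le_rpow_of_nonpos haR h (by linarith))
    _ ≤ min (R ^ b) 1 * (a * R) ^ (-(d : ℝ) - α) := by
        refine mul_le_mul_of_nonneg_right (min_rpow_le hb0 haR.le ?_) (by positivity)
        nlinarith
    _ = _ := by rw [Real.mul_rpow ha.le hR.le, radialWt]; ring

/-- The constant in the convolution inequality for the weights. -/
def convConst (d : ℕ) (α : ℝ) : ℝ := ((2 : ℝ) ^ (-(1 / α)) / 2) ^ (-(d : ℝ) - α)

lemma convConst_pos : 0 < convConst d α := by unfold convConst; positivity

lemma half_rpow_le {a t s : ℝ} (ha : 0 ≤ a) (ht : 0 < t) (h : t / 2 ≤ s) :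
    (2 : ℝ) ^ (-a) * t ^ a ≤ s ^ a := by
  calc (2 : ℝ) ^ (-a) * t ^ a = (t / 2) ^ a := by
        rw [Real.div_rpow ht.le two_pos.le, Real.rpow_neg two_pos.le]; ring
    _ ≤ s ^ a := Real.rpow_le_rpow (by positivity) h ha

/-- The two parabolic radii add up to at least a constant times the radius at `(t, x - y)`, because
one of `s` and `t - s` is at least `t/2`. The factor with the larger radius is therefore bounded by
its weight at `(t, x - y)`. -/
lemma wt_mul_wt_le (hα : 0 < α) {b₁ b₂ : ℝ} (h1 : 0 ≤ b₁) (h1' : b₁ ≤ d + α) (h2 : 0 ≤ b₂)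
    (h2' : b₂ ≤ d + α) {s t : ℝ} (hs : 0 < s) (hst : s < t) (x y z : E d) :
    wt d α b₁ (t - s) (x - z) * wt d α b₂ s (z - y) ≤ convConst d α *
      (wt d α b₁ t (x - y) * wt d α b₂ s (z - y) +
        wt d α b₂ t (x - y) * wt d α b₁ (t - s) (x - z)) := by
  have hτ : 0 < t - s := sub_pos.2 hst
  have ht : 0 < t := hs.trans hst
  have hc := convConst_pos (d := d) (α := α)
  have w1 := wt_nonneg (d := d) (α := α) (b := b₁) hτ (x - z)
  have w2 := wt_nonneg (d := d) (α := α) (b := b₂) hs (z - y)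
  have w3 := wt_nonneg (d := d) (α := α) (b := b₁) ht (x - y)
  have w4 := wt_nonneg (d := d) (α := α) (b := b₂) ht (x - y)
  have htri : ‖x - y‖ ≤ ‖x - z‖ + ‖z - y‖ := norm_sub_le_norm_sub_add_norm_sub x z y
  have hone : (2 : ℝ) ^ (-(1 / α)) ≤ 1 :=
    Real.rpow_le_one_of_one_le_of_nonpos one_le_two (by simp [hα.le])
  have hsum : 2 ^ (-(1 / α)) * (t ^ (1 / α) + ‖x - y‖) ≤
      ((t - s) ^ (1 / α) + ‖x - z‖) + (s ^ (1 / α) + ‖z - y‖) := by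
    have p1 : 0 ≤ (t - s) ^ (1 / α) := by positivity
    have p2 : 0 ≤ s ^ (1 / α) := by positivity
    have p3 : (2 : ℝ) ^ (-(1 / α)) * ‖x - y‖ ≤ ‖x - y‖ := mul_le_of_le_one_left (norm_nonneg _) hone
    have p4 : (2 : ℝ) ^ (-(1 / α)) * t ^ (1 / α) ≤ (t - s) ^ (1 / α) + s ^ (1 / α) := by
      rcases le_total (t / 2) s with h | h
      · linarith [half_rpow_le (by positivity : 0 ≤ 1 / α) ht h]
      · linarith [half_rpow_le (by positivity : 0 ≤ 1 / α) ht (by linarith : t / 2 ≤ t - s)]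
    linarith
  have ha : (0 : ℝ) < 2 ^ (-(1 / α)) / 2 := by positivity
  have hR : 0 < t ^ (1 / α) + ‖x - y‖ := by positivity
  rcases le_total ((s ^ (1 / α) + ‖z - y‖)) ((t - s) ^ (1 / α) + ‖x - z‖) with h | h
  · have := radialWt_le hα h1 h1' ha (by linarith) hR (by linarith :
      2 ^ (-(1 / α)) / 2 * (t ^ (1 / α) + ‖x - y‖) ≤ (t - s) ^ (1 / α) + ‖x - z‖)
    rw [← wt_eq_radialWt, ← wt_eq_radialWt, ← convConst] at this
    nlinarith [mul_le_mul_of_nonneg_right this w2, mul_nonneg hc.le (mul_nonneg w4 w1)]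
  · have := radialWt_le hα h2 h2' ha (by linarith) hR (by linarith :
      2 ^ (-(1 / α)) / 2 * (t ^ (1 / α) + ‖x - y‖) ≤ s ^ (1 / α) + ‖z - y‖)
    rw [← wt_eq_radialWt, ← wt_eq_radialWt, ← convConst] at this
    nlinarith [mul_le_mul_of_nonneg_left this w1, mul_nonneg hc.le (mul_nonneg w3 w2)]

lemma measurable_wt (b : ℝ) : Measurable fun p : ℝ × E d => wt d α b p.1 p.2 := by
  unfold wt kern; fun_prop

lemma min_rpow_le_rpow {b θ r : ℝ} (hθ : 0 ≤ θ) (hb : θ ≤ b) (hr : 0 < r) :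
    min (r ^ b) 1 ≤ r ^ θ := by
  rcases le_total r 1 with h | h
  · exact (min_le_left _ _).trans (Real.rpow_le_rpow_of_exponent_ge hr h hb)
  · exact (min_le_right _ _).trans (Real.one_le_rpow h hθ)

/-- Replacing `r^b ∧ 1` by `r^θ` makes the weight homogeneous, so that it scales to time one. For `θ
< α` the result is integrable at infinity, and this is why `θ` is kept apart from `b`, which may
exceed `α`. -/
lemma wt_le_decay {θ b s : ℝ} (hθ : 0 ≤ θ) (hb : θ ≤ b) (hs : 0 < s) (z : E d) :
    wt d α b s z ≤ (s ^ (1 / α)) ^ (-(d : ℝ) - (α - θ)) *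
      decay d (α - θ) ((s ^ (1 / α))⁻¹ • z) := by
  set ρ := s ^ (1 / α) with hρ
  have hρ0 : 0 < ρ := by positivity
  have hr : 0 < ρ + ‖z‖ := by positivity
  have e : ρ * (1 + ‖ρ⁻¹ • z‖) = ρ + ‖z‖ := by
    rw [norm_smul, Real.norm_of_nonneg (by positivity)]; field_simp
  rw [decay, ← Real.mul_rpow hρ0.le (by positivity), e, wt, kern, ← hρ]
  calc _ ≤ (ρ + ‖z‖) ^ θ * (ρ + ‖z‖) ^ (-(d : ℝ) - α) :=
        mul_le_mul_of_nonneg_right (min_rpow_le_rpow hθ hb hr) (by positivity)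
    _ = _ := by rw [← Real.rpow_add hr]; congr 1; ring

lemma integrable_wt_and_integral_le (hα : 0 < α) {θ b s : ℝ} (hθ : 0 < θ) (hθα : θ < α)
    (hb : θ ≤ b) (hs : 0 < s) :
    Integrable (wt d α b s) ∧
      ∫ z, wt d α b s z ≤ (∫ z, decay d (α - θ) z) * s ^ (θ / α - 1) := by
  set ρ := s ^ (1 / α) with hρ
  have hρ0 : 0 < ρ := by positivity
  have hi : Integrable fun z : E d =>
      ρ ^ (-(d : ℝ) - (α - θ)) * decay d (α - θ) (ρ⁻¹ • z) :=
    ((integrable_decay (sub_pos.2 hθα)).comp_smul (inv_ne_zero hρ0.ne')).const_mul _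
  have hle : ∀ z : E d, wt d α b s z ≤ ρ ^ (-(d : ℝ) - (α - θ)) * decay d (α - θ) (ρ⁻¹ • z) :=
    wt_le_decay hθ.le hb hs
  have hint : Integrable (wt d α b s) := by
    refine hi.mono' ((measurable_wt b).comp (measurable_const.prodMk measurable_id)).aestronglyMeasurable
      (ae_of_all _ fun z => ?_)
    rw [Real.norm_of_nonneg (wt_nonneg hs z)]
    exact hle z
  refine ⟨hint, (integral_mono hint hi hle).trans_eq ?_⟩
  rw [integral_const_mul, Measure.integral_comp_inv_smul volume (fun z => decay d (α - θ) z) ρ,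
    finrank_euclideanSpace_fin, abs_of_pos (by positivity), smul_eq_mul, ← Real.rpow_natCast,
    ← mul_assoc, ← Real.rpow_add hρ0, mul_comm, hρ, ← Real.rpow_mul hs.le]
  congr 2
  field_simp
  ring

/-- The integrand that dominates all convolutions. -/
def convWt (d : ℕ) (α b₁ b₂ lam t : ℝ) (x y : E d) (w : ℝ × E d) : ℝ :=
  Real.exp (lam * w.1) * (wt d α b₁ (t - w.1) (x - w.2) * wt d α b₂ w.1 (w.2 - y))

/-- The space-time measure on `(0,t] × ℝ^d`. -/
abbrev slab (d : ℕ) (t : ℝ) : Measure (ℝ × E d) :=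
  (volume.restrict (Ioc 0 t)).prod volume

lemma ae_slab (t : ℝ) : ∀ᵐ w ∂(slab d t), 0 < w.1 ∧ w.1 < t := by
  have h : ∀ᵐ s ∂(volume.restrict (Ioc (0 : ℝ) t)), 0 < s ∧ s < t := by
    rw [← restrict_Ioo_eq_restrict_Ioc]
    exact ae_restrict_mem measurableSet_Ioo
  exact Measure.quasiMeasurePreserving_fst.ae h

lemma measurable_convWt (b₁ b₂ lam t : ℝ) (x y : E d) :
    Measurable (convWt d α b₁ b₂ lam t x y) := by
  have h1 : Measurable fun w : ℝ × E d => wt d α b₁ (t - w.1) (x - w.2) := by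
    unfold wt kern; fun_prop
  have h2 : Measurable fun w : ℝ × E d => wt d α b₂ w.1 (w.2 - y) := by
    unfold wt kern; fun_prop
  exact (by fun_prop : Measurable fun w : ℝ × E d => Real.exp (lam * w.1)).mul (h1.mul h2)

lemma exp_neg_le_rpow {p v : ℝ} (hp0 : 0 ≤ p) (hp1 : p ≤ 1) (hv : 0 < v) :
    Real.exp (-v) ≤ v ^ (-p) := by
  rw [Real.exp_neg, Real.rpow_neg hv.le]
  refine inv_anti₀ (by positivity) ?_
  rcases le_total v 1 with h | h
  · exact (Real.rpow_le_one hv.le h hp0).trans (Real.one_le_exp hv.le)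
  · calc v ^ p ≤ v ^ (1 : ℝ) := Real.rpow_le_rpow_of_exponent_le h hp1
      _ ≤ Real.exp v := by rw [Real.rpow_one]; linarith [Real.add_one_le_exp v]

/-- Both exponents are nonpositive, so the smaller variable may carry the total exponent `p - 1`. No
Beta integral has to be evaluated. -/
lemma rpow_mul_rpow_le_add {p u s : ℝ} (hp : 0 ≤ p) (hp1 : 2 * p ≤ 1) (hu : 0 < u) (hs : 0 < s) :
    u ^ (-p) * s ^ (2 * p - 1) ≤ u ^ (p - 1) + s ^ (p - 1) := by
  have hu' : 0 ≤ u ^ (p - 1) := by positivity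
  have hs' : 0 ≤ s ^ (p - 1) := by positivity
  rcases le_total s u with h | h
  · calc u ^ (-p) * s ^ (2 * p - 1) ≤ s ^ (-p) * s ^ (2 * p - 1) := by
          gcongr ?_ * _
          exact Real.rpow_le_rpow_of_nonpos hs h (by linarith)
      _ = s ^ (p - 1) := by rw [← Real.rpow_add hs]; congr 1; ring
      _ ≤ _ := by linarith
  · calc u ^ (-p) * s ^ (2 * p - 1) ≤ u ^ (-p) * u ^ (2 * p - 1) := by
          gcongr _ * ?_
          exact Real.rpow_le_rpow_of_nonpos hu h (by linarith)
      _ = u ^ (p - 1) := by rw [← Real.rpow_add hu]; congr 1; ring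
      _ ≤ _ := by linarith

lemma integrableOn_singular_and_integral_le {p t : ℝ} (hp : 0 < p) (ht : 0 < t) (ht1 : t ≤ 1) :
    IntegrableOn (fun s => (t - s) ^ (p - 1) + s ^ (p - 1)) (Ioc 0 t) ∧
      ∫ s in Ioc 0 t, ((t - s) ^ (p - 1) + s ^ (p - 1)) ≤ 2 / p := by
  have h2 : IntervalIntegrable (fun s : ℝ => s ^ (p - 1)) volume 0 t :=
    intervalIntegral.intervalIntegrable_rpow' (by linarith)
  have h1 : IntervalIntegrable (fun s : ℝ => (t - s) ^ (p - 1)) volume 0 t := by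
    have := (h2.comp_sub_left t).symm
    simpa using this
  refine ⟨(intervalIntegrable_iff_integrableOn_Ioc_of_le ht.le).1 (h1.add h2), ?_⟩
  rw [← intervalIntegral.integral_of_le ht.le, intervalIntegral.integral_add h1 h2,
    intervalIntegral.integral_comp_sub_left (fun s => s ^ (p - 1)) t, sub_self, sub_zero,
    integral_rpow (Or.inl (by linarith)), sub_add_cancel, Real.zero_rpow hp.ne', sub_zero,
    ← add_div]
  have := Real.rpow_le_one ht.le ht1 hp.le
  gcongr
  linarith

/-- The spatial mass is of order `s^{2p-1}` with `p = θ/(2α)`. Half of the gain `2p` is spent on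
`e^{λs} ≤ e^{λt} (λ(t-s))^{-p}`, which yields the small factor `λ^{-p}`; the other half keeps the
time singularities integrable. -/
lemma integrable_convWt_slice_and_integral_le (hα : 0 < α) {θ b₁ b₂ : ℝ} (hθ : 0 < θ) (hθα : θ < α)
    (h1 : θ ≤ b₁) (h1' : b₁ ≤ d + α) (h2 : θ ≤ b₂) (h2' : b₂ ≤ d + α) {lam : ℝ} (hl : 0 < lam)
    {s t : ℝ} (hs : 0 < s) (hst : s < t) (x y : E d) :
    Integrable (fun z => convWt d α b₁ b₂ lam t x y (s, z)) ∧
    ∫ z, convWt d α b₁ b₂ lam t x y (s, z) ≤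
      (convConst d α * (∫ z, decay d (α - θ) z) * lam ^ (-(θ / (2 * α))) * Real.exp (lam * t) *
        (wt d α b₁ t (x - y) + wt d α b₂ t (x - y))) *
        ((t - s) ^ (θ / (2 * α) - 1) + s ^ (θ / (2 * α) - 1)) := by
  set I := ∫ z, decay d (α - θ) z with hI
  have hI0 : 0 ≤ I := integral_nonneg fun z => (decay_pos z).le
  set p := θ / (2 * α) with hp
  have hp0 : 0 < p := by positivity
  have hθp : θ / α = 2 * p := by rw [hp]; field_simp
  have hp1 : 2 * p ≤ 1 := by rw [← hθp, div_le_one hα]; exact hθα.le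
  have hτ : 0 < t - s := sub_pos.2 hst
  have ht : 0 < t := hs.trans hst
  have hc := convConst_pos (d := d) (α := α)
  obtain ⟨i1, j1⟩ := integrable_wt_and_integral_le (d := d) hα hθ hθα h1 hτ
  obtain ⟨i2, j2⟩ := integrable_wt_and_integral_le (d := d) hα hθ hθα h2 hs
  rw [← hI, hθp] at j1 j2
  have w3 := wt_nonneg (d := d) (α := α) (b := b₁) ht (x - y)
  have w4 := wt_nonneg (d := d) (α := α) (b := b₂) ht (x - y)
  have i1' : Integrable fun z => wt d α b₁ (t - s) (x - z) := i1.comp_sub_left x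
  have i2' : Integrable fun z => wt d α b₂ s (z - y) := i2.comp_sub_right y
  set D : E d → ℝ := fun z => Real.exp (lam * s) * (convConst d α *
      (wt d α b₁ t (x - y) * wt d α b₂ s (z - y) +
        wt d α b₂ t (x - y) * wt d α b₁ (t - s) (x - z))) with hD
  have hDi : Integrable D := (((i2'.const_mul _).add (i1'.const_mul _)).const_mul _).const_mul _
  have hle : ∀ z, convWt d α b₁ b₂ lam t x y (s, z) ≤ D z := fun z => by
    simp only [convWt, hD]
    exact mul_le_mul_of_nonneg_left (wt_mul_wt_le hα (hθ.le.trans h1) h1' (hθ.le.trans h2) h2'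
      hs hst x y z) (by positivity)
  have hi : Integrable (fun z => convWt d α b₁ b₂ lam t x y (s, z)) := by
    refine hDi.mono' ((measurable_convWt ..).comp
      (measurable_const.prodMk measurable_id)).aestronglyMeasurable (ae_of_all _ fun z => ?_)
    rw [Real.norm_of_nonneg]
    · exact hle z
    · exact mul_nonneg (by positivity) (mul_nonneg (wt_nonneg hτ _) (wt_nonneg hs _))
  refine ⟨hi, (integral_mono hi hDi hle).trans ?_⟩
  have e : ∫ z, D z = Real.exp (lam * s) * (convConst d α *
      (wt d α b₁ t (x - y) * (∫ z, wt d α b₂ s z) +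
        wt d α b₂ t (x - y) * ∫ z, wt d α b₁ (t - s) z)) := by
    simp only [hD]
    rw [integral_const_mul, integral_const_mul, integral_add (i2'.const_mul _) (i1'.const_mul _),
      integral_const_mul, integral_const_mul, integral_sub_right_eq_self (wt d α b₂ s) y,
      integral_sub_left_eq_self (wt d α b₁ (t - s)) volume x]
  have hexp : Real.exp (lam * s) ≤
      Real.exp (lam * t) * (lam ^ (-p) * (t - s) ^ (-p)) := by
    rw [← Real.mul_rpow hl.le hτ.le]
    calc Real.exp (lam * s) = Real.exp (lam * t) * Real.exp (-(lam * (t - s))) := by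
          rw [← Real.exp_add]; congr 1; ring
      _ ≤ _ := by
          gcongr
          exact exp_neg_le_rpow hp0.le (by linarith) (by positivity)
  set S := (t - s) ^ (p - 1) + s ^ (p - 1) with hS
  have k1 : (t - s) ^ (-p) * s ^ (2 * p - 1) ≤ S := rpow_mul_rpow_le_add hp0.le hp1 hτ hs
  have k2 : (t - s) ^ (-p) * (t - s) ^ (2 * p - 1) ≤ S := by
    rw [← Real.rpow_add hτ, hS]
    have : 0 ≤ s ^ (p - 1) := by positivity
    have e : -p + (2 * p - 1) = p - 1 := by ring
    rw [e]; linarith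
  rw [e]
  calc _ ≤ Real.exp (lam * t) * (lam ^ (-p) * (t - s) ^ (-p)) * (convConst d α *
      (wt d α b₁ t (x - y) * (I * s ^ (2 * p - 1)) +
        wt d α b₂ t (x - y) * (I * (t - s) ^ (2 * p - 1)))) := by
        have : 0 ≤ ∫ z, wt d α b₁ (t - s) z := integral_nonneg fun z => wt_nonneg hτ z
        have : 0 ≤ ∫ z, wt d α b₂ s z := integral_nonneg fun z => wt_nonneg hs z
        gcongr
    _ = convConst d α * I * lam ^ (-p) * Real.exp (lam * t) *
        (wt d α b₁ t (x - y) * ((t - s) ^ (-p) * s ^ (2 * p - 1)) +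
          wt d α b₂ t (x - y) * ((t - s) ^ (-p) * (t - s) ^ (2 * p - 1))) := by ring
    _ ≤ convConst d α * I * lam ^ (-p) * Real.exp (lam * t) *
        (wt d α b₁ t (x - y) * S + wt d α b₂ t (x - y) * S) := by gcongr
    _ = _ := by ring

/-- The space-time convolution of two weights gains the factor `λ^{-θ/(2α)}`. -/
lemma exists_integrable_convWt (d : ℕ) (hα : 0 < α) {θ : ℝ} (hθ : 0 < θ) (hθα : θ < α) :
    ∃ K : ℝ, 0 < K ∧ ∀ b₁ b₂ : ℝ, θ ≤ b₁ → b₁ ≤ d + α → θ ≤ b₂ → b₂ ≤ d + α →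
      ∀ lam : ℝ, 0 < lam → ∀ (t : ℝ) (x y : E d), 0 < t → t ≤ 1 →
        Integrable (convWt d α b₁ b₂ lam t x y) (slab d t) ∧
        ∫ w, convWt d α b₁ b₂ lam t x y w ∂(slab d t) ≤
          K * lam ^ (-(θ / (2 * α))) * Real.exp (lam * t) *
            (wt d α b₁ t (x - y) + wt d α b₂ t (x - y)) := by
  set I := ∫ z, decay d (α - θ) z with hI
  have hI0 : 0 ≤ I := integral_nonneg fun z => (decay_pos z).le
  set p := θ / (2 * α) with hp
  have hp0 : 0 < p := by positivity
  have hc := convConst_pos (d := d) (α := α)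
  refine ⟨convConst d α * I * (2 / p) + 1, by positivity, ?_⟩
  intro b₁ b₂ h1 h1' h2 h2' lam hl t x y ht ht1
  set R := convConst d α * I * lam ^ (-p) * Real.exp (lam * t) *
        (wt d α b₁ t (x - y) + wt d α b₂ t (x - y)) with hR
  have w3 := wt_nonneg (d := d) (α := α) (b := b₁) ht (x - y)
  have w4 := wt_nonneg (d := d) (α := α) (b := b₂) ht (x - y)
  have hR0 : 0 ≤ R := by positivity
  have hmem : ∀ᵐ s ∂(volume.restrict (Ioc (0 : ℝ) t)), 0 < s ∧ s < t := by
    rw [← restrict_Ioo_eq_restrict_Ioc]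
    exact ae_restrict_mem measurableSet_Ioo
  obtain ⟨hSi, hSl⟩ := integrableOn_singular_and_integral_le hp0 ht ht1
  have hm := measurable_convWt (d := d) (α := α) b₁ b₂ lam t x y
  have hnn : ∀ s, 0 < s → s < t → ∀ z, 0 ≤ convWt d α b₁ b₂ lam t x y (s, z) :=
    fun s h h' z => mul_nonneg (by positivity)
      (mul_nonneg (wt_nonneg (sub_pos.2 h') _) (wt_nonneg h _))
  have hin : Integrable (convWt d α b₁ b₂ lam t x y) (slab d t) := by
    rw [slab, integrable_prod_iff hm.aestronglyMeasurable]
    constructor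
    · filter_upwards [hmem] with s hs
      exact (integrable_convWt_slice_and_integral_le hα hθ hθα h1 h1' h2 h2' hl hs.1 hs.2 x y).1
    · refine (hSi.const_mul R).mono' ?_ ?_
      · exact hm.norm.stronglyMeasurable.integral_prod_right.aestronglyMeasurable
      · filter_upwards [hmem] with s hs
        rw [Real.norm_of_nonneg (integral_nonneg fun z => norm_nonneg _)]
        simp_rw [Real.norm_of_nonneg (hnn s hs.1 hs.2 _)]
        exact (integrable_convWt_slice_and_integral_le hα hθ hθα h1 h1' h2 h2' hl hs.1 hs.2 x y).2
  refine ⟨hin, ?_⟩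
  rw [slab, integral_prod _ hin]
  calc _ ≤ ∫ s in Ioc 0 t, R * ((t - s) ^ (p - 1) + s ^ (p - 1)) := by
        refine integral_mono_ae hin.integral_prod_left (hSi.const_mul R) ?_
        filter_upwards [hmem] with s hs
        exact (integrable_convWt_slice_and_integral_le hα hθ hθα h1 h1' h2 h2' hl hs.1 hs.2 x y).2
    _ ≤ R * (2 / p) := by
        rw [integral_const_mul]; gcongr
    _ = convConst d α * I * (2 / p) * (lam ^ (-p) * Real.exp (lam * t) *
        (wt d α b₁ t (x - y) + wt d α b₂ t (x - y))) := by rw [hR]; ring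
    _ ≤ (convConst d α * I * (2 / p) + 1) * (lam ^ (-p) * Real.exp (lam * t) *
        (wt d α b₁ t (x - y) + wt d α b₂ t (x - y))) := by
        gcongr; linarith
    _ = _ := by ring

end Weights

/-! ### Convergence of the Picard series and the integral equation. -/

section Iteration

variable {d : ℕ} {α β : ℝ} {κ : E d → E d → ℝ}

lemma conv_eq_integral_slab {f g : ℝ → E d → E d → ℝ} {t : ℝ} {x y : E d} (ht : 0 ≤ t)
    (hi : ConvIntegrable f g t x y) :
    conv f g t x y = ∫ w, f (t - w.1) x w.2 * g w.1 w.2 y ∂(slab d t) := by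
  rw [conv, intervalIntegral.integral_of_le ht, slab, integral_prod _ hi]

/-- The convolution of two weights is integrable and small relative to the weights. -/
def ConvBound (d : ℕ) (α b₁ b₂ lam r : ℝ) : Prop :=
  ∀ (t : ℝ) (x y : E d), 0 < t → t ≤ 1 →
    Integrable (convWt d α b₁ b₂ lam t x y) (slab d t) ∧
    ∫ w, convWt d α b₁ b₂ lam t x y w ∂(slab d t) ≤
      r * Real.exp (lam * t) * (wt d α b₁ t (x - y) + wt d α b₂ t (x - y))

/-- What the Picard iteration for the upper bound needs. -/
structure IterBounds (d : ℕ) (α β A lam r : ℝ) (κ : E d → E d → ℝ) : Prop where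
  measurable : Measurable (Function.uncurry κ)
  nonneg : 0 ≤ A
  lam_nonneg : 0 ≤ lam
  q0_le : ∀ (t : ℝ) (x y : E d), 0 < t → t ≤ 1 → |q0 d α κ t x y| ≤ A * wt d α β t (x - y)
  conv_wt : ConvBound d α β β lam r
  small : A * (2 * r) ≤ 1 / 2

variable {A lam r : ℝ}

lemma IterBounds.ae_le (h : IterBounds d α β A lam r κ) {g : ℝ → E d → E d → ℝ} {B : ℝ}
    {t : ℝ} (ht1 : t ≤ 1) (x : E d) {y : E d}
    (hg : ∀ s z, 0 < s → s ≤ 1 → |g s z y| ≤ B * (Real.exp (lam * s) * wt d α β s (z - y))) :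
    ∀ᵐ w ∂(slab d t), ‖q0 d α κ (t - w.1) x w.2 * g w.1 w.2 y‖ ≤
      A * B * convWt d α β β lam t x y w := by
  filter_upwards [ae_slab t] with w hw
  have hτ : 0 < t - w.1 := sub_pos.2 hw.2
  have := wt_nonneg (d := d) (α := α) (b := β) hτ (x - w.2)
  rw [norm_mul, Real.norm_eq_abs, Real.norm_eq_abs]
  calc _ ≤ A * wt d α β (t - w.1) (x - w.2) *
        (B * (Real.exp (lam * w.1) * wt d α β w.1 (w.2 - y))) :=
        mul_le_mul (h.q0_le _ _ _ hτ (by linarith)) (hg _ _ hw.1 (by linarith)) (abs_nonneg _)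
          (mul_nonneg h.nonneg this)
    _ = _ := by rw [convWt]; ring

lemma measurable_q0_mul (hκ : Measurable (Function.uncurry κ)) {g : ℝ → E d → E d → ℝ}
    (hg : Measurable fun p : ℝ × E d × E d => g p.1 p.2.1 p.2.2) (t : ℝ) (x y : E d) :
    Measurable fun w : ℝ × E d => q0 d α κ (t - w.1) x w.2 * g w.1 w.2 y := by
  have h1 : Measurable fun w : ℝ × E d => q0 d α κ (t - w.1) x w.2 :=
    Measurable.comp (f := fun w : ℝ × E d => (t - w.1, x, w.2))
      (g := fun p : ℝ × E d × E d => q0 d α κ p.1 p.2.1 p.2.2) (measurable_q0 hκ) (by fun_prop)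
  have h2 : Measurable fun w : ℝ × E d => g w.1 w.2 y :=
    Measurable.comp (f := fun w : ℝ × E d => (w.1, w.2, y))
      (g := fun p : ℝ × E d × E d => g p.1 p.2.1 p.2.2) hg (by fun_prop)
  exact h1.mul h2

lemma IterBounds.convIntegrable (h : IterBounds d α β A lam r κ) {g : ℝ → E d → E d → ℝ} {B : ℝ}
    {t : ℝ} (ht : 0 < t) (ht1 : t ≤ 1) (x : E d) {y : E d}
    (hm : AEStronglyMeasurable (fun w : ℝ × E d => q0 d α κ (t - w.1) x w.2 * g w.1 w.2 y)
      (slab d t))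
    (hg : ∀ s z, 0 < s → s ≤ 1 → |g s z y| ≤ B * (Real.exp (lam * s) * wt d α β s (z - y))) :
    ConvIntegrable (q0 d α κ) g t x y :=
  ((h.conv_wt t x y ht ht1).1.const_mul (A * B)).mono' hm (h.ae_le ht1 x hg)

/-- This is the contraction: in the norm weighted by `e^{λs}` times `wt`, convolution with `q₀`
halves the constant. -/
lemma IterBounds.integral_norm_le (h : IterBounds d α β A lam r κ) {g : ℝ → E d → E d → ℝ} {B : ℝ}
    (hB : 0 ≤ B) {t : ℝ} (ht : 0 < t) (ht1 : t ≤ 1) (x : E d) {y : E d}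
    (hg : ∀ s z, 0 < s → s ≤ 1 → |g s z y| ≤ B * (Real.exp (lam * s) * wt d α β s (z - y))) :
    ∫ w, ‖q0 d α κ (t - w.1) x w.2 * g w.1 w.2 y‖ ∂(slab d t) ≤
      B / 2 * (Real.exp (lam * t) * wt d α β t (x - y)) := by
  have hA := h.nonneg
  have hw := wt_nonneg (d := d) (α := α) (b := β) ht (x - y)
  obtain ⟨hi, hl⟩ := h.conv_wt t x y ht ht1
  calc _ ≤ ∫ w, A * B * convWt d α β β lam t x y w ∂(slab d t) :=
        integral_mono_of_nonneg (ae_of_all _ fun _ => norm_nonneg _) (hi.const_mul _)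
          (h.ae_le ht1 x hg)
    _ ≤ A * B * (r * Real.exp (lam * t) * (wt d α β t (x - y) + wt d α β t (x - y))) := by
        rw [integral_const_mul]; gcongr
    _ = A * (2 * r) * (B * (Real.exp (lam * t) * wt d α β t (x - y))) := by ring
    _ ≤ 1 / 2 * (B * (Real.exp (lam * t) * wt d α β t (x - y))) := by
        gcongr; exact h.small
    _ = _ := by ring

lemma IterBounds.abs_qIter_le (h : IterBounds d α β A lam r κ) (n : ℕ) :
    ∀ (t : ℝ) (x y : E d), 0 < t → t ≤ 1 →
      |qIter d α κ n t x y| ≤ A * (1 / 2) ^ n * (Real.exp (lam * t) * wt d α β t (x - y)) := by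
  have hA := h.nonneg
  have hl := h.lam_nonneg
  induction n with
  | zero =>
    intro t x y ht ht1
    have hw := wt_nonneg (d := d) (α := α) (b := β) ht (x - y)
    refine (h.q0_le t x y ht ht1).trans ?_
    rw [pow_zero, mul_one]
    gcongr
    exact le_mul_of_one_le_left hw (Real.one_le_exp (by positivity))
  | succ n ih =>
    intro t x y ht ht1
    have hg := fun s z (hs : 0 < s) (hs1 : s ≤ 1) => ih s z y hs hs1
    have hi := h.convIntegrable ht ht1 x
      (measurable_q0_mul h.measurable (measurable_qIter h.measurable n) t x y).aestronglyMeasurable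
      hg
    rw [qIter, conv_eq_integral_slab ht.le hi, ← Real.norm_eq_abs]
    refine (norm_integral_le_integral_norm _).trans
      ((h.integral_norm_le (by positivity) ht ht1 x hg).trans_eq ?_)
    rw [pow_succ]; ring

lemma IterBounds.convIntegrable_qIter (h : IterBounds d α β A lam r κ) (n : ℕ) {t : ℝ} (ht : 0 < t)
    (ht1 : t ≤ 1) (x y : E d) : ConvIntegrable (q0 d α κ) (qIter d α κ n) t x y :=
  h.convIntegrable ht ht1 x
    (measurable_q0_mul h.measurable (measurable_qIter h.measurable n) t x y).aestronglyMeasurable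
    fun s z hs hs1 => h.abs_qIter_le n s z y hs hs1

lemma hasSum_geometric_mul (a b : ℝ) : HasSum (fun n : ℕ => a * (1 / 2) ^ n * b) (2 * a * b) := by
  convert! (hasSum_geometric_two.mul_left a).mul_right b using 1
  ring

lemma IterBounds.summable_abs (h : IterBounds d α β A lam r κ) {t : ℝ} (ht : 0 < t)
    (ht1 : t ≤ 1) (x y : E d) : Summable fun n => |qIter d α κ n t x y| :=
  Summable.of_nonneg_of_le (fun _ => abs_nonneg _) (fun n => h.abs_qIter_le n t x y ht ht1)
    (hasSum_geometric_mul _ _).summable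

lemma IterBounds.abs_qSum_le (h : IterBounds d α β A lam r κ) {t : ℝ} (ht : 0 < t)
    (ht1 : t ≤ 1) (x y : E d) :
    |qSum d α κ t x y| ≤ 2 * A * (Real.exp (lam * t) * wt d α β t (x - y)) := by
  rw [qSum, ← Real.norm_eq_abs]
  exact tsum_of_norm_bounded (hasSum_geometric_mul _ _) fun n => h.abs_qIter_le n t x y ht ht1

lemma IterBounds.convIntegrable_qSum (h : IterBounds d α β A lam r κ) {t : ℝ} (ht : 0 < t)
    (ht1 : t ≤ 1) (x y : E d) : ConvIntegrable (q0 d α κ) (qSum d α κ) t x y := by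
  refine h.convIntegrable ht ht1 x ?_ fun s z hs hs1 => h.abs_qSum_le hs hs1 z y
  -- The sum is known to converge only for times in `(0,1]`. Almost every point of the slab has such
  -- a time, and there the integrand is a limit of measurable partial sums.
  refine aestronglyMeasurable_of_tendsto_ae atTop
    (f := fun (N : ℕ) (w : ℝ × E d) => ∑ n ∈ Finset.range N,
      q0 d α κ (t - w.1) x w.2 * qIter d α κ n w.1 w.2 y) (fun N => ?_) ?_
  · refine (Finset.measurable_sum _ fun n _ => ?_).aestronglyMeasurable
    exact measurable_q0_mul h.measurable (measurable_qIter h.measurable n) t x y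
  · filter_upwards [ae_slab t] with w hw
    have := (h.summable_abs hw.1 (by linarith) w.2 y).of_abs.hasSum
    exact (this.mul_left _).tendsto_sum_nat

/-- The term `n = 0` is split off and the rest is integrated term by term, which is allowed because
the integrals of the absolute values are dominated by a geometric series. -/
lemma IterBounds.qSum_eq (h : IterBounds d α β A lam r κ) {t : ℝ} (ht : 0 < t)
    (ht1 : t ≤ 1) (x y : E d) :
    qSum d α κ t x y = q0 d α κ t x y + conv (q0 d α κ) (qSum d α κ) t x y := by
  have hA := h.nonneg
  rw [qSum, (h.summable_abs ht ht1 x y).of_abs.tsum_eq_zero_add,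
    conv_eq_integral_slab ht.le (h.convIntegrable_qSum ht ht1 x y)]
  congr 1
  have hs : Summable fun n => ∫ w, ‖q0 d α κ (t - w.1) x w.2 * qIter d α κ n w.1 w.2 y‖
      ∂(slab d t) := by
    refine Summable.of_nonneg_of_le (fun n => integral_nonneg fun w => norm_nonneg _)
      (fun n => h.integral_norm_le (B := A * (1 / 2) ^ n) (by positivity) ht ht1 x
        fun s z hs hs1 => h.abs_qIter_le n s z y hs hs1) ?_
    simp_rw [mul_div_right_comm A _ (2 : ℝ)]
    exact (hasSum_geometric_mul (A / 2) _).summable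
  have := (hasSum_integral_of_summable_integral_norm
    (fun n => h.convIntegrable_qIter n ht ht1 x y) hs).tsum_eq
  simp only [tsum_mul_left] at this
  simp only [qSum]
  rw [← this]
  refine tsum_congr fun n => ?_
  rw [qIter, conv_eq_integral_slab ht.le (h.convIntegrable_qIter n ht ht1 x y)]

end Iteration

/-! ### Propagation of the Hölder estimate through the iteration. -/

section Hoelder

variable {d : ℕ} {α β γ η A A' lam r : ℝ} {κ : E d → E d → ℝ}

/-- Translating the space variable over part of the time interval preserves the integral. -/
lemma integrable_shear_and_integral_eq {t : ℝ} {G : ℝ × E d → ℝ} (hG : Integrable G (slab d t))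
    (c : ℝ) (h : E d) :
    Integrable (fun w => if c < w.1 then G (w.1, w.2 + h) else G w) (slab d t) ∧
      ∫ w, (if c < w.1 then G (w.1, w.2 + h) else G w) ∂(slab d t) = ∫ w, G w ∂(slab d t) := by
  set S : Set (ℝ × E d) := {w | c < w.1} with hS
  have hSm : MeasurableSet S := measurableSet_lt measurable_const measurable_fst
  set T : ℝ × E d ≃ᵐ ℝ × E d :=
    MeasurableEquiv.prodCongr (MeasurableEquiv.refl ℝ) (MeasurableEquiv.addRight h) with hT
  have hTp : MeasurePreserving T (slab d t) (slab d t) :=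
    (MeasurePreserving.id _).prod (measurePreserving_add_right volume h)
  have e : (fun w => if c < w.1 then G (w.1, w.2 + h) else G w) =
      fun w => S.indicator G (T w) + Sᶜ.indicator G w := by
    ext w
    have h1 : T w = (w.1, w.2 + h) := rfl
    by_cases hw : c < w.1 <;> simp [hS, h1, Set.indicator, hw]
  have i1 : Integrable (fun w => S.indicator G (T w)) (slab d t) :=
    (hTp.integrable_comp_emb T.measurableEmbedding).2 (hG.indicator hSm)
  have i2 := hG.indicator hSm.compl
  rw [e]
  refine ⟨i1.add i2, ?_⟩
  rw [integral_add i1 i2, hTp.integral_comp' (g := S.indicator G),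
    ← integral_add (hG.indicator hSm) i2]
  congr 1; ext w
  exact congr_fun (Set.indicator_self_add_compl S G) w

/-- Passing from the exponent `γ` to `β` costs `t^{-η/α}`. Combined with the `|x - x'|^η` of the
joint shift, this is exactly the modulus in the Hölder estimate. -/
lemma wt_le_mul_wt (hβ : β = η + γ) (hη : 0 ≤ η) {t : ℝ} (ht : 0 < t)
    (ht1 : t ^ (1 / α) ≤ 1) (x : E d) :
    wt d α γ t x ≤ (t ^ (1 / α))⁻¹ ^ η * wt d α β t x := by
  have hρ : 0 < t ^ (1 / α) := by positivity
  have hk := (kern_pos (α := α) ht x).le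
  have hr : 0 < t ^ (1 / α) + ‖x‖ := by positivity
  rw [wt, wt, ← mul_assoc]
  refine mul_le_mul_of_nonneg_right ?_ hk
  have h1 : 1 ≤ (t ^ (1 / α))⁻¹ ^ η := Real.one_le_rpow ((one_le_inv₀ hρ).2 ht1) hη
  rw [mul_min_of_nonneg _ _ (by positivity), mul_one]
  refine min_le_min ?_ h1
  rw [hβ, Real.rpow_add hr, ← mul_assoc, ← Real.mul_rpow (by positivity) hr.le]
  refine le_mul_of_one_le_left (by positivity) (Real.one_le_rpow ?_ hη)
  rw [inv_mul_eq_div, one_le_div hρ]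
  linarith [norm_nonneg x]

lemma inv_rpow_mul_le {t σ v : ℝ} (hα : 0 < α) (hη : 0 ≤ η) (ht : 0 < t) (hσ : t / 2 ≤ σ)
    (hv : 0 ≤ v) :
    ((σ ^ (1 / α))⁻¹ * v) ^ η ≤ ((2 : ℝ) ^ (1 / α)) ^ η * ((t ^ (1 / α))⁻¹ * v) ^ η := by
  have hσ0 : 0 < σ := by linarith
  rw [← Real.mul_rpow (by positivity) (by positivity), ← mul_assoc]
  refine Real.rpow_le_rpow (by positivity) (mul_le_mul_of_nonneg_right ?_ hv) hη
  have := half_rpow_le (by positivity : 0 ≤ 1 / α) ht hσ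
  rw [inv_le_comm₀ (by positivity) (by positivity), mul_inv, inv_inv,
    ← Real.rpow_neg two_pos.le]
  exact this

/-- The comparison constant for a spatial shift of the weights. -/
def shiftConst (d : ℕ) (α : ℝ) : ℝ := (1 + (2 : ℝ) ^ (1 / α))⁻¹ ^ (-(d : ℝ) - α)

lemma shiftConst_pos : 0 < shiftConst d α := by unfold shiftConst; positivity

lemma wt_add_le (hα : 0 < α) (hβ0 : 0 ≤ β) (hβ : β ≤ d + α) {s t : ℝ} (ht : 0 < t)
    (hs : t / 2 ≤ s) (x : E d) {a : E d} (ha : ‖a‖ ≤ t ^ (1 / α)) :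
    wt d α β s (x + a) ≤ shiftConst d α * wt d α β s x := by
  have hs0 : 0 < s := by linarith
  have h2 : (0 : ℝ) < 2 ^ (1 / α) := by positivity
  have hsα : 0 < s ^ (1 / α) := by positivity
  have h := half_rpow_le (by positivity : 0 ≤ 1 / α) ht hs
  rw [Real.rpow_neg two_pos.le, inv_mul_le_iff₀ h2] at h
  have htri : ‖x‖ ≤ ‖x + a‖ + ‖a‖ := by
    have := norm_sub_le (x + a) a
    rwa [add_sub_cancel_right] at this
  refine radialWt_le hα hβ0 hβ (by positivity) (inv_le_one_of_one_le₀ (by linarith))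
    (by positivity) ?_
  rw [inv_mul_le_iff₀ (by positivity)]
  nlinarith [mul_nonneg h2.le (norm_nonneg (x + a))]

/-- What the Picard iteration for the Hölder estimate needs. -/
structure HoelderBounds (d : ℕ) (α β γ η A A' lam r : ℝ) (κ : E d → E d → ℝ) : Prop
    extends IterBounds d α β A lam r κ where
  q0_sub_le : ∀ (t : ℝ) (x x' y : E d), 0 < t → t ≤ 1 → |q0 d α κ t x y - q0 d α κ t x' y| ≤
    A * ((t ^ (1 / α))⁻¹ * ‖x - x'‖) ^ η * (wt d α β t (x - y) + wt d α β t (x' - y))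
  q0_shift_le : ∀ (t : ℝ) (x y a : E d), 0 < t → t ≤ 1 → ‖a‖ ≤ 1 →
    |q0 d α κ t (x + a) (y + a) - q0 d α κ t x y| ≤ A' * ‖a‖ ^ η * wt d α γ t (x - y)
  nonneg' : 0 ≤ A'
  r_nonneg : 0 ≤ r
  conv_wt' : ConvBound d α γ β lam r
  small' : r * (2 * A * ((2 : ℝ) ^ (1 / α)) ^ η * (shiftConst d α + 2) +
    2 * A' * shiftConst d α) ≤ 1 / 2

/-- The increment of `q₀(t-s,·,z)` in `x` brings a factor `(t-s)^{-η/α}`, not integrable near `s =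
t` if `η ≥ α`, so it is used only for `s ≤ t/2`. For `s > t/2` the shifted integrand gives a joint
shift of `q₀` plus an increment of `q_n` at a time comparable to `t`. Every term is linear in `B`,
so the induction loses nothing. -/
lemma HoelderBounds.ae_le (h : HoelderBounds d α β γ η A A' lam r κ) (hα : 0 < α) (hη : 0 < η)
    (hβ0 : 0 ≤ β) (hβ : β ≤ d + α) {n : ℕ} {B t : ℝ} (hB : 0 ≤ B) (ht : 0 < t) (ht1 : t ≤ 1)
    {x x' : E d} (y : E d) (hx : ‖x - x'‖ ≤ t ^ (1 / α)) (hx1 : ‖x - x'‖ ≤ 1)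
    (hq : ∀ s z, 0 < s → s ≤ 1 →
      |qIter d α κ n s z y| ≤ B * (Real.exp (lam * s) * wt d α β s (z - y)))
    (hq' : ∀ s z z', 0 < s → s ≤ 1 → |qIter d α κ n s z y - qIter d α κ n s z' y| ≤
      B * ((s ^ (1 / α))⁻¹ * ‖z - z'‖) ^ η *
        (Real.exp (lam * s) * (wt d α β s (z - y) + wt d α β s (z' - y)))) :
    ∀ᵐ w ∂(slab d t),
      ‖(if t / 2 < w.1 then q0 d α κ (t - w.1) x (w.2 + (x - x')) *
          qIter d α κ n w.1 (w.2 + (x - x')) y else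
          q0 d α κ (t - w.1) x w.2 * qIter d α κ n w.1 w.2 y) -
        q0 d α κ (t - w.1) x' w.2 * qIter d α κ n w.1 w.2 y‖ ≤
      B * (A * ((2 : ℝ) ^ (1 / α)) ^ η * ((t ^ (1 / α))⁻¹ * ‖x - x'‖) ^ η) *
          convWt d α β β lam t x y w +
        B * (A * ((2 : ℝ) ^ (1 / α)) ^ η * (shiftConst d α + 2) *
          ((t ^ (1 / α))⁻¹ * ‖x - x'‖) ^ η) * convWt d α β β lam t x' y w +
        B * (A' * shiftConst d α * ‖x - x'‖ ^ η) * convWt d α γ β lam t x' y w := by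
  have hA := h.nonneg
  have hA' := h.nonneg'
  have hK := shiftConst_pos (d := d) (α := α)
  set K := shiftConst d α
  set L := ((2 : ℝ) ^ (1 / α)) ^ η with hL
  have hL0 : 0 ≤ L := by positivity
  set m := ((t ^ (1 / α))⁻¹ * ‖x - x'‖) ^ η with hm
  have hm0 : 0 ≤ m := by positivity
  filter_upwards [ae_slab t] with w hw
  obtain ⟨s, z⟩ := w
  obtain ⟨hs, hst⟩ : 0 < s ∧ s < t := hw
  have hτ : 0 < t - s := sub_pos.2 hst
  have w1 := wt_nonneg (d := d) (α := α) (b := β) hτ (x - z)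
  have w2 := wt_nonneg (d := d) (α := α) (b := β) hτ (x' - z)
  have w3 := wt_nonneg (d := d) (α := α) (b := γ) hτ (x' - z)
  have w4 := wt_nonneg (d := d) (α := α) (b := β) hs (z - y)
  have hv := norm_nonneg (x - x')
  simp only [convWt, Real.norm_eq_abs]
  set e := Real.exp (lam * s) with he
  have he0 : 0 ≤ e := by positivity
  split_ifs with hc
  · have k1 := h.q0_shift_le (t - s) x' z (x - x') hτ (by linarith) hx1
    rw [add_sub_cancel] at k1
    have hwt : wt d α β s (z + (x - x') - y) ≤ K * wt d α β s (z - y) := by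
      rw [add_sub_right_comm]
      exact wt_add_le hα hβ0 hβ ht hc.le _ hx
    have k2 := hq s (z + (x - x')) hs (by linarith)
    have k3 := hq' s (z + (x - x')) z hs (by linarith)
    rw [add_sub_cancel_left] at k3
    have k4 := inv_rpow_mul_le hα hη.le ht hc.le hv
    have k5 := h.q0_le (t - s) x' z hτ (by linarith)
    have e1 : q0 d α κ (t - s) x (z + (x - x')) * qIter d α κ n s (z + (x - x')) y -
        q0 d α κ (t - s) x' z * qIter d α κ n s z y =
        (q0 d α κ (t - s) x (z + (x - x')) - q0 d α κ (t - s) x' z) *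
          qIter d α κ n s (z + (x - x')) y +
        q0 d α κ (t - s) x' z * (qIter d α κ n s (z + (x - x')) y - qIter d α κ n s z y) := by
      ring
    have t1 : |(q0 d α κ (t - s) x (z + (x - x')) - q0 d α κ (t - s) x' z) *
          qIter d α κ n s (z + (x - x')) y| ≤
        B * (A' * K * ‖x - x'‖ ^ η) * (e * (wt d α γ (t - s) (x' - z) * wt d α β s (z - y))) := by
      rw [abs_mul]
      calc _ ≤ A' * ‖x - x'‖ ^ η * wt d α γ (t - s) (x' - z) *
            (B * (e * (K * wt d α β s (z - y)))) := by
            refine mul_le_mul k1 (k2.trans ?_) (abs_nonneg _) (by positivity)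
            gcongr
        _ = _ := by ring
    have t2 : |q0 d α κ (t - s) x' z *
        (qIter d α κ n s (z + (x - x')) y - qIter d α κ n s z y)| ≤
        B * (A * L * (K + 1) * m) * (e * (wt d α β (t - s) (x' - z) * wt d α β s (z - y))) := by
      rw [abs_mul]
      calc _ ≤ A * wt d α β (t - s) (x' - z) *
            (B * (L * m) * (e * (K * wt d α β s (z - y) + wt d α β s (z - y)))) := by
            refine mul_le_mul k5 (k3.trans ?_) (abs_nonneg _) (by positivity)
            have : 0 ≤ wt d α β s (z + (x - x') - y) := wt_nonneg hs _
            gcongr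
        _ = _ := by ring
    rw [e1]
    refine (abs_add_le _ _).trans ?_
    have p1 : 0 ≤ B * (A * L * m) * (e * (wt d α β (t - s) (x - z) * wt d α β s (z - y))) := by
      positivity
    have p2 : 0 ≤ B * (A * L * m) * (e * (wt d α β (t - s) (x' - z) * wt d α β s (z - y))) := by
      positivity
    linarith
  · have k1 := h.q0_sub_le (t - s) x x' z hτ (by linarith)
    have k2 := hq s z hs (by linarith)
    have k4 := inv_rpow_mul_le hα hη.le ht (by linarith : t / 2 ≤ t - s) hv
    rw [← sub_mul, abs_mul]
    have p1 : 0 ≤ B * (A * L * (K + 1) * m) *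
        (e * (wt d α β (t - s) (x' - z) * wt d α β s (z - y))) := by positivity
    have p2 : 0 ≤ B * (A' * K * ‖x - x'‖ ^ η) *
        (e * (wt d α γ (t - s) (x' - z) * wt d α β s (z - y))) := by positivity
    calc _ ≤ A * (L * m) * (wt d α β (t - s) (x - z) + wt d α β (t - s) (x' - z)) *
          (B * (e * wt d α β s (z - y))) := by
          refine mul_le_mul (k1.trans ?_) k2 (abs_nonneg _) (by positivity)
          gcongr
      _ ≤ _ := by linarith

lemma HoelderBounds.abs_qIter_sub_le (h : HoelderBounds d α β γ η A A' lam r κ) (hα : 0 < α)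
    (hη : 0 < η) (hγ : β = η + γ) (hβ0 : 0 ≤ β) (hβ : β ≤ d + α) (n : ℕ) :
    ∀ (t : ℝ) (x x' y : E d), 0 < t → t ≤ 1 →
      |qIter d α κ n t x y - qIter d α κ n t x' y| ≤
        A * (1 / 2) ^ n * ((t ^ (1 / α))⁻¹ * ‖x - x'‖) ^ η *
          (Real.exp (lam * t) * (wt d α β t (x - y) + wt d α β t (x' - y))) := by
  have hA := h.nonneg
  have hA' := h.nonneg'
  have hr := h.r_nonneg
  have hK := shiftConst_pos (d := d) (α := α)
  induction n with
  | zero =>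
    intro t x x' y ht ht1
    have w1 := wt_nonneg (d := d) (α := α) (b := β) ht (x - y)
    have w2 := wt_nonneg (d := d) (α := α) (b := β) ht (x' - y)
    refine (h.q0_sub_le t x x' y ht ht1).trans ?_
    rw [pow_zero, mul_one]
    gcongr
    exact le_mul_of_one_le_left (by positivity)
      (Real.one_le_exp (mul_nonneg h.lam_nonneg ht.le))
  | succ n ih =>
    intro t x x' y ht ht1
    have w1 := wt_nonneg (d := d) (α := α) (b := β) ht (x - y)
    have w2 := wt_nonneg (d := d) (α := α) (b := β) ht (x' - y)
    have hρ : 0 < t ^ (1 / α) := by positivity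
    have hρ1 : t ^ (1 / α) ≤ 1 := Real.rpow_le_one ht.le ht1 (by positivity)
    -- At distances beyond `t^{1/α}` the modulus is at least one and the size bound suffices.
    -- Otherwise the weights at time `s > t/2` tolerate a shift by `x - x'`.
    rcases le_total (t ^ (1 / α)) ‖x - x'‖ with hx | hx
    · have hm : 1 ≤ ((t ^ (1 / α))⁻¹ * ‖x - x'‖) ^ η := by
        refine Real.one_le_rpow ?_ hη.le
        rwa [inv_mul_eq_div, one_le_div hρ]
      have k1 := h.abs_qIter_le (n + 1) t x y ht ht1
      have k2 := h.abs_qIter_le (n + 1) t x' y ht ht1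
      calc _ ≤ |qIter d α κ (n + 1) t x y| + |qIter d α κ (n + 1) t x' y| := abs_sub _ _
        _ ≤ A * (1 / 2) ^ (n + 1) * 1 *
          (Real.exp (lam * t) * (wt d α β t (x - y) + wt d α β t (x' - y))) := by linarith
        _ ≤ _ := by gcongr
    have hi := h.convIntegrable_qIter n ht ht1 x y
    have hi' := h.convIntegrable_qIter n ht ht1 x' y
    -- Only the integral based at `x` is sheared, and its value is unchanged; subtracting the one
    -- based at `x'` gives the integrand bounded by `hae`.
    obtain ⟨hs, hse⟩ := integrable_shear_and_integral_eq hi (t / 2) (x - x')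
    set B := A * (1 / 2) ^ n with hB
    have hB0 : 0 ≤ B := by positivity
    have hae := h.ae_le hα hη hβ0 hβ (n := n) hB0 ht ht1 y hx (hx.trans hρ1)
      (fun s z hs hs1 => h.abs_qIter_le n s z y hs hs1)
      (fun s z z' hs hs1 => ih s z z' y hs hs1)
    obtain ⟨c1, c1'⟩ := h.conv_wt t x y ht ht1
    obtain ⟨c2, c2'⟩ := h.conv_wt t x' y ht ht1
    obtain ⟨c3, c3'⟩ := h.conv_wt' t x' y ht ht1
    have hγβ := wt_le_mul_wt (γ := γ) (d := d) hγ hη.le ht hρ1 (x' - y)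
    set K := shiftConst d α
    set L := ((2 : ℝ) ^ (1 / α)) ^ η with hL
    have hL0 : 0 ≤ L := by positivity
    set m := ((t ^ (1 / α))⁻¹ * ‖x - x'‖) ^ η with hm
    have hm0 : 0 ≤ m := by positivity
    have hmm : ‖x - x'‖ ^ η * (t ^ (1 / α))⁻¹ ^ η = m := by
      rw [hm, Real.mul_rpow (by positivity) (norm_nonneg _), mul_comm]
    have hone : 1 ≤ (t ^ (1 / α))⁻¹ ^ η := Real.one_le_rpow ((one_le_inv₀ hρ).2 hρ1) hη.le
    rw [qIter, conv_eq_integral_slab ht.le hi, conv_eq_integral_slab ht.le hi', ← hse,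
      ← integral_sub hs hi', ← Real.norm_eq_abs]
    have d1 := c1.const_mul (B * (A * L * m))
    have d2 := c2.const_mul (B * (A * L * (K + 2) * m))
    have d3 := c3.const_mul (B * (A' * K * ‖x - x'‖ ^ η))
    refine (norm_integral_le_of_norm_le ((d1.add d2).add d3) hae).trans ?_
    rw [integral_add' (d1.add d2) d3, integral_add' d1 d2, integral_const_mul, integral_const_mul,
      integral_const_mul]
    set e := Real.exp (lam * t) with he
    have he0 : 0 ≤ e := by positivity
    set W := wt d α β t (x - y) with hW
    set W' := wt d α β t (x' - y) with hW'
    have c3'' : ‖x - x'‖ ^ η * (∫ w, convWt d α γ β lam t x' y w ∂(slab d t)) ≤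
        r * e * (2 * m * W') := by
      calc _ ≤ ‖x - x'‖ ^ η * (r * e * ((t ^ (1 / α))⁻¹ ^ η * W' + (t ^ (1 / α))⁻¹ ^ η * W')) := by
            gcongr
            refine c3'.trans ?_
            gcongr
            exact le_mul_of_one_le_left w2 hone
        _ = r * e * (2 * (‖x - x'‖ ^ η * (t ^ (1 / α))⁻¹ ^ η) * W') := by ring
        _ = _ := by rw [hmm]
    calc _ ≤ B * (A * L * m) * (r * e * (W + W)) + B * (A * L * (K + 2) * m) *
          (r * e * (W' + W')) + B * (A' * K) * (r * e * (2 * m * W')) := by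
          have := mul_le_mul_of_nonneg_left c3'' (by positivity : 0 ≤ B * (A' * K))
          have q1 := mul_le_mul_of_nonneg_left c1' (by positivity : 0 ≤ B * (A * L * m))
          have q2 := mul_le_mul_of_nonneg_left c2' (by positivity : 0 ≤ B * (A * L * (K + 2) * m))
          linarith
      _ ≤ B * m * e * (r * (2 * A * L * (K + 2) + 2 * A' * K)) * (W + W') := by
          have p1 : 0 ≤ B * m * e * r * (A * L * (K + 1)) * W := by positivity
          have p2 : 0 ≤ B * m * e * r * (A' * K) * W := by positivity
          linarith
      _ ≤ B * m * e * (1 / 2) * (W + W') := by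
          gcongr
          exact h.small'
      _ = _ := by rw [hB, pow_succ]; ring

lemma HoelderBounds.abs_qSum_sub_le (h : HoelderBounds d α β γ η A A' lam r κ) (hα : 0 < α)
    (hη : 0 < η) (hγ : β = η + γ) (hβ0 : 0 ≤ β) (hβ : β ≤ d + α) {t : ℝ} (ht : 0 < t)
    (ht1 : t ≤ 1) (x x' y : E d) :
    |qSum d α κ t x y - qSum d α κ t x' y| ≤
      2 * A * (((t ^ (1 / α))⁻¹ * ‖x - x'‖) ^ η *
        (Real.exp (lam * t) * (wt d α β t (x - y) + wt d α β t (x' - y)))) := by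
  rw [qSum, qSum, ← (h.summable_abs ht ht1 x y).of_abs.tsum_sub
    (h.summable_abs ht ht1 x' y).of_abs, ← Real.norm_eq_abs]
  refine tsum_of_norm_bounded (hasSum_geometric_mul _ _) fun n => ?_
  rw [← mul_assoc]
  exact h.abs_qIter_sub_le hα hη hγ hβ0 hβ n t x x' y ht ht1

end Hoelder

/-! ### Return to the weights of the theorem and choice of the constants. -/

section Constants

variable {d : ℕ} {α β γ η κ₀ κ₁ κ₂ : ℝ}

/-- Subadditivity of `r ↦ r^β`, valid for `β ≤ 1`, separates the time part and the space part of the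
parabolic radius. -/
lemma wt_le_add (hβ0 : 0 < β) (hβ1 : β ≤ 1) {t : ℝ} (ht : 0 < t) (x : E d) :
    wt d α β t x ≤ (t ^ (β / α) + min (‖x‖ ^ β) 1) * kern d α t x := by
  refine mul_le_mul_of_nonneg_right ?_ (kern_pos ht x).le
  have h1 := Real.rpow_add_le_add_rpow (by positivity : 0 ≤ t ^ (1 / α)) (norm_nonneg x) hβ0.le hβ1
  rw [← Real.rpow_mul ht.le, one_div_mul_eq_div] at h1
  have h2 : 0 ≤ t ^ (β / α) := by positivity
  rcases min_cases (‖x‖ ^ β) 1 with ⟨h, _⟩ | ⟨h, _⟩ <;> rw [h]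
  · exact (min_le_left _ _).trans h1
  · exact (min_le_right _ _).trans (by linarith)

lemma wt_le_rho (hβ0 : 0 < β) (hβ1 : β ≤ 1) {t : ℝ} (ht : 0 < t) (x : E d) :
    wt d α β t x ≤ rho d α β 0 t x + rho d α 0 β t x := by
  refine (wt_le_add hβ0 hβ1 ht x).trans_eq ?_
  simp only [rho, kern, zero_div, Real.rpow_zero, min_self]
  ring

lemma inv_rpow_mul_wt_le_rho (hβ0 : 0 < β) (hβ1 : β ≤ 1) (hγ : β = η + γ) {t : ℝ} (ht : 0 < t)
    (x : E d) :
    (t ^ (1 / α))⁻¹ ^ η * wt d α β t x ≤ rho d α 0 γ t x + rho d α β (γ - β) t x := by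
  have e : (t ^ (1 / α))⁻¹ ^ η = t ^ ((γ - β) / α) := by
    rw [← Real.rpow_neg ht.le, ← Real.rpow_mul ht.le, hγ]
    congr 1; ring
  have e' : t ^ ((γ - β) / α) * t ^ (β / α) = t ^ (γ / α) := by
    rw [← Real.rpow_add ht]; congr 1; ring
  rw [e]
  refine (mul_le_mul_of_nonneg_left (wt_le_add hβ0 hβ1 ht x) (by positivity)).trans_eq ?_
  simp only [rho, kern, Real.rpow_zero, min_self, ← e']
  ring

/-- Uniform constants for the Picard iteration. -/
lemma exists_hoelderBounds (hd : 1 ≤ d) (hα0 : 0 < α) (hα2 : α < 2) (hβ1 : β < 1) (h0 : 0 < κ₀)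
    (κ₁ κ₂ : ℝ) (hγ : 0 < γ) (hγβ : γ < β) :
    ∃ A A' lam r : ℝ, ∀ κ, IsKernel d β κ₀ κ₁ κ₂ κ →
      HoelderBounds d α β γ (β - γ) A A' lam r κ := by
  obtain ⟨C, hB⟩ := exists_heatKernelBounds hd hα0 hα2 h0 κ₁
  have hC := hB.pos
  have hβ0 : 0 < β := hγ.trans hγβ
  have hd' : (1 : ℝ) ≤ d := by exact_mod_cast hd
  set M := |κ₂| + 2 * |κ₁| with hM
  have hM0 : 0 ≤ M := by positivity
  -- Here `θ` has to lie below both exponents `γ` and `β` and strictly below `α`, while `γ` itself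
  -- need not be less than `α`.
  obtain ⟨K, hK, hconv⟩ := exists_integrable_convWt d hα0 (θ := min γ (α / 2)) (by positivity)
    ((min_le_right _ _).trans_lt (by linarith))
  set p := min γ (α / 2) / (2 * α) with hp
  have hp0 : 0 < p := by positivity
  have hS := shiftConst_pos (d := d) (α := α)
  set A := M * C with hA
  set A' := M * C + M * M * C with hA'
  have hA0 : 0 ≤ A := by positivity
  set Q₀ := 2 * A * ((2 : ℝ) ^ (1 / α)) ^ (β - γ) * (shiftConst d α + 2) +
    2 * A' * shiftConst d α with hQ₀
  have hQ₀0 : 0 ≤ Q₀ := by positivity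
  -- With `λ = R^{1/p}` the convolution constant is `K λ^{-p} = K / R`, and `R` is large enough for
  -- both smallness conditions at once.
  set R := 2 * K * (Q₀ + 2 * A) + 1 with hR
  have hR0 : 0 < R := by positivity
  have hlp : (R ^ (1 / p)) ^ (-p) = R⁻¹ := by
    rw [← Real.rpow_mul hR0.le, ← Real.rpow_neg_one]
    congr 1; field_simp
  have hsm : K * R⁻¹ * (Q₀ + 2 * A) ≤ 1 / 2 := by
    rw [mul_right_comm, ← div_eq_mul_inv, div_le_iff₀ hR0, hR]; linarith
  have hr0 : 0 ≤ K * R⁻¹ := by positivity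
  have hθ1 : min γ (α / 2) ≤ γ := min_le_left _ _
  have hcw : ∀ b, γ ≤ b → b ≤ β → ConvBound d α b β (R ^ (1 / p)) (K * R⁻¹) := by
    intro b hb hb' t x y ht ht1
    have := hconv b β (by linarith) (by linarith) (by linarith) (by linarith) (R ^ (1 / p))
      (by positivity) t x y ht ht1
    rwa [hlp] at this
  refine ⟨A, A', R ^ (1 / p), K * R⁻¹, fun κ h => ?_⟩
  exact {
    measurable := h.measurable
    nonneg := hA0
    lam_nonneg := by positivity
    q0_le := fun t x y ht _ => q0_abs_le hB h h0 hβ0.le ht x y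
    conv_wt := hcw β hγβ.le le_rfl
    small := by nlinarith [mul_nonneg hr0 hQ₀0]
    q0_sub_le := fun t x x' y ht ht1 =>
      q0_sub_le hB h h0 hα0 hβ0 hβ1.le (by linarith) (by linarith) ht ht1 x x' y
    q0_shift_le := fun t x y a ht _ ha =>
      q0_shift_le hB h h0 (by linarith) hγ (by ring) ht x y a ha
    nonneg' := by positivity
    r_nonneg := hr0
    conv_wt' := hcw γ le_rfl hγβ.le
    small' := by nlinarith [mul_nonneg hr0 hA0] }

lemma exists_abs_qSum_le (hd : 1 ≤ d) (hα0 : 0 < α) (hα2 : α < 2) (hβ0 : 0 < β) (hβ1 : β < 1)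
    (h0 : 0 < κ₀) (κ₁ κ₂ : ℝ) :
    ∃ C : ℝ, 0 < C ∧ ∀ κ, IsKernel d β κ₀ κ₁ κ₂ κ → ∀ (t : ℝ) (x y : E d), 0 < t → t ≤ 1 →
      |qSum d α κ t x y| ≤ C * (rho d α β 0 t (x - y) + rho d α 0 β t (x - y)) := by
  -- Only the size estimates are needed here, so any exponent strictly between `0` and `β` would do.
  obtain ⟨A, A', lam, r, H⟩ := exists_hoelderBounds (γ := β / 2) hd hα0 hα2 hβ1 h0 κ₁ κ₂
    (by linarith) (by linarith)
  refine ⟨2 * |A| * Real.exp |lam| + 1, by positivity, fun κ h t x y ht ht1 => ?_⟩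
  have hA := (H κ h).nonneg
  have hl := (H κ h).lam_nonneg
  rw [abs_of_nonneg hA, abs_of_nonneg hl]
  have hw := wt_nonneg (d := d) (α := α) (b := β) ht (x - y)
  have he : Real.exp (lam * t) ≤ Real.exp lam :=
    Real.exp_le_exp.2 (mul_le_of_le_one_right hl ht1)
  calc _ ≤ 2 * A * (Real.exp (lam * t) * wt d α β t (x - y)) := (H κ h).abs_qSum_le ht ht1 x y
    _ ≤ 2 * A * (Real.exp lam * wt d α β t (x - y)) := by gcongr
    _ ≤ (2 * A * Real.exp lam + 1) * wt d α β t (x - y) := by linarith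
    _ ≤ _ := by
      gcongr
      exact wt_le_rho hβ0 hβ1.le ht _

lemma exists_abs_qSum_sub_le (hd : 1 ≤ d) (hα0 : 0 < α) (hα2 : α < 2) (hβ0 : 0 < β) (hβ1 : β < 1)
    (h0 : 0 < κ₀) (κ₁ κ₂ : ℝ) (hγ : 0 < γ) (hγβ : γ < β) :
    ∃ C : ℝ, 0 < C ∧ ∀ κ, IsKernel d β κ₀ κ₁ κ₂ κ → ∀ (t : ℝ) (x x' y : E d), 0 < t → t ≤ 1 →
      |qSum d α κ t x y - qSum d α κ t x' y| ≤ C * min (‖x - x'‖ ^ (β - γ)) 1 *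
        ((rho d α 0 γ t (x - y) + rho d α β (γ - β) t (x - y)) +
          (rho d α 0 γ t (x' - y) + rho d α β (γ - β) t (x' - y))) := by
  obtain ⟨A, A', lam, r, H⟩ := exists_hoelderBounds hd hα0 hα2 hβ1 h0 κ₁ κ₂ hγ hγβ
  have hd' : (1 : ℝ) ≤ d := by exact_mod_cast hd
  have hη : 0 < β - γ := by linarith
  refine ⟨2 * |A| * Real.exp |lam| + 1, by positivity, fun κ h t x x' y ht ht1 => ?_⟩
  have hA := (H κ h).nonneg
  have hl := (H κ h).lam_nonneg
  rw [abs_of_nonneg hA, abs_of_nonneg hl]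
  have w1 := wt_nonneg (d := d) (α := α) (b := β) ht (x - y)
  have w2 := wt_nonneg (d := d) (α := α) (b := β) ht (x' - y)
  have he : Real.exp (lam * t) ≤ Real.exp lam :=
    Real.exp_le_exp.2 (mul_le_of_le_one_right hl ht1)
  have hρ : 0 < t ^ (1 / α) := by positivity
  have hρ1 : t ^ (1 / α) ≤ 1 := Real.rpow_le_one ht.le ht1 (by positivity)
  have hone : 1 ≤ (t ^ (1 / α))⁻¹ ^ (β - γ) := Real.one_le_rpow ((one_le_inv₀ hρ).2 hρ1) hη.le
  set N := (t ^ (1 / α))⁻¹ ^ (β - γ) with hN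
  set u := ‖x - x'‖ ^ (β - γ) with hu
  have hu0 : 0 ≤ u := by positivity
  have key : |qSum d α κ t x y - qSum d α κ t x' y| ≤ 2 * A * Real.exp lam * min u 1 *
      (N * wt d α β t (x - y) + N * wt d α β t (x' - y)) := by
    -- The Hölder bound serves when the minimum is the power of `|x - x'|`, the size bound when it
    -- is one. In the second case inserting `N ≥ 1` loses nothing that is needed.
    rcases min_cases u 1 with ⟨hm, _⟩ | ⟨hm, _⟩ <;> rw [hm]
    · calc _ ≤ 2 * A * (((t ^ (1 / α))⁻¹ * ‖x - x'‖) ^ (β - γ) *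
            (Real.exp (lam * t) * (wt d α β t (x - y) + wt d α β t (x' - y)))) :=
            (H κ h).abs_qSum_sub_le hα0 hη (by ring) hβ0.le (by linarith) ht ht1 x x' y
        _ = 2 * A * Real.exp (lam * t) * u *
            (N * wt d α β t (x - y) + N * wt d α β t (x' - y)) := by
            rw [Real.mul_rpow (by positivity) (norm_nonneg _)]; ring
        _ ≤ _ := by gcongr
    · have k1 := (H κ h).abs_qSum_le ht ht1 x y
      have k2 := (H κ h).abs_qSum_le ht ht1 x' y
      calc _ ≤ |qSum d α κ t x y| + |qSum d α κ t x' y| := abs_sub _ _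
        _ ≤ 2 * A * Real.exp (lam * t) * 1 *
            (1 * wt d α β t (x - y) + 1 * wt d α β t (x' - y)) := by linarith
        _ ≤ _ := by gcongr
  refine key.trans ?_
  gcongr
  · linarith
  · exact inv_rpow_mul_wt_le_rho hβ0 hβ1.le (by ring) ht _
  · exact inv_rpow_mul_wt_le_rho hβ0 hβ1.le (by ring) ht _

end Constants

end

end StableLike

theorem theorem3p1 (d : ℕ) (hd : 1 ≤ d) (α : ℝ) (hα0 : 0 < α) (hα2 : α < 2)
    (β : ℝ) (hβ0 : 0 < β) (hβ1 : β < 1) (κ₀ κ₁ κ₂ : ℝ) (hκ₀ : 0 < κ₀) :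
    -- the objects are well defined, the series converges absolutely and solves the equation
    (∀ κ : StableLike.E d → StableLike.E d → ℝ, StableLike.IsKernel d β κ₀ κ₁ κ₂ κ →
      (∀ y, StableLike.IsHeatKernel d α (κ y) (StableLike.heatKernel d α (κ y))) ∧
      (∀ (t : ℝ) (x y : StableLike.E d), 0 < t → t ≤ 1 →
        (∀ v, MeasureTheory.Integrable (fun z =>
          StableLike.secondDiff (StableLike.heatKernel d α (κ y) t) v z * κ x z *
            ‖z‖ ^ (-(d : ℝ) - α))) ∧
        (∀ n, StableLike.ConvIntegrable (StableLike.q0 d α κ) (StableLike.qIter d α κ n) t x y) ∧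
        Summable (fun n => |StableLike.qIter d α κ n t x y|) ∧
        StableLike.ConvIntegrable (StableLike.q0 d α κ) (StableLike.qSum d α κ) t x y ∧
        StableLike.qSum d α κ t x y =
          StableLike.q0 d α κ t x y +
            StableLike.conv (StableLike.q0 d α κ) (StableLike.qSum d α κ) t x y)) ∧
    -- the pointwise bound, with a constant depending only on d, α, β, κ₀, κ₁, κ₂
    (∃ C₁ : ℝ, 0 < C₁ ∧
      ∀ κ : StableLike.E d → StableLike.E d → ℝ, StableLike.IsKernel d β κ₀ κ₁ κ₂ κ →
        ∀ (t : ℝ) (x y : StableLike.E d), 0 < t → t ≤ 1 →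
          |StableLike.qSum d α κ t x y| ≤
            C₁ * (StableLike.rho d α β 0 t (x - y) + StableLike.rho d α 0 β t (x - y))) ∧
    -- the Hölder estimate, with a constant depending only on d, α, β, γ, κ₀, κ₁, κ₂
    (∀ γ : ℝ, 0 < γ → γ < β → ∃ C₂ : ℝ, 0 < C₂ ∧
      ∀ κ : StableLike.E d → StableLike.E d → ℝ, StableLike.IsKernel d β κ₀ κ₁ κ₂ κ →
        ∀ (t : ℝ) (x x' y : StableLike.E d), 0 < t → t ≤ 1 →
          |StableLike.qSum d α κ t x y - StableLike.qSum d α κ t x' y| ≤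
            C₂ * min (‖x - x'‖ ^ (β - γ)) 1 *
              ((StableLike.rho d α 0 γ t (x - y) + StableLike.rho d α β (γ - β) t (x - y)) +
               (StableLike.rho d α 0 γ t (x' - y) +
                StableLike.rho d α β (γ - β) t (x' - y)))) := by
  refine ⟨fun κ h => ⟨fun y => StableLike.isHeatKernel hd hα0 hα2 hκ₀ (h.isDensity y), ?_⟩,
    StableLike.exists_abs_qSum_le hd hα0 hα2 hβ0 hβ1 hκ₀ κ₁ κ₂,
    fun γ hγ hγβ => StableLike.exists_abs_qSum_sub_le hd hα0 hα2 hβ0 hβ1 hκ₀ κ₁ κ₂ hγ hγβ⟩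
  obtain ⟨C, hB⟩ := StableLike.exists_heatKernelBounds hd hα0 hα2 hκ₀ κ₁
  obtain ⟨A, A', lam, r, H⟩ := StableLike.exists_hoelderBounds (γ := β / 2) hd hα0 hα2 hβ1 hκ₀
    κ₁ κ₂ (by linarith) (by linarith)
  have hI := (H κ h).toIterBounds
  refine fun t x y ht ht1 => ⟨fun v => ?_, fun n => hI.convIntegrable_qIter n ht ht1 x y,
    hI.summable_abs ht ht1 x y, hI.convIntegrable_qSum ht ht1 x y, hI.qSum_eq ht ht1 x y⟩
  refine (StableLike.integrable_mul_density (hB.integrable _ (h.isDensity y) t ht v)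
    (h.isDensity x).measurable ((h.isDensity x).abs_le hκ₀)).congr
      (Filter.Eventually.of_forall fun z => ?_)
  simp only [StableLike.levy]
  ring
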